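/- Let $m>1$, let $l\ge 0$ with $l\le m$, and let $X_m=L_1\big((0,\infty),(1+x^m)\,dx\big)$ (real-valued functions). Assume: - $r:(0,\infty)\to(0,\infty)$ is continuous, $r(x)\le r_0(1+x)$ for some constant $r_0$, and $\int_0^1 \frac{dx}{r(x)}<\infty$; - $a\ge 0$ is measurable on $(0,\infty)$ and essentially bounded on $(0,M]$ for every $M>0$; - $b\ge 0$ is a measurable function on $(0,\infty)^2$ with $b(x,y)=0$ for $x>y$; writing $n_k(y)=\int_0^y x^k b(x,y)\,dx$, for every $y>0$ we have $n_1(y)=y$ and $n_0(y)\le b_0(1+y^l)$ with a constant $b_0$; and $\liminf_{y\to\infty}\big(1-n_{m_0}(y)/y^{m_0}\big)>0$ for some $m_0>1$; - $\beta\ge 0$ is measurable on $(0,\infty)$ and $\operatorname{ess\,sup}_{x>0}\beta(x)/(1+x^m)<\infty$. Let $K_{\beta,m}$ be the operator in $X_m$ given by $$K_{\beta,m}u=-\partial_x(ru)-au+\int_x^\infty a(y)b(x,y)u(y)\,dy,$$ $$D(K_{\beta,m})=\Big\{u\in X_m:\ \partial_x(ru),\,au\in X_m,\ \lim_{x\to0^+}r(x)u(x)=\int_0^\infty\beta(y)u(y)\,dy\Big\},$$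 where $\partial_x$ is the distributional derivative on $(0,\infty)$ and the limit is that of the continuous representative of $ru$. For a measurable function $f$ on $(0,\infty)$ let $\operatorname{supp} f$ be its essential support, that is, the complement of the largest open set on which $f=0$ almost everywhere; $\sup\emptyset=-\infty$. For $y>0$ put $\mathfrak b(y)=\inf\operatorname{supp} b(\cdot,y)$ if $a(y)>0$, and $\mathfrak b(y)=y$ if $a(y)=0$. For $z\ge0$ put $\mathfrak c(z)=\operatorname{ess\,inf}_{y\ge z}\mathfrak b(y)$. For $z>0$ the iterates $\mathfrak c^{(n)}(z)$ are nonincreasing in $n$ and nonnegative; let $\mathfrak c_\infty(z)=\lim_{n\to\infty}\mathfrak c^{(n)}(z)$ and $\bar{\mathfrak c}=\sup_{z>0}\mathfrak c_\infty(z)\in[0,\infty]$. **Theorem.** The operator $K_{\beta,m}$ generates a strongly continuous semigroup $(S_{K_{\beta,m}}(t))_{t\ge0}$ on $X_m$, and this semigroup is positive. It is irreducible (the only closed order ideals of the Banach lattice $X_m$ that are invariant under all $S_{K_{\beta,m}}(t)$, $t\ge 0$, are $\{0\}$ and $X_m$) if and only if $$\sup\operatorname{supp}\beta=\infty\quad\text{or}\quad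 \sup\operatorname{supp}\beta>\bar{\mathfrak c}\quad\text{or}\quad\bar{\mathfrak c}=0 .$$ -/

import Mathlib

open MeasureTheory Set Filter Topology
open scoped NNReal ENNReal ContDiff

noncomputable section

namespace GrowthFrag

/-! ### The state space -/

/-- The measure `(1 + x ^ m) dx` on the half-line `(0, ∞)`. -/
def weightMeasure (m : ℝ) : Measure ℝ :=
  (volume.restrict (Ioi (0 : ℝ))).withDensity (fun x => ENNReal.ofReal (1 + x ^ m))

/-- The Banach lattice `X_m = L₁((0, ∞), (1 + x ^ m) dx)`. -/
abbrev XSpace (m : ℝ) : Type := Lp ℝ 1 (weightMeasure m)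

/-! ### Strongly continuous semigroups, generators, positivity, irreducibility -/

section Semigroup

variable {E : Type*} [NormedAddCommGroup E] [NormedSpace ℝ E]

/-- `(S t)_{t ≥ 0}` is a strongly continuous semigroup of bounded linear operators. -/
structure IsC0Semigroup (S : ℝ≥0 → E →L[ℝ] E) : Prop where
  map_zero : S 0 = ContinuousLinearMap.id ℝ E
  map_add : ∀ s t : ℝ≥0, S (s + t) = (S s).comp (S t)
  tendsto_zero : ∀ f : E, Tendsto (fun t : ℝ≥0 => S t f) (𝓝[>] 0) (𝓝 f)

/-- The graph of the infinitesimal generator of `S`: the pairs `(u, f)` such that `u` is in the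
domain of the generator, which maps it to `f`. -/
def generatorGraph (S : ℝ≥0 → E →L[ℝ] E) : Set (E × E) :=
  {p | Tendsto (fun t : ℝ≥0 => ((t : ℝ)⁻¹) • (S t p.1 - p.1)) (𝓝[>] 0) (𝓝 p.2)}

/-- `S` is a strongly continuous semigroup whose generator is the operator with graph `G`. -/
def IsSemigroupGeneratedBy (S : ℝ≥0 → E →L[ℝ] E) (G : Set (E × E)) : Prop :=
  IsC0Semigroup S ∧ generatorGraph S = G

/-- Positivity of a semigroup on an ordered space. -/
def IsPositiveSemigroup [PartialOrder E] (S : ℝ≥0 → E →L[ℝ] E) : Prop :=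
  ∀ (t : ℝ≥0) (f : E), 0 ≤ f → 0 ≤ S t f

/-- A linear subspace of a vector lattice is an (order) ideal if `|g| ≤ |f|` and `f ∈ I` imply
`g ∈ I`. -/
def IsLatticeIdeal [Lattice E] (I : Submodule ℝ E) : Prop :=
  ∀ f ∈ I, ∀ g : E, |g| ≤ |f| → g ∈ I

/-- A semigroup on a Banach lattice is irreducible if the only closed ideals that are invariant
under the semigroup are `{0}` and the whole space. -/
def IsIrreducibleSemigroup [Lattice E] (S : ℝ≥0 → E →L[ℝ] E) : Prop :=
  ∀ I : Submodule ℝ E, IsClosed (I : Set E) → IsLatticeIdeal I →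
    (∀ (t : ℝ≥0), ∀ f ∈ I, S t f ∈ I) → I = ⊥ ∨ I = ⊤

end Semigroup

/-! ### The growth-fragmentation operator -/

/-- `w` is the distributional derivative of `g` on `(0, ∞)`. -/
def IsWeakDeriv (g w : ℝ → ℝ) : Prop :=
  ∀ φ : ℝ → ℝ, ContDiff ℝ ∞ φ → HasCompactSupport φ → tsupport φ ⊆ Ioi 0 →
    ∫ x in Ioi (0 : ℝ), g x * deriv φ x = - ∫ x in Ioi (0 : ℝ), w x * φ x

/-- `lim_{x → 0+} g(x) = c`, for a function `g` on `(0, ∞)` that is given up to null sets and has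
a (necessarily unique) continuous representative on `(0, ∞)`. -/
def HasTraceAtZero (g : ℝ → ℝ) (c : ℝ) : Prop :=
  ∃ G : ℝ → ℝ, ContinuousOn G (Ioi 0) ∧ (∀ᵐ x ∂(volume.restrict (Ioi (0 : ℝ))), G x = g x) ∧
    Tendsto G (𝓝[>] 0) (𝓝 c)

/-- The gain term `(ℬ u)(x) = ∫_x^∞ a(y) b(x, y) u(y) dy`. -/
def gain (a : ℝ → ℝ) (b : ℝ → ℝ → ℝ) (u : ℝ → ℝ) (x : ℝ) : ℝ :=
  ∫ y in Ioi x, a y * b x y * u y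

/-- The graph of `K_{β,m}`: the pairs `(u, f)` in `X_m × X_m` such that `∂ₓ(r u)` and `a u` are in
`X_m`, `lim_{x → 0+} r(x) u(x) = ∫ β u`, and `f = -∂ₓ(r u) - a u + ℬ u`. -/
def operatorGraph (r a β : ℝ → ℝ) (b : ℝ → ℝ → ℝ) (m : ℝ) : Set (XSpace m × XSpace m) :=
  {p | ∃ w : ℝ → ℝ,
    IsWeakDeriv (fun x => r x * p.1 x) w ∧
    MemLp w 1 (weightMeasure m) ∧
    MemLp (fun x => a x * p.1 x) 1 (weightMeasure m) ∧
    HasTraceAtZero (fun x => r x * p.1 x) (∫ y in Ioi (0 : ℝ), β y * p.1 y) ∧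
    ∀ᵐ x ∂(weightMeasure m), p.2 x = - w x - a x * p.1 x + gain a b (fun y => p.1 y) x}

/-! ### The fragmentation kernel -/

/-- The moment `n_k(y) = ∫_0^y x ^ k b(x, y) dx`, as an extended non-negative number. -/
def fragMoment (b : ℝ → ℝ → ℝ) (k y : ℝ) : ℝ≥0∞ :=
  ∫⁻ x in Ioc (0 : ℝ) y, ENNReal.ofReal (x ^ k * b x y)

/-- `N_k(y) = y ^ k - n_k(y)`. -/
def momentDefect (b : ℝ → ℝ → ℝ) (k y : ℝ) : ℝ :=
  y ^ k - (fragMoment b k y).toReal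

/-! ### Essential supports and the threshold `c̄` -/

/-- The essential support of a function on `(0, ∞)`: the points of `ℝ` without a neighbourhood
on which (within `(0, ∞)`) the function vanishes almost everywhere. -/
def essSupport (f : ℝ → ℝ) : Set ℝ :=
  {x | ∀ U ∈ 𝓝 x, ¬ ∀ᵐ y ∂(volume.restrict (U ∩ Ioi 0)), f y = 0}

/-- `sup supp f` in `[-∞, ∞]` (with `sup ∅ = -∞`). -/
def supSupp (f : ℝ → ℝ) : EReal :=
  ⨆ x ∈ essSupport f, (x : EReal)

open Classical in
/-- `𝔟(y) = inf supp b(·, y)` for sizes `y` that fragment, and `𝔟(y) = y` where `a(y) = 0`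
(particles of such sizes do not split). -/
def minDaughter (a : ℝ → ℝ) (b : ℝ → ℝ → ℝ) (y : ℝ) : ℝ :=
  if a y = 0 then y else sInf (essSupport (fun x => b x y))

/-- `𝔠(z) = ess inf_{y ≥ z} 𝔟(y)`. -/
def cMap (a : ℝ → ℝ) (b : ℝ → ℝ → ℝ) (z : ℝ) : ℝ :=
  essInf (minDaughter a b) (volume.restrict (Ici z))

/-- `𝔠_∞(z) = lim_{n → ∞} 𝔠^{(n)}(z)`. -/
def cLim (a : ℝ → ℝ) (b : ℝ → ℝ → ℝ) (z : ℝ) : ℝ :=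
  limUnder atTop (fun n : ℕ => (cMap a b)^[n] z)

/-- `c̄ = sup_{z > 0} 𝔠_∞(z)` in `[0, ∞]`. -/
def cBar (a : ℝ → ℝ) (b : ℝ → ℝ → ℝ) : EReal :=
  ⨆ z ∈ Ioi (0 : ℝ), (cLim a b z : EReal)

end GrowthFrag

end

noncomputable section

namespace GrowthFrag

/-! ### Exponentials of bounded operators -/

section Exponential

variable {E : Type*} [NormedAddCommGroup E] [NormedSpace ℝ E]

/-! Generation. The weight 1 + x^m is replaced by an equivalent one, 1 + κ x^m. The liminf condition
says that large particles, when they split, lose a fixed fraction of their m₀-th moment;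
interpolation with the conserved first moment transfers this to the m-th moment
(`fragMoment_le_of_defect`), and a large κ makes the loss outweigh the increase in the number of
particles (`exists_coeffs`). In the new weight the gain is therefore at most (1 - η) times the loss
plus C times the norm (`wInt_gainE_le`). The transport equation (r u)' + (c + a) u = g is solved
with an integrating factor, and its solution controls a u as well as u
(`lintegral_transportSol_le`). So the gain is absorbed with η to spare, while drift, births and the
bounded part of the gain each cost one C: for c > 3C, solutions of (c - K) u = f satisfy (c - 3C)
N(u) ≤ N(f) in the weighted norm N (`apriori`). For f ≥ 0 a solution is the limit of a monotone
iteration started at 0 among [0, ∞]-valued functions (`exists_minimal_solution`), so the resolvent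
exists and is positive. The domain is dense because φ / r, with φ a test function, violates only the
boundary condition, and correcting a boundary defect k costs at most |k| / (c - 3C). Yosida
approximation then yields the semigroup, and it inherits positivity from the resolvent.

Irreducibility. A closed subspace is invariant under the semigroup as soon as it is invariant under
the resolvents at all c > 3C, and invariance under the semigroup gives invariance under the
resolvent at large c. Growth only moves mass upwards: if f ≥ 0 does not vanish on (0, y), the
resolvent of f is strictly positive on [y, ∞). Hence the only possible obstruction is an ideal of
functions vanishing on some (0, z) with z > 0, and this ideal is invariant exactly when particles
larger than z neither give birth nor produce fragments smaller than z (`IsTrap`,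
`isIrreducibleSemigroup_iff`). A trap at z means z ≤ 𝔠(z), that is, z is a fixed point of 𝔠,
together with sup supp β ≤ z (`isTrap_iff`). All limits 𝔠_∞(z) are fixed points, every positive
fixed point is such a limit, and c̄ is itself a fixed point when it is finite. So a trap is absent
exactly under the stated alternative (`forall_fixedPoint_lt_iff`). -/

lemma seminorm_pow_apply_le {N : Seminorm ℝ E} {B : E →L[ℝ] E} {q : ℝ} (hq : 0 ≤ q)
    (hB : ∀ x, N (B x) ≤ q * N x) (k : ℕ) (x : E) : N ((B ^ k) x) ≤ q ^ k * N x := by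
  induction k with
  | zero => simp
  | succ k ih =>
    rw [pow_succ', mul_apply_eq_comp, pow_succ', mul_assoc]
    exact (hB _).trans (mul_le_mul_of_nonneg_left ih hq)

variable [CompleteSpace E]

lemma hasSum_exp_apply (B : E →L[ℝ] E) (x : E) :
    HasSum (fun k : ℕ => ((k.factorial : ℝ)⁻¹) • (B ^ k) x) (NormedSpace.exp B x) := by
  have h := NormedSpace.exp_series_hasSum_exp' (𝕂 := ℝ) B
  have := (ContinuousLinearMap.apply ℝ E x).hasSum h
  simpa using this

lemma seminorm_exp_apply_le {N : Seminorm ℝ E} (hN : Continuous N) {B : E →L[ℝ] E} {q : ℝ}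
    (hq : 0 ≤ q) (hB : ∀ x, N (B x) ≤ q * N x) (x : E) :
    N (NormedSpace.exp B x) ≤ Real.exp q * N x := by
  have h := (hasSum_exp_apply B x).tendsto_sum_nat
  refine le_of_tendsto ((hN.tendsto _).comp h) (Eventually.of_forall fun n => ?_)
  simp only [Function.comp_apply]
  calc N (∑ i ∈ Finset.range n, ((i.factorial : ℝ)⁻¹) • (B ^ i) x)
      ≤ ∑ i ∈ Finset.range n, N (((i.factorial : ℝ)⁻¹) • (B ^ i) x) := by
        exact Finset.le_sum_of_subadditive N (map_zero N).le (map_add_le_add N) _ _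
    _ ≤ ∑ i ∈ Finset.range n, (q ^ i / i.factorial) * N x := by
        refine Finset.sum_le_sum fun i _ => ?_
        rw [map_smul_eq_mul, norm_inv, Real.norm_natCast, div_eq_inv_mul, mul_assoc]
        exact mul_le_mul_of_nonneg_left (seminorm_pow_apply_le hq hB i x) (by positivity)
    _ = (∑ i ∈ Finset.range n, q ^ i / i.factorial) * N x := by rw [Finset.sum_mul]
    _ ≤ Real.exp q * N x :=
        mul_le_mul_of_nonneg_right (Real.sum_le_exp_of_nonneg hq n) (apply_nonneg N x)

/-- The exponential series has non-negative coefficients, so its partial sums stay in the cone. This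
serves both the positive cone and closed ideals. -/
lemma exp_apply_mem_of_mapsTo {C : Set E} (hC : IsClosed C) (h0 : (0 : E) ∈ C)
    (hadd : ∀ x ∈ C, ∀ y ∈ C, x + y ∈ C) (hsmul : ∀ c : ℝ, 0 ≤ c → ∀ x ∈ C, c • x ∈ C)
    {B : E →L[ℝ] E} (hB : ∀ x ∈ C, B x ∈ C) {x : E} (hx : x ∈ C) :
    NormedSpace.exp B x ∈ C := by
  have hpow : ∀ k : ℕ, (B ^ k) x ∈ C := by
    intro k
    induction k with
    | zero => simpa using hx
    | succ k ih => rw [pow_succ', mul_apply_eq_comp]; exact hB _ ih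
  refine hC.mem_of_tendsto (hasSum_exp_apply B x).tendsto_sum_nat (Eventually.of_forall fun n => ?_)
  induction n with
  | zero => simpa using h0
  | succ n ih =>
    rw [Finset.sum_range_succ]
    exact hadd _ ih _ (hsmul _ (by positivity) _ (hpow n))

/-- Splits off the negative scalar part of the Yosida approximation, so that what remains under the
exponential is a non-negative multiple of the resolvent. -/
lemma exp_sub_smul_one (B : E →L[ℝ] E) (c : ℝ) :
    NormedSpace.exp (B - c • (1 : E →L[ℝ] E)) = Real.exp (-c) • NormedSpace.exp B := by
  have h1 : B - c • (1 : E →L[ℝ] E) = (-c) • (1 : E →L[ℝ] E) + B := by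
    rw [neg_smul]; abel
  have hc : NormedSpace.exp ((-c) • (1 : E →L[ℝ] E)) = Real.exp (-c) • (1 : E →L[ℝ] E) := by
    have := NormedSpace.algebraMap_exp_comm (𝔸 := E →L[ℝ] E) (-c)
    rw [Algebra.algebraMap_eq_smul_one, Algebra.algebraMap_eq_smul_one, ← Real.exp_eq_exp_ℝ] at this
    exact this.symm
  let : NormedAlgebra ℚ (E →L[ℝ] E) := NormedAlgebra.restrictScalars ℚ ℝ _
  rw [h1, NormedSpace.exp_add_of_commute, hc, smul_mul_assoc, one_mul]
  exact (Commute.one_left B).smul_left (-c)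

end Exponential

/-! ### General facts on strongly continuous semigroups -/

section C0

variable {E : Type*} [NormedAddCommGroup E] [NormedSpace ℝ E] {S : ℝ≥0 → E →L[ℝ] E}

lemma IsC0Semigroup.apply_add (hS : IsC0Semigroup S) (s t : ℝ≥0) (x : E) :
    S (s + t) x = S s (S t x) := by
  rw [hS.map_add]; rfl

lemma IsC0Semigroup.tendsto_nhds_zero (hS : IsC0Semigroup S) (x : E) :
    Tendsto (fun s : ℝ≥0 => S s x) (𝓝 0) (𝓝 x) := by
  have e : S 0 x = x := by rw [hS.map_zero]; rfl
  have h1 : ContinuousWithinAt (fun s : ℝ≥0 => S s x) (Ioi 0) 0 := by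
    have h := hS.tendsto_zero x
    unfold ContinuousWithinAt
    simpa only [e] using h
  have h2 := h1.insert
  have hu : insert (0 : ℝ≥0) (Ioi 0) = univ := by
    ext s; simp
  rw [hu, continuousWithinAt_univ] at h2
  have h3 := h2.tendsto
  simpa only [e] using h3

/-- Otherwise there are times t_n → 0 with norms exceeding n, while S(t_n) x → x bounds every orbit;
this contradicts Banach–Steinhaus. -/
lemma IsC0Semigroup.exists_norm_le_near_zero [CompleteSpace E] (hS : IsC0Semigroup S) :
    ∃ δ : ℝ≥0, 0 < δ ∧ ∃ C : ℝ, ∀ t ≤ δ, ‖S t‖ ≤ C := by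
  by_contra! hcon
  have h1 : ∀ n : ℕ, ∃ t : ℝ≥0, t ≤ 1 / ((n : ℝ≥0) + 1) ∧ (n : ℝ) < ‖S t‖ := fun n =>
    hcon _ (by positivity) n
  choose t ht htn using h1
  have ht0 : Tendsto t atTop (𝓝 0) :=
    by
    refine tendsto_of_tendsto_of_tendsto_of_le_of_le tendsto_const_nhds ?_
      (fun _ => zero_le) ht
    rw [← NNReal.tendsto_coe]
    simpa using tendsto_one_div_add_atTop_nhds_zero_nat (𝕜 := ℝ)
  have hbd : ∀ x, ∃ C, ∀ n, ‖S (t n) x‖ ≤ C := by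
    intro x
    have hx : Tendsto (fun n => S (t n) x) atTop (𝓝 x) := by
      exact (hS.tendsto_nhds_zero x).comp ht0
    obtain ⟨C, hC⟩ := (Metric.isBounded_range_of_tendsto _ hx).exists_norm_le
    exact ⟨C, fun n => hC _ ⟨n, rfl⟩⟩
  obtain ⟨C, hC⟩ := banach_steinhaus hbd
  obtain ⟨n, hn⟩ := exists_nat_gt C
  exact absurd (htn n) (not_lt.2 ((hC n).trans hn.le))

lemma IsC0Semigroup.exists_norm_le [CompleteSpace E] (hS : IsC0Semigroup S) (T : ℝ≥0) :
    ∃ C : ℝ, 0 ≤ C ∧ ∀ t ≤ T, ‖S t‖ ≤ C := by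
  obtain ⟨δ, hδ, C, hC⟩ := hS.exists_norm_le_near_zero
  have hC0 : 0 ≤ C := (norm_nonneg _).trans (hC 0 zero_le)
  have key : ∀ n : ℕ, ∃ D : ℝ, 0 ≤ D ∧ ∀ t ≤ (n : ℝ≥0) * δ, ‖S t‖ ≤ D := by
    intro n
    induction n with
    | zero => exact ⟨C, hC0, fun t ht => hC t (ht.trans (by simp))⟩
    | succ n ih =>
      obtain ⟨D, hD0, hD⟩ := ih
      refine ⟨max C (C * D), le_max_of_le_left hC0, fun t ht => ?_⟩
      rcases le_total t δ with h | h
      · exact (hC t h).trans (le_max_left _ _)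
      · have : t = δ + (t - δ) := (add_tsub_cancel_of_le h).symm
        rw [this, hS.map_add]
        refine (ContinuousLinearMap.opNorm_comp_le _ _).trans (le_trans ?_ (le_max_right _ _))
        refine mul_le_mul (hC _ le_rfl) (hD _ ?_) (norm_nonneg _) hC0
        rw [tsub_le_iff_right]
        calc t ≤ ((n + 1 : ℕ) : ℝ≥0) * δ := ht
          _ = n * δ + δ := by push_cast; ring
  obtain ⟨n, hn⟩ := exists_nat_gt (T / δ)
  obtain ⟨D, hD0, hD⟩ := key n
  exact ⟨D, hD0, fun t ht => hD t (ht.trans ((div_le_iff₀ hδ).1 hn.le))⟩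

lemma IsC0Semigroup.continuous_apply [CompleteSpace E] (hS : IsC0Semigroup S) (x : E) :
    Continuous fun t : ℝ≥0 => S t x := by
  rw [continuous_iff_continuousAt]
  intro t
  obtain ⟨C, hC0, hC⟩ := hS.exists_norm_le (t + 1)
  have hd : Tendsto (fun h : ℝ≥0 => C * ‖S h x - x‖) (𝓝 0) (𝓝 0) := by
    have := (((hS.tendsto_nhds_zero x).sub_const x).norm).const_mul C
    simpa using this
  -- Subtraction in `ℝ≥0` is truncated, so this sum is |s - t|; it treats both sides of t with one
  -- bound.
  have habs : Tendsto (fun s : ℝ≥0 => (s - t) + (t - s)) (𝓝 t) (𝓝 0) := by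
    have h : Continuous fun s : ℝ≥0 => (s - t) + (t - s) := by fun_prop
    simpa using h.tendsto t
  have hlim := hd.comp habs
  unfold ContinuousAt
  rw [tendsto_iff_norm_sub_tendsto_zero]
  refine squeeze_zero' (Eventually.of_forall fun _ => norm_nonneg _) ?_ hlim
  have hnear : ∀ᶠ s in 𝓝 t, s < t + 1 := eventually_lt_nhds (by simp)
  filter_upwards [hnear] with s hs
  simp only [Function.comp_apply]
  rcases le_total s t with h | h
  · have e1 : (s - t) + (t - s) = t - s := by rw [tsub_eq_zero_of_le h, zero_add]
    rw [e1]
    have e2 : S t x = S s (S (t - s) x) := by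
      rw [← hS.apply_add, add_tsub_cancel_of_le h]
    rw [e2, ← map_sub, ← norm_neg, ← map_neg, neg_sub]
    exact (S s).le_of_opNorm_le (hC s hs.le) _
  · have e1 : (s - t) + (t - s) = s - t := by rw [tsub_eq_zero_of_le h, add_zero]
    rw [e1]
    have e2 : S s x = S t (S (s - t) x) := by
      rw [← hS.apply_add, add_tsub_cancel_of_le h]
    rw [e2, ← map_sub]
    exact (S t).le_of_opNorm_le (hC t (by simp)) _

lemma IsC0Semigroup.map_mem_generatorGraph (hS : IsC0Semigroup S) {x y : E}
    (h : (x, y) ∈ generatorGraph S) (s : ℝ≥0) : (S s x, S s y) ∈ generatorGraph S := by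
  have := ((S s).continuous.tendsto y).comp h
  refine this.congr fun t => ?_
  simp only [Function.comp_apply, map_smul, map_sub]
  rw [← hS.apply_add, ← hS.apply_add, add_comm]

lemma tendsto_sub_toNNReal (s : ℝ) :
    Tendsto (fun σ : ℝ => (σ - s).toNNReal) (𝓝[>] s) (𝓝[>] 0) := by
  refine tendsto_nhdsWithin_iff.2 ⟨?_, ?_⟩
  · have h : Continuous fun σ : ℝ => (σ - s).toNNReal := by fun_prop
    have := h.tendsto s
    simp only [sub_self, Real.toNNReal_zero] at this
    exact this.mono_left nhdsWithin_le_nhds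
  · filter_upwards [self_mem_nhdsWithin] with σ hσ
    simpa using hσ

lemma IsC0Semigroup.hasDerivWithinAt (hS : IsC0Semigroup S) {x y : E}
    (h : (x, y) ∈ generatorGraph S) {s : ℝ} (hs : 0 ≤ s) :
    HasDerivWithinAt (fun σ : ℝ => S σ.toNNReal x) (S s.toNNReal y) (Ici s) s := by
  rw [hasDerivWithinAt_iff_tendsto_slope, Ici_sdiff_left]
  have h1 := (hS.map_mem_generatorGraph h s.toNNReal)
  have h2 := Tendsto.comp h1 (tendsto_sub_toNNReal s)
  refine h2.congr' ?_
  filter_upwards [self_mem_nhdsWithin] with σ hσ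
  have hσ' : s < σ := hσ
  simp only [Function.comp_apply, slope, vsub_eq_sub]
  rw [Real.coe_toNNReal _ (sub_nonneg.2 hσ'.le), ← hS.apply_add, ← Real.toNNReal_add (by linarith) hs]
  simp

lemma IsC0Semigroup.hasDerivWithinAt_exp_smul (hS : IsC0Semigroup S) {x y : E}
    (h : (x, y) ∈ generatorGraph S) (c : ℝ) {s : ℝ} (hs : 0 ≤ s) :
    HasDerivWithinAt (fun σ : ℝ => Real.exp (-(c * σ)) • S σ.toNNReal x)
      (Real.exp (-(c * s)) • S s.toNNReal (y - c • x)) (Ici s) s := by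
  have h1 : HasDerivAt (fun σ : ℝ => Real.exp (-(c * σ))) (Real.exp (-(c * s)) * (-(c * 1))) s :=
    (((hasDerivAt_id s).const_mul c).neg).exp
  have h2 := h1.hasDerivWithinAt.smul (hS.hasDerivWithinAt h hs) (s := Ici s)
  convert! h2 using 1
  rw [map_sub, map_smul, smul_sub, smul_smul]
  rw [mul_one, mul_neg, neg_smul, sub_eq_add_neg]

lemma IsC0Semigroup.continuous_exp_smul [CompleteSpace E] (hS : IsC0Semigroup S) (x : E) (c : ℝ) :
    Continuous fun σ : ℝ => Real.exp (-(c * σ)) • S σ.toNNReal x :=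
  (by fun_prop : Continuous fun σ : ℝ => Real.exp (-(c * σ))).smul
    ((hS.continuous_apply x).comp continuous_real_toNNReal)

/-- A strongly continuous semigroup is determined by its generator. -/
theorem IsC0Semigroup.eq_of_generatorGraph_eq [CompleteSpace E] {T : ℝ≥0 → E →L[ℝ] E}
    (hS : IsC0Semigroup S) (hT : IsC0Semigroup T) (hST : generatorGraph S = generatorGraph T)
    (hdense : Dense (Prod.fst '' generatorGraph S)) : S = T := by
  funext t
  refine ContinuousLinearMap.coeFn_injective ?_
  refine Continuous.ext_on hdense (S t).continuous (T t).continuous ?_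
  rintro x ⟨⟨x, y⟩, hxy, rfl⟩
  change S t x = T t x
  obtain ⟨C, hC0, hC⟩ := hT.exists_norm_le t
  -- The standard interpolation between T t x at σ = 0 and S t x at σ = t. Its right derivative
  -- vanishes because both generators take the same value at S(σ) x.
  set F : ℝ → E := fun σ => T (t - σ.toNNReal) (S σ.toNNReal x) with hF
  have hcontF : ContinuousOn F (Icc 0 t) := by
    have hcS : Continuous fun σ : ℝ => S σ.toNNReal x :=
      (hS.continuous_apply x).comp continuous_real_toNNReal
    intro s _
    have h1 : Tendsto (fun σ : ℝ => T (t - σ.toNNReal) (S s.toNNReal x)) (𝓝 s)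
        (𝓝 (T (t - s.toNNReal) (S s.toNNReal x))) := by
      have hc : Continuous fun σ : ℝ => T (t - σ.toNNReal) (S s.toNNReal x) :=
        (hT.continuous_apply _).comp (by fun_prop)
      exact hc.tendsto s
    have h2 : Tendsto (fun σ : ℝ => T (t - σ.toNNReal) (S σ.toNNReal x - S s.toNNReal x)) (𝓝 s)
        (𝓝 0) := by
      rw [tendsto_zero_iff_norm_tendsto_zero]
      refine squeeze_zero (fun _ => norm_nonneg _)
        (fun σ => (T (t - σ.toNNReal)).le_of_opNorm_le (hC _ tsub_le_self) _) ?_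
      have := (((hcS.tendsto s).sub_const (S s.toNNReal x)).norm).const_mul C
      simpa using this
    have h3 := h1.add h2
    rw [add_zero] at h3
    refine Tendsto.mono_left (h3.congr fun σ => ?_) nhdsWithin_le_nhds
    simp only [map_sub, hF]; abel
  have hderiv : ∀ s ∈ Ico (0 : ℝ) t, HasDerivWithinAt F 0 (Ici s) s := by
    intro s hs
    rw [hasDerivWithinAt_iff_tendsto_slope, Ici_sdiff_left, tendsto_zero_iff_norm_tendsto_zero]
    have h1 := hS.map_mem_generatorGraph hxy s.toNNReal
    have h2 := hST ▸ h1
    set z := S s.toNNReal x with hz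
    have h3 := (Tendsto.sub h1 h2).norm.const_mul C
    rw [sub_self, norm_zero, mul_zero] at h3
    have h4 := h3.comp (tendsto_sub_toNNReal s)
    refine squeeze_zero' (Eventually.of_forall fun _ => norm_nonneg _) ?_ h4
    have hnear : ∀ᶠ σ : ℝ in 𝓝[>] s, σ < (t : ℝ) := nhdsWithin_le_nhds (eventually_lt_nhds hs.2)
    filter_upwards [self_mem_nhdsWithin, hnear] with σ hσ hσt
    have hσ' : s < σ := hσ
    set h := (σ - s).toNNReal with hh
    have hhr : (h : ℝ) = σ - s := Real.coe_toNNReal _ (sub_nonneg.2 hσ'.le)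
    have e1 : σ.toNNReal = h + s.toNNReal := by
      rw [hh, ← Real.toNNReal_add (by linarith) hs.1]; simp
    have hle : σ.toNNReal ≤ t := Real.toNNReal_le_iff_le_coe.2 hσt.le
    have e2 : t - s.toNNReal = (t - σ.toNNReal) + h := by
      rw [e1] at hle ⊢
      rw [tsub_add_eq_tsub_tsub_swap, tsub_add_cancel_of_le]
      exact le_tsub_of_add_le_right hle
    have e3 : slope F s σ = T (t - σ.toNNReal)
        (((h : ℝ)⁻¹) • (S h z - z) - ((h : ℝ)⁻¹) • (T h z - z)) := by
      simp only [slope, vsub_eq_sub, hF]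
      rw [e2, hT.apply_add, e1, hS.apply_add, ← hz, hhr, ← smul_sub, map_smul]
      congr 1
      simp only [map_sub]; abel
    rw [e3]
    exact (T _).le_of_opNorm_le (hC _ tsub_le_self) _
  have hconst := constant_of_has_deriv_right_zero hcontF hderiv t ⟨t.2, le_rfl⟩
  simp only [hF, Real.toNNReal_coe, tsub_self, Real.toNNReal_zero, tsub_zero, hT.map_zero,
    hS.map_zero] at hconst
  simpa using hconst

end C0

/-! ### The Hille–Yosida theorem for quasi-dissipative operators -/

section HilleYosida

variable {E : Type*} [NormedAddCommGroup E] [NormedSpace ℝ E]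

/-- The linear operator with graph `G` is densely defined, `γ`-dissipative for the norm `N`, which
is equivalent to the given one, and `R c` is the inverse of `c - G` for `c > γ`. -/
structure IsQuasiDissipative (G : Submodule ℝ (E × E)) (N : Seminorm ℝ E) (γ M : ℝ)
    (R : ℝ → E →L[ℝ] E) : Prop where
  norm_le : ∀ x, ‖x‖ ≤ N x
  le_norm : ∀ x, N x ≤ M * ‖x‖
  nonneg : 0 ≤ γ
  mem : ∀ c, γ < c → ∀ f, (R c f, c • R c f - f) ∈ G
  dissip : ∀ c, γ < c → ∀ u f, (u, f) ∈ G → (c - γ) * N u ≤ N (c • u - f)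
  dense : Dense (Prod.fst '' (G : Set (E × E)))

namespace IsQuasiDissipative

variable {G : Submodule ℝ (E × E)} {N : Seminorm ℝ E} {γ M : ℝ} {R : ℝ → E →L[ℝ] E}

lemma continuous_seminorm (h : IsQuasiDissipative G N γ M R) : Continuous N := by
  refine Seminorm.continuous_of_le (q := (Real.toNNReal M) • normSeminorm ℝ E) ?_ fun x => ?_
  · have : Continuous fun x : E => (Real.toNNReal M : ℝ) * ‖x‖ := by fun_prop
    exact this
  · refine (h.le_norm x).trans ?_
    exact mul_le_mul_of_nonneg_right (Real.le_coe_toNNReal M) (norm_nonneg x)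

lemma eq_resolvent (h : IsQuasiDissipative G N γ M R) {c : ℝ} (hc : γ < c) {u f : E}
    (hu : (u, c • u - f) ∈ G) : u = R c f := by
  have h1 := G.sub_mem hu (h.mem c hc f)
  have h2 := h.dissip c hc (u - R c f) (c • u - f - (c • R c f - f)) h1
  have h3 : c • (u - R c f) - (c • u - f - (c • R c f - f)) = 0 := by
    rw [smul_sub]; abel
  rw [h3, map_zero] at h2
  have h4 : N (u - R c f) ≤ 0 := nonpos_of_mul_nonpos_right h2 (sub_pos.2 hc)
  exact sub_eq_zero.1 (norm_le_zero_iff.1 ((h.norm_le _).trans h4))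

lemma resolvent_sub (h : IsQuasiDissipative G N γ M R) {c : ℝ} (hc : γ < c) {u f : E}
    (hu : (u, f) ∈ G) : R c (c • u - f) = u := by
  refine (h.eq_resolvent hc ?_).symm
  simpa using hu

lemma seminorm_resolvent_le (h : IsQuasiDissipative G N γ M R) {c : ℝ} (hc : γ < c) (f : E) :
    N (R c f) ≤ (c - γ)⁻¹ * N f := by
  have h1 := h.dissip c hc _ _ (h.mem c hc f)
  rw [sub_sub_cancel] at h1
  rwa [← div_eq_inv_mul, le_div_iff₀' (sub_pos.2 hc)]

lemma resolvent_comm (h : IsQuasiDissipative G N γ M R) {c d : ℝ} (hc : γ < c) (hd : γ < d) :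
    Commute (R c) (R d) := by
  ext f
  change R c (R d f) = R d (R c f)
  have hv := h.mem c hc f
  have hy := h.mem d hd (R c f)
  -- The resolvent identity, verified through uniqueness of the solution of (d - G) u = f.
  have h1 : R d f = R c f + (c - d) • R d (R c f) := by
    refine (h.eq_resolvent hd ?_).symm
    convert G.add_mem hv (G.smul_mem (c - d) hy) using 1
    refine Prod.ext ?_ ?_
    · simp
    · simp only [Prod.snd_add, Prod.smul_snd]
      module
  refine (h.eq_resolvent hc ?_).symm
  rw [h1]
  convert hy using 2
  module

/-- The Yosida approximation. -/
def yosida (R : ℝ → E →L[ℝ] E) (c : ℝ) : E →L[ℝ] E :=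
  (c ^ 2) • R c - c • (1 : E →L[ℝ] E)

lemma yosida_apply (h : IsQuasiDissipative G N γ M R) {c : ℝ} (hc : γ < c) {u f : E}
    (hu : (u, f) ∈ G) : yosida R c u = c • R c f := by
  have h1 := h.resolvent_sub hc hu
  rw [map_sub, map_smul, sub_eq_iff_eq_add] at h1
  simp only [yosida, sub_apply, smul_apply, one_apply_eq_self]
  have h2 : c • (c • R c u) = c • (u + R c f) := by rw [h1]
  rw [smul_add, smul_smul, ← pow_two] at h2
  rw [h2]; abel

lemma yosida_comm (h : IsQuasiDissipative G N γ M R) {c d : ℝ} (hc : γ < c) (hd : γ < d) :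
    Commute (yosida R c) (yosida R d) := by
  have h0 := h.resolvent_comm hc hd
  unfold yosida
  refine Commute.sub_left (Commute.sub_right ?_ ?_) (Commute.sub_right ?_ ?_)
  · exact (h0.smul_left _).smul_right _
  · exact ((Commute.one_right (R c)).smul_left _).smul_right _
  · exact ((Commute.one_left (R d)).smul_left _).smul_right _
  · exact ((Commute.one_left (1 : E →L[ℝ] E)).smul_left _).smul_right _

/-- On the domain c R(c) u - u = R(c) f has size at most N(f) / (c - γ). Density extends this to all
x because c R(c) is bounded by 2 once c ≥ 2γ. -/
lemma tendsto_smul_resolvent (h : IsQuasiDissipative G N γ M R) (x : E) :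
    Tendsto (fun c => N (c • R c x - x)) atTop (𝓝 0) := by
  rw [Metric.tendsto_nhds]
  intro ε hε
  have hball : {y : E | N (x - y) < ε / 6}.Nonempty := ⟨x, by simpa using by positivity⟩
  have hopen : IsOpen {y : E | N (x - y) < ε / 6} :=
    isOpen_lt (h.continuous_seminorm.comp (continuous_const.sub continuous_id)) continuous_const
  obtain ⟨u, hu1, ⟨⟨u', f⟩, hu, rfl⟩⟩ := h.dense.inter_open_nonempty _ hopen hball
  have hu1 : N (x - u') < ε / 6 := hu1
  have hlim : Tendsto (fun c : ℝ => (c - γ)⁻¹ * N f) atTop (𝓝 0) := by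
    have : Tendsto (fun c : ℝ => (c - γ)⁻¹) atTop (𝓝 0) :=
      tendsto_inv_atTop_zero.comp (tendsto_atTop_add_const_right _ (-γ) tendsto_id)
    simpa using this.mul_const (N f)
  have hev := hlim.eventually (gt_mem_nhds (show (0 : ℝ) < ε / 2 by positivity))
  filter_upwards [hev, eventually_gt_atTop γ, eventually_ge_atTop (2 * γ), eventually_gt_atTop 0]
    with c hc1 hc2 hc3 hc4
  rw [Real.dist_eq, sub_zero, abs_of_nonneg (apply_nonneg N _)]
  have e : c • R c x - x = c • R c (x - u') - (x - u') + R c f := by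
    have := h.resolvent_sub hc2 hu
    rw [map_sub, map_smul, sub_eq_iff_eq_add] at this
    rw [map_sub, smul_sub, this]; abel
  have h1 : N (c • R c (x - u')) ≤ 2 * N (x - u') := by
    rw [map_smul_eq_mul, Real.norm_of_nonneg hc4.le]
    have h2 := h.seminorm_resolvent_le hc2 (x - u')
    have hpos : 0 < c - γ := sub_pos.2 hc2
    calc c * N (R c (x - u')) ≤ c * ((c - γ)⁻¹ * N (x - u')) := by gcongr
      _ = (c / (c - γ)) * N (x - u') := by rw [div_eq_mul_inv, mul_assoc]
      _ ≤ 2 * N (x - u') := by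
        refine mul_le_mul_of_nonneg_right ?_ (apply_nonneg N _)
        rw [div_le_iff₀ hpos]; linarith
  have h3 : N (c • R c x - x) ≤ N (c • R c (x - u')) + N (x - u') + N (R c f) := by
    rw [e]
    exact (map_add_le_add N _ _).trans (add_le_add (map_sub_le_add N _ _) le_rfl)
  have h4 := h.seminorm_resolvent_le hc2 f
  linarith

lemma tendsto_yosida (h : IsQuasiDissipative G N γ M R) {u f : E} (hu : (u, f) ∈ G) :
    Tendsto (fun c => N (yosida R c u - f)) atTop (𝓝 0) := by
  refine (h.tendsto_smul_resolvent f).congr' ?_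
  filter_upwards [eventually_gt_atTop γ] with c hc
  rw [h.yosida_apply hc hu]

/-- The uniformly continuous semigroup generated by the Yosida approximation. -/
def expYosida (R : ℝ → E →L[ℝ] E) (c t : ℝ) : E →L[ℝ] E := NormedSpace.exp (t • yosida R c)

lemma expYosida_zero (c : ℝ) : expYosida R c 0 = 1 := by
  simp [expYosida]

variable [CompleteSpace E]

lemma expYosida_eq (c t : ℝ) :
    expYosida R c t = Real.exp (-(t * c)) • NormedSpace.exp ((t * c ^ 2) • R c) := by
  rw [expYosida, yosida, smul_sub, smul_smul, smul_smul, exp_sub_smul_one]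

/-- The exponent is t (c² / (c - γ) - c), at most 2γt for c ≥ 2γ; the extra 1 keeps c > γ when γ =
0. The rate 2γ instead of γ is not sharp, and it is why later arguments ask for 2γ < c. -/
lemma seminorm_expYosida_le (h : IsQuasiDissipative G N γ M R) {c : ℝ} (hc : 2 * γ + 1 ≤ c)
    {t : ℝ} (ht : 0 ≤ t) (x : E) : N (expYosida R c t x) ≤ Real.exp (2 * γ * t) * N x := by
  have hγ := h.nonneg
  have hc' : γ < c := by linarith
  have hpos : 0 < c - γ := sub_pos.2 hc'
  rw [expYosida_eq, smul_apply, map_smul_eq_mul, Real.norm_of_nonneg (Real.exp_pos _).le]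
  have h1 := seminorm_exp_apply_le h.continuous_seminorm (B := (t * c ^ 2) • R c)
    (q := t * c ^ 2 * (c - γ)⁻¹) (mul_nonneg (by positivity) (inv_nonneg.2 hpos.le)) (fun y => by
      rw [smul_apply, map_smul_eq_mul, Real.norm_of_nonneg (by positivity),
        mul_assoc (t * c ^ 2)]
      exact mul_le_mul_of_nonneg_left (h.seminorm_resolvent_le hc' y) (by positivity)) x
  refine (mul_le_mul_of_nonneg_left h1 (Real.exp_pos _).le).trans ?_
  rw [← mul_assoc, ← Real.exp_add]
  refine mul_le_mul_of_nonneg_right (Real.exp_le_exp.2 ?_) (apply_nonneg N x)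
  have h2 : c ^ 2 * (c - γ)⁻¹ ≤ c + 2 * γ := by
    rw [← div_eq_mul_inv, div_le_iff₀ hpos]; nlinarith
  nlinarith

lemma hasDerivAt_expYosida (c t : ℝ) (x : E) :
    HasDerivAt (fun s => expYosida R c s x) (expYosida R c t (yosida R c x)) t := by
  have h := hasDerivAt_exp_smul_const (𝕂 := ℝ) (yosida R c) t
  exact ((ContinuousLinearMap.apply ℝ E x).hasFDerivAt.comp_hasDerivAt t h)

lemma expYosida_add (c s t : ℝ) : expYosida R c (s + t) = expYosida R c s * expYosida R c t := by
  let : NormedAlgebra ℚ (E →L[ℝ] E) := NormedAlgebra.restrictScalars ℚ ℝ _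
  rw [expYosida, add_smul, NormedSpace.exp_add_of_commute]
  · rfl
  · exact ((Commute.refl _).smul_left s).smul_right t

lemma norm_expYosida_sub_le (h : IsQuasiDissipative G N γ M R) {c d : ℝ} (hc : 2 * γ + 1 ≤ c)
    (hd : 2 * γ + 1 ≤ d) {t : ℝ} (ht : 0 ≤ t) (x : E) :
    ‖expYosida R c t x - expYosida R d t x‖ ≤
      Real.exp (2 * γ * t) * N (yosida R c x - yosida R d x) * t := by
  have hγ := h.nonneg
  let : NormedAlgebra ℚ (E →L[ℝ] E) := NormedAlgebra.restrictScalars ℚ ℝ _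
  have hcomm : Commute (yosida R c) (yosida R d) := h.yosida_comm (by linarith) (by linarith)
  -- Interpolates between the two commuting exponentials; the derivative in s is the exponential
  -- applied to the difference of the two Yosida approximations at x.
  set F : ℝ → E := fun s => NormedSpace.exp (s • yosida R c + (t - s) • yosida R d) x with hF
  have hFe : ∀ s, F s = expYosida R c s (expYosida R d (t - s) x) := by
    intro s
    simp only [hF]
    rw [NormedSpace.exp_add_of_commute ((hcomm.smul_left s).smul_right (t - s))]
    rfl
  have hder : ∀ s ∈ Icc (0 : ℝ) t, HasDerivWithinAt F
      (expYosida R c s (expYosida R d (t - s) (yosida R c x - yosida R d x)))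
      (Icc 0 t) s := by
    intro s _
    have e1 : F = fun s => NormedSpace.exp (t • yosida R d) (NormedSpace.exp
        (s • (yosida R c - yosida R d)) x) := by
      funext s
      have hcm : Commute (t • yosida R d) (s • (yosida R c - yosida R d)) :=
        (((hcomm.symm.sub_right (Commute.refl _)).smul_left t).smul_right s)
      have := NormedSpace.exp_add_of_commute hcm
      have e2 : t • yosida R d + s • (yosida R c - yosida R d)
          = s • yosida R c + (t - s) • yosida R d := by module
      rw [e2] at this
      simp only [hF, this]; rfl
    have h1 := hasDerivAt_exp_smul_const (𝕂 := ℝ) (yosida R c - yosida R d) s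
    have h2 := (NormedSpace.exp (t • yosida R d)).hasFDerivAt.comp_hasDerivAt s
      ((ContinuousLinearMap.apply ℝ E x).hasFDerivAt.comp_hasDerivAt s h1)
    have e3 : NormedSpace.exp (t • yosida R d) (NormedSpace.exp
        (s • (yosida R c - yosida R d)) ((yosida R c - yosida R d) x)) =
        expYosida R c s (expYosida R d (t - s) (yosida R c x - yosida R d x)) := by
      have hcm : Commute (t • yosida R d) (s • (yosida R c - yosida R d)) :=
        (((hcomm.symm.sub_right (Commute.refl _)).smul_left t).smul_right s)
      have h3 := NormedSpace.exp_add_of_commute hcm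
      have h4 := NormedSpace.exp_add_of_commute ((hcomm.smul_left s).smul_right (t - s))
      have e2 : t • yosida R d + s • (yosida R c - yosida R d)
          = s • yosida R c + (t - s) • yosida R d := by module
      rw [e2, h4] at h3
      have := congrArg (fun L : E →L[ℝ] E => L ((yosida R c - yosida R d) x)) h3
      exact this.symm
    rw [e1]
    refine HasDerivAt.hasDerivWithinAt ?_
    rw [← e3]
    exact h2
  have hbound : ∀ s ∈ Ico (0 : ℝ) t,
      ‖expYosida R c s (expYosida R d (t - s) (yosida R c x - yosida R d x))‖ ≤
      Real.exp (2 * γ * t) * N (yosida R c x - yosida R d x) := by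
    intro s hs
    refine (h.norm_le _).trans ((h.seminorm_expYosida_le hc hs.1 _).trans ?_)
    refine (mul_le_mul_of_nonneg_left (h.seminorm_expYosida_le hd (sub_nonneg.2 hs.2.le) _)
      (Real.exp_pos _).le).trans (le_of_eq ?_)
    rw [← mul_assoc, ← Real.exp_add]
    congr 2; ring
  have := norm_image_sub_le_of_norm_deriv_le_segment' hder hbound t ⟨ht, le_rfl⟩
  rw [hFe, hFe] at this
  simpa [expYosida_zero] using this

/-- Yosida approximations converge only on the domain, so x is replaced by a nearby domain element
u'; the uniform bound e^{2γt} controls the replacement error. -/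
lemma cauchySeq_expYosida (h : IsQuasiDissipative G N γ M R) {t : ℝ} (ht : 0 ≤ t) (x : E) :
    CauchySeq fun n : ℕ => expYosida R n t x := by
  have hγ := h.nonneg
  rw [Metric.cauchySeq_iff']
  intro ε hε
  set K := Real.exp (2 * γ * t) with hK
  have hKpos : 0 < K := Real.exp_pos _
  have hball : {y : E | N (x - y) < ε / (4 * K)}.Nonempty := ⟨x, by simpa using by positivity⟩
  have hopen : IsOpen {y : E | N (x - y) < ε / (4 * K)} :=
    isOpen_lt (h.continuous_seminorm.comp (continuous_const.sub continuous_id)) continuous_const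
  obtain ⟨u, hu1, ⟨⟨u', f⟩, hu, rfl⟩⟩ := h.dense.inter_open_nonempty _ hopen hball
  have hu1 : N (x - u') < ε / (4 * K) := hu1
  rw [lt_div_iff₀ (by positivity)] at hu1
  have hev := ((h.tendsto_yosida hu).comp tendsto_natCast_atTop_atTop).eventually
    (gt_mem_nhds (show (0 : ℝ) < ε / (8 * K * (t + 1)) by positivity))
  obtain ⟨n₀, hn₀⟩ := eventually_atTop.1 (hev.and (tendsto_natCast_atTop_atTop.eventually
    (eventually_ge_atTop (2 * γ + 1))))
  refine ⟨n₀, fun n hn => ?_⟩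
  obtain ⟨hn1, hn2⟩ := hn₀ n hn
  obtain ⟨hm1, hm2⟩ := hn₀ n₀ le_rfl
  simp only [Function.comp_apply] at hn1 hm1
  rw [dist_eq_norm]
  have e : expYosida R n t x - expYosida R n₀ t x = expYosida R n t (x - u')
      - expYosida R n₀ t (x - u') + (expYosida R n t u' - expYosida R n₀ t u') := by
    simp only [map_sub]; abel
  have h1 : ‖expYosida R n t (x - u')‖ ≤ K * N (x - u') :=
    (h.norm_le _).trans (h.seminorm_expYosida_le hn2 ht _)
  have h2 : ‖expYosida R n₀ t (x - u')‖ ≤ K * N (x - u') :=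
    (h.norm_le _).trans (h.seminorm_expYosida_le hm2 ht _)
  have h3 := h.norm_expYosida_sub_le hn2 hm2 ht u'
  have h4 : N (yosida R n u' - yosida R n₀ u') ≤ 2 * (ε / (8 * K * (t + 1))) := by
    have : yosida R n u' - yosida R n₀ u' = (yosida R n u' - f) - (yosida R n₀ u' - f) := by abel
    rw [this]
    exact (map_sub_le_add N _ _).trans (by linarith)
  have h5 : K * N (yosida R n u' - yosida R n₀ u') * t ≤ ε / 4 := by
    calc K * N (yosida R n u' - yosida R n₀ u') * t
        ≤ K * (2 * (ε / (8 * K * (t + 1)))) * (t + 1) := by gcongr; linarith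
      _ = ε / 4 := by field_simp; ring
  have h6 : ‖expYosida R n t x - expYosida R n₀ t x‖ ≤
      ‖expYosida R n t (x - u')‖ + ‖expYosida R n₀ t (x - u')‖ +
      ‖expYosida R n t u' - expYosida R n₀ t u'‖ := by
    rw [e]
    exact (norm_add_le _ _).trans (add_le_add (norm_sub_le _ _) le_rfl)
  nlinarith

/-- The limit of the Yosida semigroups. -/
lemma exists_semigroup (h : IsQuasiDissipative G N γ M R) :
    ∃ T : ℝ≥0 → E →L[ℝ] E, ∀ (t : ℝ≥0) x,
      Tendsto (fun n : ℕ => expYosida R n t x) atTop (𝓝 (T t x)) := by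
  have h1 : ∀ (t : ℝ≥0) x, ∃ y, Tendsto (fun n : ℕ => expYosida R n t x) atTop (𝓝 y) :=
    fun t x => cauchySeq_tendsto_of_complete (h.cauchySeq_expYosida t.2 x)
  choose F hF using h1
  refine ⟨fun t => continuousLinearMapOfTendsto
    (fun n : ℕ => expYosida R n t) (f := F t) (tendsto_pi_nhds.2 (hF t)), fun t x => hF t x⟩

variable {T : ℝ≥0 → E →L[ℝ] E}

lemma seminorm_semigroup_le (h : IsQuasiDissipative G N γ M R)
    (hT : ∀ (t : ℝ≥0) x, Tendsto (fun n : ℕ => expYosida R n t x) atTop (𝓝 (T t x))) (t : ℝ≥0) (x : E) :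
    N (T t x) ≤ Real.exp (2 * γ * t) * N x := by
  refine le_of_tendsto ((h.continuous_seminorm.tendsto _).comp (hT t x)) ?_
  filter_upwards [tendsto_natCast_atTop_atTop.eventually (eventually_ge_atTop (2 * γ + 1))]
    with n hn
  exact h.seminorm_expYosida_le hn t.2 x

/-- Quantitative differentiability at time 0. The value f need not lie in the domain, so it is
compared with a domain element y, which the approximating semigroups move only by O(t); then n → ∞.
-/
lemma norm_semigroup_sub_le (h : IsQuasiDissipative G N γ M R)
    (hT : ∀ (t : ℝ≥0) x, Tendsto (fun n : ℕ => expYosida R n t x) atTop (𝓝 (T t x))) (t : ℝ≥0)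
    {u f y g : E} (hu : (u, f) ∈ G) (hy : (y, g) ∈ G) (ht : t ≤ 1) :
    ‖T t u - u - (t : ℝ) • f‖ ≤
      ((Real.exp (2 * γ) + 1) * N (f - y) + 2 * t * Real.exp (2 * γ) * N g) * t := by
  have hγ := h.nonneg
  set K := Real.exp (2 * γ) with hK
  have hexp : ∀ s : ℝ, s ≤ 1 → Real.exp (2 * γ * s) ≤ K := fun s hs =>
    Real.exp_le_exp.2 (by nlinarith)
  have hKpos : 0 < K := Real.exp_pos _
  have ht' : (t : ℝ) ≤ 1 := by exact_mod_cast ht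
  have key : ∀ n : ℕ, 2 * γ + 1 ≤ n → ‖expYosida R n t u - u - (t : ℝ) • f‖ ≤
      (K * N (yosida R n u - f) + ((K + 1) * N (f - y) + 2 * t * K * N g)) * t := by
    intro n hn
    have hn' : γ < n := by linarith
    have hyos : N (yosida R n y) ≤ 2 * N g := by
      rw [h.yosida_apply hn' hy, map_smul_eq_mul, Real.norm_natCast]
      have hpos : 0 < (n : ℝ) - γ := sub_pos.2 hn'
      calc (n : ℝ) * N (R n g) ≤ n * ((n - γ)⁻¹ * N g) := by
            gcongr; exact h.seminorm_resolvent_le hn' g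
        _ = (n / (n - γ)) * N g := by rw [div_eq_mul_inv, mul_assoc]
        _ ≤ 2 * N g := by
          refine mul_le_mul_of_nonneg_right ?_ (apply_nonneg N _)
          rw [div_le_iff₀ hpos]; linarith
    have hsmall : ∀ s ∈ Icc (0 : ℝ) t, ‖expYosida R n s y - y‖ ≤ 2 * t * K * N g := by
      intro s hs
      have hb : ∀ σ ∈ Ico (0 : ℝ) s, ‖expYosida R n σ (yosida R n y)‖ ≤ K * (2 * N g) := by
        intro σ hσ
        refine (h.norm_le _).trans ((h.seminorm_expYosida_le hn hσ.1 _).trans ?_)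
        exact mul_le_mul (hexp _ (hσ.2.le.trans (hs.2.trans ht'))) hyos (apply_nonneg N _) hKpos.le
      have := norm_image_sub_le_of_norm_deriv_le_segment'
        (fun σ _ => (hasDerivAt_expYosida (R := R) n σ y).hasDerivWithinAt) hb s ⟨hs.1, le_rfl⟩
      rw [expYosida_zero, sub_zero] at this
      refine this.trans ?_
      calc K * (2 * N g) * s ≤ K * (2 * N g) * t :=
            mul_le_mul_of_nonneg_left hs.2 (by positivity)
        _ = 2 * t * K * N g := by ring
    have hder : ∀ s ∈ Icc (0 : ℝ) t, HasDerivWithinAt (fun s => expYosida R n s u - s • f)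
        (expYosida R n s (yosida R n u) - (1 : ℝ) • f) (Icc 0 t) s := fun s _ =>
      ((hasDerivAt_expYosida (R := R) n s u).sub ((hasDerivAt_id s).smul_const f)).hasDerivWithinAt
    have hb : ∀ s ∈ Ico (0 : ℝ) t, ‖expYosida R n s (yosida R n u) - (1 : ℝ) • f‖ ≤
        K * N (yosida R n u - f) + ((K + 1) * N (f - y) + 2 * t * K * N g) := by
      intro s hs
      have hs1 : s ≤ 1 := hs.2.le.trans ht'
      have e : expYosida R n s (yosida R n u) - (1 : ℝ) • f = expYosida R n s (yosida R n u - f)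
          + (expYosida R n s (f - y) + (expYosida R n s y - y) - (f - y)) := by
        simp only [map_sub, one_smul]; abel
      rw [e]
      have b1 : ‖expYosida R n s (yosida R n u - f)‖ ≤ K * N (yosida R n u - f) :=
        (h.norm_le _).trans ((h.seminorm_expYosida_le hn hs.1 _).trans
          (mul_le_mul_of_nonneg_right (hexp s hs1) (apply_nonneg N _)))
      have b2 : ‖expYosida R n s (f - y)‖ ≤ K * N (f - y) :=
        (h.norm_le _).trans ((h.seminorm_expYosida_le hn hs.1 _).trans
          (mul_le_mul_of_nonneg_right (hexp s hs1) (apply_nonneg N _)))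
      have b3 := hsmall s ⟨hs.1, hs.2.le⟩
      have b4 := h.norm_le (f - y)
      calc _ ≤ ‖expYosida R n s (yosida R n u - f)‖ + (‖expYosida R n s (f - y)‖
            + ‖expYosida R n s y - y‖ + ‖f - y‖) := by
            refine (norm_add_le _ _).trans (add_le_add le_rfl ?_)
            exact (norm_sub_le _ _).trans (add_le_add (norm_add_le _ _) le_rfl)
        _ ≤ _ := by linarith
    have := norm_image_sub_le_of_norm_deriv_le_segment' hder hb t ⟨t.2, le_rfl⟩
    simp only [expYosida_zero, sub_zero, zero_smul] at this
    have e2 : expYosida R n t u - u - (t : ℝ) • f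
        = expYosida R n t u - (t : ℝ) • f - (1 : E →L[ℝ] E) u := by
      rw [one_apply_eq_self]; abel
    rw [e2]
    exact this
  have hl : Tendsto (fun n : ℕ => ‖expYosida R n t u - u - (t : ℝ) • f‖) atTop
      (𝓝 ‖T t u - u - (t : ℝ) • f‖) := (((hT t u).sub_const u).sub_const _).norm
  have hr : Tendsto (fun n : ℕ => (K * N (yosida R n u - f)
      + ((K + 1) * N (f - y) + 2 * t * K * N g)) * t) atTop
      (𝓝 (((K + 1) * N (f - y) + 2 * t * K * N g) * t)) := by
    have := ((((h.tendsto_yosida hu).comp tendsto_natCast_atTop_atTop).const_mul K).add_const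
      ((K + 1) * N (f - y) + 2 * t * K * N g)).mul_const (t : ℝ)
    simpa using this
  refine le_of_tendsto_of_tendsto hl hr ?_
  filter_upwards [tendsto_natCast_atTop_atTop.eventually (eventually_ge_atTop (2 * γ + 1))]
    with n hn
  exact key n hn

lemma mem_generatorGraph (h : IsQuasiDissipative G N γ M R)
    (hT : ∀ (t : ℝ≥0) x, Tendsto (fun n : ℕ => expYosida R n t x) atTop (𝓝 (T t x)))
    {u f : E} (hu : (u, f) ∈ G) : (u, f) ∈ generatorGraph T := by
  have hγ := h.nonneg
  change Tendsto _ _ _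
  rw [Metric.tendsto_nhds]
  intro ε hε
  set K := Real.exp (2 * γ) with hK
  have hKpos : 0 < K := Real.exp_pos _
  have hball : {y : E | N (f - y) < ε / (2 * (K + 1))}.Nonempty :=
    ⟨f, by simpa using by positivity⟩
  have hopen : IsOpen {y : E | N (f - y) < ε / (2 * (K + 1))} :=
    isOpen_lt (h.continuous_seminorm.comp (continuous_const.sub continuous_id)) continuous_const
  obtain ⟨_, hy1, ⟨⟨y, g⟩, hy, rfl⟩⟩ := h.dense.inter_open_nonempty _ hopen hball
  have hy1 : N (f - y) < ε / (2 * (K + 1)) := hy1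
  rw [lt_div_iff₀ (by positivity)] at hy1
  have hlim : Tendsto (fun t : ℝ≥0 => 2 * (t : ℝ) * K * N g) (𝓝[>] 0) (𝓝 0) := by
    have hc : Continuous fun t : ℝ≥0 => 2 * (t : ℝ) * K * N g := by fun_prop
    have := hc.tendsto 0
    simp only [NNReal.coe_zero, mul_zero, zero_mul] at this
    exact this.mono_left nhdsWithin_le_nhds
  have hle : ∀ᶠ t : ℝ≥0 in 𝓝[>] 0, t ≤ 1 := nhdsWithin_le_nhds (eventually_le_nhds zero_lt_one)
  filter_upwards [self_mem_nhdsWithin, hle,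
    hlim.eventually (gt_mem_nhds (show (0 : ℝ) < ε / 2 by positivity))] with t ht0 ht1 ht2
  have ht0' : (0 : ℝ) < t := by exact_mod_cast ht0
  have h1 := h.norm_semigroup_sub_le hT t hu hy ht1
  rw [dist_eq_norm]
  have e : ((t : ℝ)⁻¹) • (T t u - u) - f = ((t : ℝ)⁻¹) • (T t u - u - (t : ℝ) • f) := by
    rw [smul_sub _ _ ((t : ℝ) • f), smul_smul, inv_mul_cancel₀ ht0'.ne', one_smul]
  rw [e, norm_smul, norm_inv, Real.norm_of_nonneg ht0'.le, ← div_eq_inv_mul, div_lt_iff₀ ht0']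
  refine h1.trans_lt (mul_lt_mul_of_pos_right ?_ ht0')
  linarith

lemma isC0Semigroup (h : IsQuasiDissipative G N γ M R)
    (hT : ∀ (t : ℝ≥0) x, Tendsto (fun n : ℕ => expYosida R n t x) atTop (𝓝 (T t x))) :
    IsC0Semigroup T := by
  have hγ := h.nonneg
  refine ⟨?_, ?_, ?_⟩
  · ext x
    have h1 := hT 0 x
    rw [NNReal.coe_zero] at h1
    simp only [expYosida_zero] at h1
    exact tendsto_nhds_unique h1 tendsto_const_nhds
  · intro s t
    ext x
    have h1 := hT (s + t) x
    have h2 : Tendsto (fun n : ℕ => expYosida R n (s + t : ℝ≥0) x) atTop (𝓝 (T s (T t x))) := by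
      have h3 := hT s (T t x)
      have h4 : Tendsto (fun n : ℕ => expYosida R n s (expYosida R n t x - T t x)) atTop (𝓝 0) := by
        rw [tendsto_zero_iff_norm_tendsto_zero]
        have h5 : Tendsto (fun n : ℕ => Real.exp (2 * γ * s) * N (expYosida R n t x - T t x)) atTop
            (𝓝 0) := by
          have := ((h.continuous_seminorm.tendsto _).comp
            ((hT t x).sub_const (T t x))).const_mul (Real.exp (2 * γ * s))
          simpa using this
        refine squeeze_zero' (Eventually.of_forall fun _ => norm_nonneg _) ?_ h5
        filter_upwards [tendsto_natCast_atTop_atTop.eventually (eventually_ge_atTop (2 * γ + 1))]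
          with n hn
        exact (h.norm_le _).trans (h.seminorm_expYosida_le hn s.2 _)
      have h6 := h3.add h4
      rw [add_zero] at h6
      refine h6.congr fun n => ?_
      rw [NNReal.coe_add, expYosida_add, mul_apply_eq_comp, map_sub]
      abel
    exact tendsto_nhds_unique h1 h2
  · intro f
    rw [Metric.tendsto_nhds]
    intro ε hε
    set K := Real.exp (2 * γ) with hK
    have hKpos : 0 < K := Real.exp_pos _
    have hball : {y : E | N (f - y) < ε / (2 * (K + 1))}.Nonempty :=
      ⟨f, by simpa using by positivity⟩
    have hopen : IsOpen {y : E | N (f - y) < ε / (2 * (K + 1))} :=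
      isOpen_lt (h.continuous_seminorm.comp (continuous_const.sub continuous_id)) continuous_const
    obtain ⟨_, hy1, ⟨⟨y, g⟩, hy, rfl⟩⟩ := h.dense.inter_open_nonempty _ hopen hball
    have hy1 : N (f - y) < ε / (2 * (K + 1)) := hy1
    rw [lt_div_iff₀ (by positivity)] at hy1
    have hlim : Tendsto (fun t : ℝ≥0 => T t y - y) (𝓝[>] 0) (𝓝 0) := by
      have h1 : Tendsto (fun t : ℝ≥0 => ((t : ℝ)⁻¹) • (T t y - y)) (𝓝[>] 0) (𝓝 g) :=
        h.mem_generatorGraph hT hy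
      have h2 : Tendsto (fun t : ℝ≥0 => (t : ℝ)) (𝓝[>] 0) (𝓝 0) := by
        have := (NNReal.continuous_coe).tendsto 0
        simp only [NNReal.coe_zero] at this
        exact this.mono_left nhdsWithin_le_nhds
      have h3 := h2.smul h1
      rw [zero_smul] at h3
      refine h3.congr' ?_
      filter_upwards [self_mem_nhdsWithin] with t ht
      have ht' : (t : ℝ) ≠ 0 := by exact_mod_cast (ne_of_gt ht)
      rw [smul_smul, mul_inv_cancel₀ ht', one_smul]
    have hle : ∀ᶠ t : ℝ≥0 in 𝓝[>] 0, t ≤ 1 := nhdsWithin_le_nhds (eventually_le_nhds zero_lt_one)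
    have hev := (tendsto_zero_iff_norm_tendsto_zero.1 hlim).eventually
      (gt_mem_nhds (show (0 : ℝ) < ε / 2 by positivity))
    filter_upwards [hle, hev] with t ht1 ht2
    have ht1' : (t : ℝ) ≤ 1 := by exact_mod_cast ht1
    rw [dist_eq_norm]
    have e : T t f - f = T t (f - y) + (T t y - y) - (f - y) := by rw [map_sub]; abel
    have h3 : ‖T t (f - y)‖ ≤ K * N (f - y) := by
      refine (h.norm_le _).trans ((h.seminorm_semigroup_le hT t _).trans ?_)
      refine mul_le_mul_of_nonneg_right (Real.exp_le_exp.2 ?_) (apply_nonneg N _)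
      nlinarith
    have h4 := h.norm_le (f - y)
    calc ‖T t f - f‖ ≤ ‖T t (f - y)‖ + ‖T t y - y‖ + ‖f - y‖ := by
          rw [e]; exact (norm_sub_le _ _).trans (add_le_add (norm_add_le _ _) le_rfl)
      _ < ε := by linarith

/-- If `x ↦ e^{-c t} T(t) x` is constant along a functional, the functional vanishes at `x`. -/
lemma functional_eq_zero (h : IsQuasiDissipative G N γ M R) (hT0 : IsC0Semigroup T)
    (hTN : ∀ (t : ℝ≥0) x, N (T t x) ≤ Real.exp (2 * γ * t) * N x)
    {c : ℝ} (hc : 2 * γ < c) {x y : E} (hxy : (x, y) ∈ generatorGraph T) (φ : E →L[ℝ] ℝ)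
    (hφ : ∀ t, φ (T t (y - c • x)) = 0) : φ x = 0 := by
  -- F is constant, its right derivative being a multiple of φ(T(s)(y - c x)) = 0, and it tends to 0
  -- because c exceeds the growth bound 2γ.
  set F : ℝ → ℝ := fun σ => φ (Real.exp (-(c * σ)) • T σ.toNNReal x) with hF
  have hcont : Continuous F := φ.continuous.comp (hT0.continuous_exp_smul x c)
  have hder : ∀ s : ℝ, 0 ≤ s → HasDerivWithinAt F 0 (Ici s) s := by
    intro s hs
    have h1 := φ.hasFDerivAt.comp_hasDerivWithinAt s (hT0.hasDerivWithinAt_exp_smul hxy c hs)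
    rwa [map_smul, hφ, smul_zero] at h1
  have hconst : ∀ s : ℝ, 0 ≤ s → F s = φ x := by
    intro s hs
    have := constant_of_has_deriv_right_zero hcont.continuousOn
      (fun σ (hσ : σ ∈ Ico (0 : ℝ) s) => hder σ hσ.1) s ⟨hs, le_rfl⟩
    rw [this]
    simp [hF, hT0.map_zero]
  have hlim : Tendsto F atTop (𝓝 0) := by
    rw [tendsto_zero_iff_norm_tendsto_zero]
    have hg : Tendsto (fun s : ℝ => ‖φ‖ * N x * Real.exp (-((c - 2 * γ) * s))) atTop (𝓝 0) := by
      have h1 : Tendsto (fun s : ℝ => (c - 2 * γ) * s) atTop atTop :=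
        tendsto_id.const_mul_atTop (by linarith)
      have := (Real.tendsto_exp_neg_atTop_nhds_zero.comp h1).const_mul (‖φ‖ * N x)
      simpa using this
    refine squeeze_zero' (Eventually.of_forall fun _ => norm_nonneg _) ?_ hg
    filter_upwards [eventually_ge_atTop 0] with s hs
    have h1 : ‖F s‖ ≤ ‖φ‖ * ‖Real.exp (-(c * s)) • T s.toNNReal x‖ := φ.le_opNorm _
    refine h1.trans ?_
    rw [norm_smul, Real.norm_of_nonneg (Real.exp_pos _).le, mul_assoc]
    refine mul_le_mul_of_nonneg_left ?_ (norm_nonneg _)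
    have h2 := (h.norm_le _).trans (hTN s.toNNReal x)
    rw [Real.coe_toNNReal _ hs] at h2
    refine (mul_le_mul_of_nonneg_left h2 (Real.exp_pos _).le).trans (le_of_eq ?_)
    rw [← mul_assoc, ← Real.exp_add, mul_comm]
    congr 2; ring
  have h1 : Tendsto F atTop (𝓝 (φ x)) := by
    refine tendsto_const_nhds.congr' ?_
    filter_upwards [eventually_ge_atTop 0] with s hs
    exact (hconst s hs).symm
  exact tendsto_nhds_unique h1 hlim

lemma generatorGraph_eq (h : IsQuasiDissipative G N γ M R)
    (hT : ∀ (t : ℝ≥0) x, Tendsto (fun n : ℕ => expYosida R n t x) atTop (𝓝 (T t x))) :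
    generatorGraph T = G := by
  have hγ := h.nonneg
  refine Subset.antisymm ?_ fun p hp => h.mem_generatorGraph hT hp
  rintro ⟨u, f⟩ hu
  set c := 2 * γ + 1 with hc
  have hc1 : γ < c := by linarith
  have hv := h.mem c hc1 (c • u - f)
  set v := R c (c • u - f) with hvdef
  have hv' := h.mem_generatorGraph hT hv
  have hx : (u - v, c • (u - v)) ∈ generatorGraph T := by
    have h1 := Tendsto.sub (f := fun t : ℝ≥0 => ((t : ℝ)⁻¹) • (T t u - u))
      (g := fun t : ℝ≥0 => ((t : ℝ)⁻¹) • (T t v - v)) hu hv'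
    have e : (u, f).2 - (v, c • v - (c • u - f)).2 = c • (u - v) := by
      simp only [smul_sub]; abel
    rw [e] at h1
    refine h1.congr fun t => ?_
    rw [← smul_sub, map_sub, sub_sub_sub_comm]
  have hzero : u - v = 0 := by
    refine SeparatingDual.eq_zero_of_forall_dual_eq_zero (R := ℝ) (fun φ => ?_)
    refine h.functional_eq_zero (h.isC0Semigroup hT) (h.seminorm_semigroup_le hT)
      (c := c) (by linarith) hx φ fun t => ?_
    simp
  have : u = v := sub_eq_zero.1 hzero
  rw [← this] at hv
  simpa using hv

/-- **Hille–Yosida**: a quasi-dissipative operator generates a semigroup. -/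
theorem exists_isSemigroupGeneratedBy (h : IsQuasiDissipative G N γ M R) :
    ∃ T : ℝ≥0 → E →L[ℝ] E, IsSemigroupGeneratedBy T (G : Set (E × E)) := by
  obtain ⟨T, hT⟩ := h.exists_semigroup
  exact ⟨T, h.isC0Semigroup hT, h.generatorGraph_eq hT⟩

lemma tendsto_expYosida (h : IsQuasiDissipative G N γ M R)
    (hT : IsSemigroupGeneratedBy T (G : Set (E × E))) (t : ℝ≥0) (x : E) :
    Tendsto (fun n : ℕ => expYosida R n t x) atTop (𝓝 (T t x)) := by
  obtain ⟨T', hT'⟩ := h.exists_semigroup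
  have : T = T' := hT.1.eq_of_generatorGraph_eq (h.isC0Semigroup hT')
    (hT.2.trans (h.generatorGraph_eq hT').symm) (by rw [hT.2]; exact h.dense)
  rw [this]
  exact hT' t x

/-- A closed convex cone that is invariant under the resolvent is invariant under the semigroup. -/
theorem semigroup_mem_of_resolvent_mem (h : IsQuasiDissipative G N γ M R)
    (hT : IsSemigroupGeneratedBy T (G : Set (E × E))) {C : Set E} (hC : IsClosed C)
    (h0 : (0 : E) ∈ C) (hadd : ∀ x ∈ C, ∀ y ∈ C, x + y ∈ C)
    (hsmul : ∀ c : ℝ, 0 ≤ c → ∀ x ∈ C, c • x ∈ C)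
    (hR : ∀ c, γ < c → ∀ x ∈ C, R c x ∈ C) (t : ℝ≥0) {x : E} (hx : x ∈ C) : T t x ∈ C := by
  refine hC.mem_of_tendsto (h.tendsto_expYosida hT t x) ?_
  filter_upwards [tendsto_natCast_atTop_atTop.eventually (eventually_gt_atTop γ)] with n hn
  -- Up to a positive factor the approximating semigroup is the exponential of a non-negative
  -- multiple of `R n`, which preserves the cone.
  rw [expYosida_eq]
  refine hsmul _ (Real.exp_pos _).le _ (exp_apply_mem_of_mapsTo hC h0 hadd hsmul ?_ hx)
  intro y hy
  exact hsmul _ (by positivity) _ (hR n hn y hy)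

/-- A closed subspace that is invariant under the semigroup is invariant under the resolvent. -/
theorem resolvent_mem_of_semigroup_mem (h : IsQuasiDissipative G N γ M R)
    (hT : IsSemigroupGeneratedBy T (G : Set (E × E))) {I : Submodule ℝ E}
    (hI : IsClosed (I : Set E)) (hTI : ∀ t, ∀ x ∈ I, T t x ∈ I) {c : ℝ} (hc : 2 * γ < c)
    {x : E} (hx : x ∈ I) : R c x ∈ I := by
  have hγ := h.nonneg
  by_contra hcon
  -- A functional separating R(c) x from I vanishes on I, hence along the orbit of x. Since (c - G)
  -- R(c) x = x, `functional_eq_zero` forces it to vanish at R(c) x too.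
  obtain ⟨φ, s, hφ1, hφ2⟩ := geometric_hahn_banach_closed_point I.convex hI hcon
  have hφ0 : ∀ y ∈ I, φ y = 0 := by
    intro y hy
    by_contra hne
    -- A functional bounded above on a subspace is zero there: at this multiple of y it would take
    -- the forbidden value s.
    have h1 := hφ1 (((φ y)⁻¹ * s) • y) (I.smul_mem _ hy)
    simp only [map_smul, smul_eq_mul] at h1
    rw [mul_comm, ← mul_assoc, mul_inv_cancel₀ hne, one_mul] at h1
    exact lt_irrefl _ h1
  have h2 := h.mem c (by linarith) x
  have h3 : φ (R c x) = 0 := by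
    refine h.functional_eq_zero hT.1 (h.seminorm_semigroup_le (h.tendsto_expYosida hT))
      hc (y := c • R c x - x) (by rw [hT.2]; exact h2) φ fun t => ?_
    have e : c • R c x - x - c • R c x = -x := by abel
    rw [e, map_neg, map_neg, hφ0 _ (hTI t x hx), neg_zero]
  have h4 := hφ1 0 I.zero_mem
  rw [map_zero] at h4
  rw [h3] at hφ2
  exact absurd hφ2 (not_lt.2 h4.le)

end IsQuasiDissipative

end HilleYosida

/-! ### Absolutely continuous functions and Tonelli on triangles -/

lemma LipschitzOnWith.comp_absolutelyContinuousOnInterval {f g : ℝ → ℝ} {a b : ℝ} {K : ℝ≥0}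
    {s : Set ℝ} (hg : LipschitzOnWith K g s) (hf : AbsolutelyContinuousOnInterval f a b)
    (hfs : MapsTo f (uIcc a b) s) : AbsolutelyContinuousOnInterval (fun x => g (f x)) a b := by
  rw [absolutelyContinuousOnInterval_iff] at hf ⊢
  intro ε hε
  obtain ⟨δ, hδ, h⟩ := hf (ε / (K + 1)) (by positivity)
  refine ⟨δ, hδ, fun I hI hlt => ?_⟩
  have h1 := h I hI hlt
  calc ∑ i ∈ Finset.range I.1, dist (g (f (I.2 i).1)) (g (f (I.2 i).2))
      ≤ ∑ i ∈ Finset.range I.1, K * dist (f (I.2 i).1) (f (I.2 i).2) := by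
        refine Finset.sum_le_sum fun i hi => ?_
        have hm := hI.1 i hi
        exact hg.dist_le_mul _ (hfs hm.1) _ (hfs hm.2)
    _ = K * ∑ i ∈ Finset.range I.1, dist (f (I.2 i).1) (f (I.2 i).2) := by rw [Finset.mul_sum]
    _ ≤ K * (ε / (K + 1)) := mul_le_mul_of_nonneg_left h1.le K.2
    _ < (K + 1) * (ε / (K + 1)) := by gcongr; linarith
    _ = ε := by field_simp

lemma absolutelyContinuousOnInterval_exp {f : ℝ → ℝ} {a b : ℝ}
    (hf : AbsolutelyContinuousOnInterval f a b) :
    AbsolutelyContinuousOnInterval (fun x => Real.exp (f x)) a b := by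
  obtain ⟨M, hM⟩ := hf.exists_bound
  obtain ⟨K, hK⟩ := (Real.contDiff_exp (n := 1)).contDiffOn.exists_lipschitzOnWith (s := Icc (-M) M)
    (by decide) (convex_Icc _ _) isCompact_Icc
  exact LipschitzOnWith.comp_absolutelyContinuousOnInterval hK hf
    fun x hx => abs_le.1 (hM x hx)

lemma measurable_setLIntegral_Ioc {F : ℝ → ℝ≥0∞} (hF : Measurable F) :
    Measurable fun x => ∫⁻ s in Ioc (0 : ℝ) x, F s := by
  have hS : MeasurableSet {p : ℝ × ℝ | 0 < p.2 ∧ p.2 ≤ p.1} :=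
    (measurableSet_lt measurable_const measurable_snd).inter
      (measurableSet_le measurable_snd measurable_fst)
  have h := (((hF.comp measurable_snd).indicator hS).lintegral_prod_right' (ν := volume))
  convert h using 2 with x
  rw [← lintegral_indicator measurableSet_Ioc]
  rfl

lemma measurable_setLIntegral_Ioi {F : ℝ → ℝ → ℝ≥0∞} (hF : Measurable (Function.uncurry F)) :
    Measurable fun x => ∫⁻ y in Ioi x, F x y := by
  have hS : MeasurableSet {p : ℝ × ℝ | p.1 < p.2} := measurableSet_lt measurable_fst measurable_snd
  have h := ((hF.indicator hS).lintegral_prod_right' (ν := volume))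
  convert h using 2 with x
  rw [← lintegral_indicator measurableSet_Ioi]
  rfl

lemma lintegral_triangle {F : ℝ → ℝ → ℝ≥0∞} (hF : Measurable (Function.uncurry F)) :
    ∫⁻ x in Ioi (0 : ℝ), ∫⁻ y in Ioi x, F x y = ∫⁻ y in Ioi (0 : ℝ), ∫⁻ x in Ioo 0 y, F x y := by
  have hS : MeasurableSet {p : ℝ × ℝ | 0 < p.1 ∧ p.1 < p.2} :=
    (measurableSet_lt measurable_const measurable_fst).inter
      (measurableSet_lt measurable_fst measurable_snd)
  have h := lintegral_lintegral_swap (μ := volume) (ν := volume)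
    (f := fun x y => {p : ℝ × ℝ | 0 < p.1 ∧ p.1 < p.2}.indicator (Function.uncurry F) (x, y))
    (hF.indicator hS).aemeasurable
  have e1 : ∫⁻ x in Ioi (0 : ℝ), ∫⁻ y in Ioi x, F x y = ∫⁻ x, ∫⁻ y,
      {p : ℝ × ℝ | 0 < p.1 ∧ p.1 < p.2}.indicator (Function.uncurry F) (x, y) := by
    rw [← lintegral_indicator measurableSet_Ioi]
    refine lintegral_congr fun x => ?_
    by_cases hx : 0 < x
    · rw [indicator_of_mem (mem_Ioi.2 hx), ← lintegral_indicator measurableSet_Ioi]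
      refine lintegral_congr fun y => ?_
      by_cases hy : x < y <;> simp [indicator, hx, hy]
    · rw [indicator_of_notMem (by simpa using hx)]
      simp [indicator, hx]
  have e2 : ∫⁻ y in Ioi (0 : ℝ), ∫⁻ x in Ioo 0 y, F x y = ∫⁻ y, ∫⁻ x,
      {p : ℝ × ℝ | 0 < p.1 ∧ p.1 < p.2}.indicator (Function.uncurry F) (x, y) := by
    rw [← lintegral_indicator measurableSet_Ioi]
    refine lintegral_congr fun y => ?_
    by_cases hy : 0 < y
    · rw [indicator_of_mem (mem_Ioi.2 hy), ← lintegral_indicator measurableSet_Ioo]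
      refine lintegral_congr fun x => ?_
      by_cases hx : 0 < x ∧ x < y <;> simp [indicator, hx]
    · rw [indicator_of_notMem (by simpa using hy)]
      symm
      rw [lintegral_eq_zero_of_ae_eq_zero]
      refine Eventually.of_forall fun x => ?_
      have : ¬ (0 < x ∧ x < y) := fun hxy => hy (hxy.1.trans hxy.2)
      simp [indicator, this]
  rw [e1, e2, h]

/-! ### Standing assumptions in quantitative form -/

/-- The weight `1 + κ x ^ m`. -/
def wt (κ m x : ℝ) : ℝ := 1 + κ * x ^ m

/-- The properties of the coefficients on which the generation theorem depends. -/
structure Coeffs (r a β : ℝ → ℝ) (b : ℝ → ℝ → ℝ) (m κ η C : ℝ) : Prop where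
  r_meas : Measurable r
  r_cont : ContinuousOn r (Ioi 0)
  r_pos : ∀ x, 0 < x → 0 < r x
  r_int : ∀ M, IntegrableOn (fun x => 1 / r x) (Ioc 0 M)
  one_lt : 1 < m
  one_le : 1 ≤ κ
  η_pos : 0 < η
  η_le : η ≤ 1
  C_nonneg : 0 ≤ C
  -- Drift raises the weight at relative rate at most C.
  growth : ∀ x, 0 < x → κ * (m * x ^ (m - 1)) * r x ≤ C * wt κ m x
  a_meas : Measurable a
  a_nonneg : ∀ x, 0 < x → 0 ≤ a x
  a_bdd : ∀ M : ℝ, ∃ D : ℝ, ∀ᵐ x ∂(volume.restrict (Ioc 0 M)), a x ≤ D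
  b_meas : Measurable (Function.uncurry b)
  b_nonneg : ∀ x y, 0 < x → 0 < y → 0 ≤ b x y
  -- Splitting loses the fraction η of the weight, up to an error bounded independently of the
  -- possibly unbounded rate a.
  frag : ∀ᵐ y ∂(volume.restrict (Ioi (0 : ℝ))),
    ENNReal.ofReal (a y) * ∫⁻ x in Ioo 0 y, ENNReal.ofReal (wt κ m x * b x y) ≤
      ENNReal.ofReal (((1 - η) * a y + C) * wt κ m y)
  β_meas : Measurable β
  β_nonneg : ∀ x, 0 < x → 0 ≤ β x
  β_bdd : ∀ᵐ x ∂(volume.restrict (Ioi (0 : ℝ))), β x ≤ C * wt κ m x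

/-- The accumulated rate `∫_0^x (c + a) / r`. -/
def absorb (r a : ℝ → ℝ) (c x : ℝ) : ℝ := ∫ s in Ioc 0 x, (c + a s) / r s

/-- The solution `u` of `(r u)' + (c + a) u = g` with `(r u)(0) = k`. -/
def transportSol (r a : ℝ → ℝ) (c : ℝ) (g : ℝ → ℝ≥0∞) (k : ℝ≥0∞) (x : ℝ) : ℝ≥0∞ :=
  ENNReal.ofReal (Real.exp (-absorb r a c x) / r x) *
    (k + ∫⁻ s in Ioc 0 x, ENNReal.ofReal (Real.exp (absorb r a c s)) * g s)

/-- The gain term for `[0, ∞]`-valued functions. -/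
def gainE (a : ℝ → ℝ) (b : ℝ → ℝ → ℝ) (u : ℝ → ℝ≥0∞) (x : ℝ) : ℝ≥0∞ :=
  ∫⁻ y in Ioi x, ENNReal.ofReal (a y * b x y) * u y

/-- The number of births, for `[0, ∞]`-valued functions. -/
def birthE (β : ℝ → ℝ) (u : ℝ → ℝ≥0∞) : ℝ≥0∞ :=
  ∫⁻ y in Ioi (0 : ℝ), ENNReal.ofReal (β y) * u y

/-- The weighted integral `∫ (1 + κ x ^ m) u`. -/
def wInt (κ m : ℝ) (u : ℝ → ℝ≥0∞) : ℝ≥0∞ :=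
  ∫⁻ x in Ioi (0 : ℝ), ENNReal.ofReal (wt κ m x) * u x

/-- The weighted integral `∫ a (1 + κ x ^ m) u`. -/
def awInt (a : ℝ → ℝ) (κ m : ℝ) (u : ℝ → ℝ≥0∞) : ℝ≥0∞ :=
  ∫⁻ x in Ioi (0 : ℝ), ENNReal.ofReal (a x * wt κ m x) * u x

lemma one_le_wt {κ m x : ℝ} (hκ : 1 ≤ κ) (hx : 0 < x) : 1 ≤ wt κ m x := by
  unfold wt
  have := Real.rpow_nonneg hx.le m
  nlinarith

lemma measurable_wt (κ m : ℝ) : Measurable (wt κ m) := by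
  unfold wt; fun_prop

namespace Coeffs

variable {r a β : ℝ → ℝ} {b : ℝ → ℝ → ℝ} {m κ η C : ℝ}

lemma wt_pos (h : Coeffs r a β b m κ η C) {x : ℝ} (hx : 0 < x) : 0 < wt κ m x :=
  zero_lt_one.trans_le (one_le_wt h.one_le hx)

lemma hasDerivAt_wt (h : Coeffs r a β b m κ η C) (x : ℝ) :
    HasDerivAt (wt κ m) (κ * (m * x ^ (m - 1))) x := by
  have := (((Real.hasDerivAt_rpow_const (x := x) (p := m) (Or.inr h.one_lt.le)).const_mul κ)
    ).const_add 1
  exact this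

lemma absolutelyContinuous_wt (h : Coeffs r a β b m κ η C) (A B : ℝ) :
    AbsolutelyContinuousOnInterval (wt κ m) A B := by
  have h1 : ContDiff ℝ ((1 : ℕ) : WithTop ℕ∞) fun x : ℝ => x ^ m :=
    Real.contDiff_rpow_const_of_le (by simpa using h.one_lt.le)
  have h2 : ContDiff ℝ 1 (wt κ m) := by
    unfold wt
    exact contDiff_const.add (contDiff_const.mul (by simpa using h1))
  exact h2.contDiffOn.absolutelyContinuousOnInterval

lemma integrableOn_rate (h : Coeffs r a β b m κ η C) (c M : ℝ) :
    IntegrableOn (fun s => (c + a s) / r s) (Ioc 0 M) := by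
  obtain ⟨D, hD⟩ := h.a_bdd M
  have h1 := (h.r_int M).bdd_mul (f := fun s => c + a s) (c := |c| + D)
    (h.a_meas.const_add c).aestronglyMeasurable ?_
  · refine h1.congr (Eventually.of_forall fun s => ?_)
    simp [div_eq_mul_inv]
  · filter_upwards [hD, ae_restrict_mem measurableSet_Ioc] with s hs hs0
    rw [Real.norm_eq_abs]
    refine (abs_add_le _ _).trans ?_
    rw [abs_of_nonneg (h.a_nonneg s hs0.1)]
    linarith

lemma intervalIntegrable_rate (h : Coeffs r a β b m κ η C) (c : ℝ) {A B : ℝ} (hA : 0 ≤ A)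
    (hB : 0 ≤ B) : IntervalIntegrable (fun s => (c + a s) / r s) volume A B := by
  have h0 : ∀ M, 0 ≤ M → IntervalIntegrable (fun s => (c + a s) / r s) volume 0 M := fun M hM => by
    rw [intervalIntegrable_iff_integrableOn_Ioc_of_le hM]
    exact h.integrableOn_rate c M
  exact (h0 A hA).symm.trans (h0 B hB)

lemma absorb_eq {c x : ℝ} (hx : 0 ≤ x) : absorb r a c x = ∫ s in (0 : ℝ)..x, (c + a s) / r s := by
  rw [absorb, intervalIntegral.integral_of_le hx]

lemma absolutelyContinuous_absorb (h : Coeffs r a β b m κ η C) (c : ℝ) {A B : ℝ} (hA : 0 ≤ A)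
    (hB : 0 ≤ B) : AbsolutelyContinuousOnInterval (absorb r a c) A B := by
  have h0 : 0 ≤ max A B := hA.trans (le_max_left _ _)
  have h1 := (h.intervalIntegrable_rate c le_rfl h0).absolutelyContinuousOnInterval_intervalIntegral
    (c := 0) left_mem_uIcc
  have h2 : AbsolutelyContinuousOnInterval (absorb r a c) 0 (max A B) := by
    rw [absolutelyContinuousOnInterval_iff] at h1 ⊢
    intro ε hε
    obtain ⟨δ, hδ, hh⟩ := h1 ε hε
    refine ⟨δ, hδ, fun E hE hlt => (hh E hE hlt).trans_le' (le_of_eq ?_)⟩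
    refine Finset.sum_congr rfl fun i hi => ?_
    have hm := hE.1 i hi
    rw [uIcc_of_le h0] at hm
    rw [absorb_eq hm.1.1, absorb_eq hm.2.1]
  refine h2.mono ?_
  rw [uIcc_of_le h0]
  rintro x ⟨hx1, hx2⟩
  exact ⟨(le_min hA hB).trans hx1, hx2⟩

lemma ae_hasDerivAt_absorb (h : Coeffs r a β b m κ η C) (c M : ℝ) :
    ∀ᵐ x, x ∈ Ioo 0 M → HasDerivAt (absorb r a c) ((c + a x) / r x) x := by
  rcases le_or_gt M 0 with hM | hM
  · exact Eventually.of_forall fun x hx => absurd (hx.1.trans hx.2) (not_lt.2 hM)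
  filter_upwards [(h.intervalIntegrable_rate c le_rfl hM.le).ae_hasDerivAt_integral] with x hx hx0
  have h1 := hx (by rw [uIcc_of_le hM.le]; exact ⟨hx0.1.le, hx0.2.le⟩) 0 left_mem_uIcc
  refine h1.congr_of_eventuallyEq ?_
  filter_upwards [lt_mem_nhds hx0.1] with y hy
  exact absorb_eq hy.le

lemma measurable_absorb (h : Coeffs r a β b m κ η C) (c : ℝ) : Measurable (absorb r a c) := by
  have hS : MeasurableSet {p : ℝ × ℝ | 0 < p.2 ∧ p.2 ≤ p.1} :=
    (measurableSet_lt measurable_const measurable_snd).inter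
      (measurableSet_le measurable_snd measurable_fst)
  have hF : Measurable fun s => (c + a s) / r s := (h.a_meas.const_add c).div h.r_meas
  have h1 := ((hF.comp measurable_snd).indicator hS).stronglyMeasurable.integral_prod_right'
    (ν := volume)
  convert h1.measurable using 1
  funext x
  rw [absorb, ← integral_indicator measurableSet_Ioc]
  rfl

lemma measurable_transportSol (h : Coeffs r a β b m κ η C) (c : ℝ) {g : ℝ → ℝ≥0∞}
    (hg : Measurable g) (k : ℝ≥0∞) : Measurable (transportSol r a c g k) := by
  have h1 := h.measurable_absorb c
  refine Measurable.mul ?_ (Measurable.const_add (measurable_setLIntegral_Ioc ?_) k)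
  · exact (h1.neg.exp.div h.r_meas).ennreal_ofReal
  · exact h1.exp.ennreal_ofReal.mul hg

lemma measurable_gainE (h : Coeffs r a β b m κ η C) {u : ℝ → ℝ≥0∞} (hu : Measurable u) :
    Measurable (gainE a b u) := by
  refine measurable_setLIntegral_Ioi (F := fun x y => ENNReal.ofReal (a y * b x y) * u y) ?_
  exact ((h.a_meas.comp measurable_snd).mul h.b_meas).ennreal_ofReal.mul (hu.comp measurable_snd)

/-- The kernel estimate behind the dissipativity of the transport part. -/
lemma lintegral_kernel_le (h : Coeffs r a β b m κ η C) {c s : ℝ} (hc : C ≤ c) (hs : 0 ≤ s) :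
    ∫⁻ x in Ioi s, ENNReal.ofReal ((c - C + a x) * wt κ m x) *
        ENNReal.ofReal (Real.exp (-absorb r a c x) / r x) ≤
      ENNReal.ofReal (wt κ m s * Real.exp (-absorb r a c s)) := by
  set f : ℝ → ℝ≥0∞ := fun x => ENNReal.ofReal ((c - C + a x) * wt κ m x) *
        ENNReal.ofReal (Real.exp (-absorb r a c x) / r x) with hf
  -- With P the accumulated rate and w the weight, -F' = ((c + a) w - w' r) e^{-P} / r dominates the
  -- integrand because w' r ≤ C w. Integration leaves F(s) - F(X) ≤ F(s).
  set F : ℝ → ℝ := fun x => wt κ m x * Real.exp (-absorb r a c x) with hFdef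
  have key : ∀ X, s ≤ X → ∫⁻ x in Ioc s X, f x ≤ ENNReal.ofReal (F s) := by
    intro X hX
    have hAC : AbsolutelyContinuousOnInterval F s X :=
      (h.absolutelyContinuous_wt s X).fun_mul (absolutelyContinuousOnInterval_exp
        (h.absolutelyContinuous_absorb c hs (hs.trans hX)).fun_neg)
    have hint : IntegrableOn (fun x => -deriv F x) (Ioc s X) :=
      ((intervalIntegrable_iff_integrableOn_Ioc_of_le hX).1 hAC.intervalIntegrable_deriv).neg
    have hle : ∀ᵐ x ∂(volume.restrict (Ioc s X)), f x ≤ ENNReal.ofReal (-deriv F x) ∧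
        0 ≤ -deriv F x := by
      filter_upwards [ae_restrict_of_ae (h.ae_hasDerivAt_absorb c (X + 1)),
        ae_restrict_mem measurableSet_Ioc] with x hx hx1
      have hx0 : 0 < x := hs.trans_lt hx1.1
      have hP := hx ⟨hx0, by linarith [hx1.2]⟩
      have hd : HasDerivAt F (κ * (m * x ^ (m - 1)) * Real.exp (-absorb r a c x) + wt κ m x *
          (Real.exp (-absorb r a c x) * (-((c + a x) / r x)))) x :=
        (h.hasDerivAt_wt x).mul hP.neg.exp
      have hr := h.r_pos x hx0
      have hw := h.wt_pos hx0
      have ha := h.a_nonneg x hx0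
      have hle : (c - C + a x) * wt κ m x * (Real.exp (-absorb r a c x) / r x) ≤ -deriv F x := by
        rw [hd.deriv]
        have h1 := h.growth x hx0
        have e : -(κ * (m * x ^ (m - 1)) * Real.exp (-absorb r a c x) + wt κ m x *
          (Real.exp (-absorb r a c x) * (-((c + a x) / r x)))) =
          ((c + a x) * wt κ m x - κ * (m * x ^ (m - 1)) * r x) *
            (Real.exp (-absorb r a c x) / r x) := by
          field_simp
          ring
        rw [e]
        refine mul_le_mul_of_nonneg_right ?_ (by positivity)
        nlinarith
      have hnn : 0 ≤ (c - C + a x) * wt κ m x :=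
        mul_nonneg (by linarith) hw.le
      refine ⟨?_, le_trans (mul_nonneg hnn (by positivity)) hle⟩
      simp only [hf]
      rw [← ENNReal.ofReal_mul hnn]
      exact ENNReal.ofReal_le_ofReal hle
    calc ∫⁻ x in Ioc s X, f x ≤ ∫⁻ x in Ioc s X, ENNReal.ofReal (-deriv F x) :=
          lintegral_mono_ae (hle.mono fun _ hx => hx.1)
      _ = ENNReal.ofReal (∫ x in Ioc s X, -deriv F x) :=
          (ofReal_integral_eq_lintegral_ofReal hint (hle.mono fun _ hx => hx.2)).symm
      _ = ENNReal.ofReal (F s - F X) := by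
          rw [integral_neg, ← intervalIntegral.integral_of_le hX, hAC.integral_deriv_eq_sub]
          congr 1; ring
      _ ≤ ENNReal.ofReal (F s) := by
          refine ENNReal.ofReal_le_ofReal ?_
          rcases hX.eq_or_lt with rfl | hlt
          · have : 0 ≤ F s := mul_nonneg (by
              unfold wt
              have := Real.rpow_nonneg hs m
              have := h.one_le
              positivity) (Real.exp_pos _).le
            linarith
          · have : 0 ≤ F X := mul_nonneg (h.wt_pos (hs.trans_lt hlt)).le (Real.exp_pos _).le
            linarith
  have hU : Ioi s = ⋃ n : ℕ, Ioc s (s + n) := by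
    ext x
    simp only [mem_Ioi, mem_iUnion, mem_Ioc]
    constructor
    · intro hx
      obtain ⟨n, hn⟩ := exists_nat_ge (x - s)
      exact ⟨n, hx, by linarith⟩
    · rintro ⟨n, hn, -⟩; exact hn
  rw [hU, setLIntegral_iUnion_of_directed]
  · exact iSup_le fun n => key _ (by simp)
  · refine Monotone.directed_le fun i j hij => Ioc_subset_Ioc_right ?_
    have : (i : ℝ) ≤ j := by exact_mod_cast hij
    linarith

/-- Dissipativity of the transport part. -/
lemma lintegral_transportSol_le (h : Coeffs r a β b m κ η C) {c : ℝ} (hc : C ≤ c)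
    {g : ℝ → ℝ≥0∞} (hg : Measurable g) (k : ℝ≥0∞) :
    ∫⁻ x in Ioi (0 : ℝ), ENNReal.ofReal ((c - C + a x) * wt κ m x) * transportSol r a c g k x ≤
      k + wInt κ m g := by
  have hP := h.measurable_absorb c
  have hw := measurable_wt κ m
  set J : ℝ → ℝ≥0∞ := fun x => ENNReal.ofReal ((c - C + a x) * wt κ m x) *
        ENNReal.ofReal (Real.exp (-absorb r a c x) / r x) with hJ
  have hJm : Measurable J :=
    ((h.a_meas.const_add _).mul hw).ennreal_ofReal.mul (hP.neg.exp.div h.r_meas).ennreal_ofReal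
  set q : ℝ → ℝ≥0∞ := fun s => ENNReal.ofReal (Real.exp (absorb r a c s)) * g s with hq
  have hqm : Measurable q := hP.exp.ennreal_ofReal.mul hg
  -- After exchanging the integrals, each source at s is weighted by the kernel integral over (s,
  -- ∞), which is at most w(s) e^{-P(s)} and cancels the factor e^{P(s)}. The boundary value enters
  -- at s = 0, where the weight is 1.
  have e1 : ∫⁻ x in Ioi (0 : ℝ), ENNReal.ofReal ((c - C + a x) * wt κ m x) *
      transportSol r a c g k x =
      k * (∫⁻ x in Ioi (0 : ℝ), J x) + ∫⁻ x in Ioi (0 : ℝ), ∫⁻ s in Ioo 0 x, J x * q s := by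
    rw [← lintegral_const_mul _ hJm, ← lintegral_add_left (hJm.const_mul k)]
    refine lintegral_congr fun x => ?_
    rw [lintegral_const_mul _ hqm, setLIntegral_congr Ioo_ae_eq_Ioc, transportSol]
    simp only [hJ, hq]
    ring
  rw [e1, ← lintegral_triangle (F := fun s x => J x * q s)
    ((hJm.comp measurable_snd).mul (hqm.comp measurable_fst))]
  refine add_le_add ?_ ?_
  · have h1 := h.lintegral_kernel_le hc (le_refl (0 : ℝ))
    have h2 : wt κ m 0 * Real.exp (-absorb r a c 0) = 1 := by
      have : m ≠ 0 := (zero_lt_one.trans h.one_lt).ne'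
      simp [wt, absorb, Real.zero_rpow this]
    rw [h2, ENNReal.ofReal_one] at h1
    calc k * ∫⁻ x in Ioi (0 : ℝ), J x ≤ k * 1 := by gcongr
      _ = k := mul_one k
  · refine lintegral_mono_ae ?_
    filter_upwards [ae_restrict_mem measurableSet_Ioi] with s hs
    have hs0 : (0 : ℝ) < s := hs
    rw [lintegral_mul_const _ hJm]
    have h1 := h.lintegral_kernel_le hc hs0.le
    calc (∫⁻ x in Ioi s, J x) * q s
        ≤ ENNReal.ofReal (wt κ m s * Real.exp (-absorb r a c s)) * q s := by gcongr
      _ = ENNReal.ofReal (wt κ m s) * g s := by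
        simp only [hq]
        rw [← mul_assoc, ← ENNReal.ofReal_mul (mul_nonneg (h.wt_pos hs0).le (Real.exp_pos _).le),
          mul_assoc (wt κ m s), ← Real.exp_add, neg_add_cancel, Real.exp_zero, mul_one]

/-- The gain term is controlled by the loss term. -/
lemma wInt_gainE_le (h : Coeffs r a β b m κ η C) {u : ℝ → ℝ≥0∞} (hu : Measurable u) :
    wInt κ m (gainE a b u) ≤
      ENNReal.ofReal (1 - η) * awInt a κ m u + ENNReal.ofReal C * wInt κ m u := by
  have hw := measurable_wt κ m
  have hm1 : Measurable (Function.uncurry fun x y => ENNReal.ofReal (a y * b x y) * u y) :=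
    ((h.a_meas.comp measurable_snd).mul h.b_meas).ennreal_ofReal.mul (hu.comp measurable_snd)
  have hm2 : Measurable fun x => ENNReal.ofReal (a x * wt κ m x) * u x :=
    (h.a_meas.mul hw).ennreal_ofReal.mul hu
  have hm3 : Measurable fun x => ENNReal.ofReal (wt κ m x) * u x := hw.ennreal_ofReal.mul hu
  have e1 : wInt κ m (gainE a b u) = ∫⁻ x in Ioi (0 : ℝ), ∫⁻ y in Ioi x,
      ENNReal.ofReal (wt κ m x) * (ENNReal.ofReal (a y * b x y) * u y) := by
    refine lintegral_congr fun x => ?_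
    have hmx : Measurable fun y => ENNReal.ofReal (a y * b x y) * u y :=
      hm1.comp measurable_prodMk_left
    rw [gainE, lintegral_const_mul _ hmx]
  rw [e1, lintegral_triangle (F := fun x y => ENNReal.ofReal (wt κ m x) *
    (ENNReal.ofReal (a y * b x y) * u y)) ((hw.comp measurable_fst).ennreal_ofReal.mul hm1),
    awInt, wInt, ← lintegral_const_mul _ hm2, ← lintegral_const_mul _ hm3,
    ← lintegral_add_left (hm2.const_mul _)]
  refine lintegral_mono_ae ?_
  filter_upwards [h.frag, ae_restrict_mem measurableSet_Ioi] with y hy hy0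
  have hy0' : (0 : ℝ) < y := hy0
  have ha := h.a_nonneg y hy0'
  have hwy := h.wt_pos hy0'
  have e2 : ∫⁻ x in Ioo 0 y, ENNReal.ofReal (wt κ m x) * (ENNReal.ofReal (a y * b x y) * u y) =
      (ENNReal.ofReal (a y) * ∫⁻ x in Ioo 0 y, ENNReal.ofReal (wt κ m x * b x y)) * u y := by
    have hbm : Measurable fun x => b x y := h.b_meas.comp measurable_prodMk_right
    have hwb : Measurable fun x => ENNReal.ofReal (wt κ m x * b x y) := (hw.mul hbm).ennreal_ofReal
    rw [← lintegral_const_mul _ hwb, ← lintegral_mul_const _ (hwb.const_mul _)]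
    refine setLIntegral_congr_fun measurableSet_Ioo fun x hx => ?_
    rw [ENNReal.ofReal_mul ha, ENNReal.ofReal_mul (h.wt_pos hx.1).le]
    ring
  rw [e2]
  calc _ ≤ ENNReal.ofReal (((1 - η) * a y + C) * wt κ m y) * u y := by gcongr
    _ = _ := by
      have hη := h.η_le
      rw [← mul_assoc, ← mul_assoc, ← add_mul, ← ENNReal.ofReal_mul (by linarith),
        ← ENNReal.ofReal_mul h.C_nonneg, ← ENNReal.ofReal_add]
      · congr 2; ring
      · exact mul_nonneg (by linarith) (mul_nonneg ha hwy.le)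
      · exact mul_nonneg h.C_nonneg hwy.le

lemma birthE_le (h : Coeffs r a β b m κ η C) {u : ℝ → ℝ≥0∞} (hu : Measurable u) :
    birthE β u ≤ ENNReal.ofReal C * wInt κ m u := by
  have hw := measurable_wt κ m
  have hm3 : Measurable fun x => ENNReal.ofReal (wt κ m x) * u x := hw.ennreal_ofReal.mul hu
  rw [wInt, ← lintegral_const_mul _ hm3]
  refine lintegral_mono_ae ?_
  filter_upwards [h.β_bdd, ae_restrict_mem measurableSet_Ioi] with y hy hy0
  rw [← mul_assoc, ← ENNReal.ofReal_mul h.C_nonneg]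
  gcongr

end Coeffs

/-! ### The resolvent equation for non-negative data -/

/-- The fixed point map for the resolvent equation with right-hand side `f`. -/
def resolventStep (r a β : ℝ → ℝ) (b : ℝ → ℝ → ℝ) (c : ℝ) (f u : ℝ → ℝ≥0∞) : ℝ → ℝ≥0∞ :=
  transportSol r a c (fun x => f x + gainE a b u x) (birthE β u)

lemma lintegral_mul_iSup {α : Type*} [MeasurableSpace α] {μ : Measure α} {φ : α → ℝ≥0∞}
    {v : ℕ → α → ℝ≥0∞} (hφ : Measurable φ) (hv : ∀ n, Measurable (v n)) (hmono : Monotone v) :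
    ∫⁻ y, φ y * ⨆ n, v n y ∂μ = ⨆ n, ∫⁻ y, φ y * v n y ∂μ := by
  have hm : ∀ n, Measurable fun y => φ y * v n y := fun n => hφ.mul (hv n)
  rw [← lintegral_iSup hm fun i j hij y => mul_le_mul_right (hmono hij y) _]
  simp only [ENNReal.mul_iSup]

section Monotone

variable {r a β : ℝ → ℝ} {b : ℝ → ℝ → ℝ} {c : ℝ}

lemma transportSol_mono {g g' : ℝ → ℝ≥0∞} {k k' : ℝ≥0∞} (hg : ∀ x, 0 < x → g x ≤ g' x)
    (hk : k ≤ k') (x : ℝ) : transportSol r a c g k x ≤ transportSol r a c g' k' x := by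
  unfold transportSol
  refine mul_le_mul_right (add_le_add hk ?_) _
  refine setLIntegral_mono' measurableSet_Ioc fun s hs => ?_
  exact mul_le_mul_right (hg s hs.1) _

lemma transportSol_mono_ae {g g' : ℝ → ℝ≥0∞} {k k' : ℝ≥0∞}
    (hg : ∀ᵐ x ∂(volume.restrict (Ioi (0 : ℝ))), g x ≤ g' x)
    (hk : k ≤ k') (x : ℝ) : transportSol r a c g k x ≤ transportSol r a c g' k' x := by
  unfold transportSol
  refine mul_le_mul_right (add_le_add hk ?_) _
  refine lintegral_mono_ae ?_
  filter_upwards [ae_restrict_of_ae_restrict_of_subset Ioc_subset_Ioi_self hg] with s hs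
  exact mul_le_mul_right hs _

lemma gainE_mono {u v : ℝ → ℝ≥0∞} (huv : ∀ x, u x ≤ v x) (x : ℝ) :
    gainE a b u x ≤ gainE a b v x :=
  lintegral_mono fun y => mul_le_mul_right (huv y) _

lemma birthE_mono {u v : ℝ → ℝ≥0∞} (huv : ∀ x, u x ≤ v x) : birthE β u ≤ birthE β v :=
  lintegral_mono fun y => mul_le_mul_right (huv y) _

lemma resolventStep_mono (f : ℝ → ℝ≥0∞) : Monotone (resolventStep r a β b c f) := fun _ _ huv x =>
  transportSol_mono (fun y _ => add_le_add le_rfl (gainE_mono huv y)) (birthE_mono huv) x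

lemma wInt_add {κ m : ℝ} {u v : ℝ → ℝ≥0∞} (hu : Measurable u) :
    wInt κ m (fun x => u x + v x) = wInt κ m u + wInt κ m v := by
  have h : Measurable fun x => ENNReal.ofReal (wt κ m x) * u x :=
    (measurable_wt κ m).ennreal_ofReal.mul hu
  rw [wInt, wInt, wInt, ← lintegral_add_left h]
  simp only [mul_add]

end Monotone

namespace Coeffs

variable {r a β : ℝ → ℝ} {b : ℝ → ℝ → ℝ} {m κ η C : ℝ}

lemma measurable_resolventStep (h : Coeffs r a β b m κ η C) (c : ℝ) {f u : ℝ → ℝ≥0∞}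
    (hf : Measurable f) (hu : Measurable u) : Measurable (resolventStep r a β b c f u) :=
  h.measurable_transportSol c (hf.add (h.measurable_gainE hu)) _

lemma lintegral_wt_eq (h : Coeffs r a β b m κ η C) {c : ℝ} (hc : C ≤ c) {u : ℝ → ℝ≥0∞}
    (hu : Measurable u) :
    ∫⁻ x in Ioi (0 : ℝ), ENNReal.ofReal ((c - C + a x) * wt κ m x) * u x =
      ENNReal.ofReal (c - C) * wInt κ m u + awInt a κ m u := by
  have hw := measurable_wt κ m
  have hm3 : Measurable fun x => ENNReal.ofReal (wt κ m x) * u x := hw.ennreal_ofReal.mul hu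
  rw [wInt, awInt, ← lintegral_const_mul _ hm3, ← lintegral_add_left (hm3.const_mul _)]
  refine setLIntegral_congr_fun measurableSet_Ioi fun x hx => ?_
  have hx0 : (0 : ℝ) < x := hx
  have hwx := h.wt_pos hx0
  have hax := h.a_nonneg x hx0
  rw [← mul_assoc, ← ENNReal.ofReal_mul (by linarith), ← add_mul, ← ENNReal.ofReal_add, add_mul]
  · exact mul_nonneg (by linarith) hwx.le
  · exact mul_nonneg hax hwx.le

/-- The basic estimate for subsolutions of the resolvent equation. -/
lemma wInt_add_awInt_le (h : Coeffs r a β b m κ η C) {c : ℝ} (hc : C ≤ c) {u v f : ℝ → ℝ≥0∞}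
    {k : ℝ≥0∞} (hf : Measurable f) (hu : Measurable u) (hv : Measurable v)
    (hle : ∀ᵐ x ∂(volume.restrict (Ioi (0 : ℝ))),
      u x ≤ transportSol r a c (fun x => f x + gainE a b v x) (birthE β v + k) x) :
    ENNReal.ofReal (c - C) * wInt κ m u + awInt a κ m u ≤
      wInt κ m f + k + ENNReal.ofReal (1 - η) * awInt a κ m v
        + 2 * (ENNReal.ofReal C * wInt κ m v) := by
  rw [← h.lintegral_wt_eq hc hu]
  calc ∫⁻ x in Ioi (0 : ℝ), ENNReal.ofReal ((c - C + a x) * wt κ m x) * u x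
      ≤ ∫⁻ x in Ioi (0 : ℝ), ENNReal.ofReal ((c - C + a x) * wt κ m x) *
        transportSol r a c (fun x => f x + gainE a b v x) (birthE β v + k) x :=
        lintegral_mono_ae (hle.mono fun x hx => mul_le_mul_right hx _)
    _ ≤ birthE β v + k + wInt κ m (fun x => f x + gainE a b v x) :=
        h.lintegral_transportSol_le hc (hf.add (h.measurable_gainE hv)) _
    _ ≤ ENNReal.ofReal C * wInt κ m v + k + (wInt κ m f +
        (ENNReal.ofReal (1 - η) * awInt a κ m v + ENNReal.ofReal C * wInt κ m v)) := by
        rw [wInt_add hf]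
        exact add_le_add (add_le_add (h.birthE_le hv) le_rfl)
          (add_le_add le_rfl (h.wInt_gainE_le hv))
    _ = _ := by ring

/-- The a priori estimate for subsolutions of the resolvent equation. -/
lemma apriori (h : Coeffs r a β b m κ η C) {c : ℝ} (hc : 3 * C ≤ c) {u f : ℝ → ℝ≥0∞}
    {k : ℝ≥0∞} (hf : Measurable f) (hu : Measurable u)
    (hle : ∀ᵐ x ∂(volume.restrict (Ioi (0 : ℝ))),
      u x ≤ transportSol r a c (fun x => f x + gainE a b u x) (birthE β u + k) x)
    (hw : wInt κ m u ≠ ⊤) (ha : awInt a κ m u ≠ ⊤) :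
    ENNReal.ofReal (c - 3 * C) * wInt κ m u + ENNReal.ofReal η * awInt a κ m u ≤
      wInt κ m f + k := by
  have hC := h.C_nonneg
  have hη := h.η_pos
  have hη' := h.η_le
  have h1 := h.wInt_add_awInt_le (by linarith) hf hu hu hle
  by_cases hF : wInt κ m f + k = ⊤
  · rw [hF]; exact le_top
  -- Finiteness allows subtraction: a share η of the loss term survives, and the two terms C from
  -- births and bounded gain lower c - C to c - 3C.
  lift wInt κ m u to ℝ≥0 using hw with X hX
  lift awInt a κ m u to ℝ≥0 using ha with Y hY
  lift wInt κ m f + k to ℝ≥0 using hF with F hF'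
  have e : ∀ t : ℝ, ENNReal.ofReal t = ((t.toNNReal : ℝ≥0) : ℝ≥0∞) := fun _ => rfl
  simp only [e] at h1 ⊢
  norm_cast at h1 ⊢
  rw [← NNReal.coe_le_coe] at h1 ⊢
  push_cast at h1 ⊢
  rw [Real.coe_toNNReal _ (by linarith), Real.coe_toNNReal _ (by linarith),
    Real.coe_toNNReal _ hC] at h1
  rw [Real.coe_toNNReal _ (by linarith), Real.coe_toNNReal _ hη.le]
  nlinarith

/-- The a priori estimate moves terms across the inequality, so each iterate must first be known to
have finite norms. -/
lemma resolventStep_finite (h : Coeffs r a β b m κ η C) {c : ℝ} (hc : C < c) {u f : ℝ → ℝ≥0∞}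
    (hf : Measurable f) (hu : Measurable u) (hfw : wInt κ m f ≠ ⊤)
    (hw : wInt κ m u ≠ ⊤) (ha : awInt a κ m u ≠ ⊤) :
    wInt κ m (resolventStep r a β b c f u) ≠ ⊤ ∧ awInt a κ m (resolventStep r a β b c f u) ≠ ⊤ := by
  have h1 := h.wInt_add_awInt_le (k := 0) hc.le hf (h.measurable_resolventStep c hf hu) hu
    (Eventually.of_forall fun x => le_of_eq (by rw [add_zero]; rfl))
  have h2 : ENNReal.ofReal (c - C) * wInt κ m (resolventStep r a β b c f u) +
      awInt a κ m (resolventStep r a β b c f u) ≠ ⊤ := by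
    refine ne_top_of_le_ne_top ?_ h1
    have := ENNReal.mul_ne_top (ENNReal.ofReal_ne_top (r := 1 - η)) ha
    have := ENNReal.mul_ne_top (ENNReal.ofReal_ne_top (r := C)) hw
    finiteness
  rw [ENNReal.add_ne_top] at h2
  refine ⟨fun htop => h2.1 ?_, h2.2⟩
  rw [htop, ENNReal.mul_top]
  simpa using hc

lemma gainE_iSup (h : Coeffs r a β b m κ η C) {v : ℕ → ℝ → ℝ≥0∞} (hv : ∀ n, Measurable (v n))
    (hmono : Monotone v) (x : ℝ) :
    gainE a b (fun y => ⨆ n, v n y) x = ⨆ n, gainE a b (v n) x := by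
  unfold gainE
  have hab : Measurable fun y => ENNReal.ofReal (a y * b x y) :=
    (h.a_meas.mul (h.b_meas.comp measurable_prodMk_left)).ennreal_ofReal
  exact lintegral_mul_iSup hab hv hmono

lemma birthE_iSup (h : Coeffs r a β b m κ η C) {v : ℕ → ℝ → ℝ≥0∞} (hv : ∀ n, Measurable (v n))
    (hmono : Monotone v) : birthE β (fun y => ⨆ n, v n y) = ⨆ n, birthE β (v n) := by
  exact lintegral_mul_iSup h.β_meas.ennreal_ofReal hv hmono

/-- Monotone convergence in every integral; this is what turns the supremum of the iterates into a
fixed point. -/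
lemma resolventStep_iSup (h : Coeffs r a β b m κ η C) (c : ℝ) {f : ℝ → ℝ≥0∞} (hf : Measurable f)
    {v : ℕ → ℝ → ℝ≥0∞} (hv : ∀ n, Measurable (v n)) (hmono : Monotone v) (x : ℝ) :
    resolventStep r a β b c f (fun y => ⨆ n, v n y) x = ⨆ n, resolventStep r a β b c f (v n) x := by
  unfold resolventStep transportSol
  have hE : Measurable fun s => ENNReal.ofReal (Real.exp (absorb r a c s)) :=
    (h.measurable_absorb c).exp.ennreal_ofReal
  rw [← ENNReal.mul_iSup, h.birthE_iSup hv hmono]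
  congr 1
  have e1 : ∫⁻ s in Ioc 0 x, ENNReal.ofReal (Real.exp (absorb r a c s)) *
      (f s + gainE a b (fun y => ⨆ n, v n y) s) = ⨆ n, ∫⁻ s in Ioc 0 x,
      ENNReal.ofReal (Real.exp (absorb r a c s)) * (f s + gainE a b (v n) s) := by
    rw [← lintegral_mul_iSup (v := fun n s => f s + gainE a b (v n) s) hE
      (fun n => hf.add (h.measurable_gainE (hv n)))
      fun i j hij y => add_le_add le_rfl (gainE_mono (hmono hij) y)]
    refine lintegral_congr fun s => ?_
    rw [h.gainE_iSup hv hmono, ENNReal.add_iSup]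
  rw [e1]
  refine ENNReal.iSup_add_iSup_of_monotone (fun i j hij => birthE_mono (hmono hij))
    fun i j hij => ?_
  exact lintegral_mono fun y => mul_le_mul_right (add_le_add le_rfl (gainE_mono (hmono hij) y)) _

/-- The resolvent equation has a minimal solution for non-negative data. -/
theorem exists_minimal_solution (h : Coeffs r a β b m κ η C) {c : ℝ} (hc : 3 * C < c)
    {f : ℝ → ℝ≥0∞} (hf : Measurable f) (hfw : wInt κ m f ≠ ⊤) :
    ∃ U : ℝ → ℝ≥0∞, Measurable U ∧ U = resolventStep r a β b c f U ∧
      wInt κ m U ≠ ⊤ ∧ awInt a κ m U ≠ ⊤ ∧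
      ∀ s : Set ℝ, (∀ u, Measurable u → (∀ x ∈ s, u x = 0) →
        ∀ x ∈ s, resolventStep r a β b c f u x = 0) → ∀ x ∈ s, U x = 0 := by
  have hC := h.C_nonneg
  set v : ℕ → ℝ → ℝ≥0∞ := fun n => (resolventStep r a β b c f)^[n] 0 with hv
  have hsucc : ∀ n, v (n + 1) = resolventStep r a β b c f (v n) := fun n =>
    Function.iterate_succ_apply' _ _ _
  have hvm : ∀ n, Measurable (v n) := by
    intro n
    induction n with
    | zero => exact measurable_zero
    | succ n ih => rw [hsucc]; exact h.measurable_resolventStep c hf ih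
  have hmono : Monotone v :=
    Monotone.monotone_iterate_of_le_map (resolventStep_mono f) (fun _ => zero_le)
  have hfin : ∀ n, wInt κ m (v n) ≠ ⊤ ∧ awInt a κ m (v n) ≠ ⊤ := by
    intro n
    induction n with
    | zero => simp [hv, wInt, awInt]
    | succ n ih =>
      rw [hsucc]
      exact h.resolventStep_finite (by linarith) hf (hvm n) hfw ih.1 ih.2
  -- Monotonicity makes each iterate a subsolution, v n ≤ v (n + 1) = step (v n), so the a priori
  -- bound is uniform in n.
  have hbound : ∀ n, ENNReal.ofReal (c - 3 * C) * wInt κ m (v n) +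
      ENNReal.ofReal η * awInt a κ m (v n) ≤ wInt κ m f := by
    intro n
    have := h.apriori (k := 0) hc.le hf (hvm n) (Eventually.of_forall fun x => ?_)
      (hfin n).1 (hfin n).2
    · simpa using this
    · refine (hmono n.le_succ x).trans ?_
      rw [Nat.succ_eq_add_one, hsucc, add_zero]
      exact le_rfl
  have hcpos : 0 < c - 3 * C := by linarith
  have hlim1 : wInt κ m (fun x => ⨆ n, v n x) ≤ wInt κ m f / ENNReal.ofReal (c - 3 * C) := by
    unfold wInt
    rw [lintegral_mul_iSup (measurable_wt κ m).ennreal_ofReal hvm hmono]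
    refine iSup_le fun n => ?_
    rw [ENNReal.le_div_iff_mul_le (Or.inl (by simpa using hcpos)) (Or.inl ENNReal.ofReal_ne_top),
      mul_comm]
    exact le_self_add.trans (hbound n)
  have hlim2 : awInt a κ m (fun x => ⨆ n, v n x) ≤ wInt κ m f / ENNReal.ofReal η := by
    unfold awInt
    have haw : Measurable fun x => ENNReal.ofReal (a x * wt κ m x) :=
      (h.a_meas.mul (measurable_wt κ m)).ennreal_ofReal
    rw [lintegral_mul_iSup haw hvm hmono]
    refine iSup_le fun n => ?_
    rw [ENNReal.le_div_iff_mul_le (Or.inl (by simpa using h.η_pos)) (Or.inl ENNReal.ofReal_ne_top),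
      mul_comm]
    exact le_add_self.trans (hbound n)
  refine ⟨fun x => ⨆ n, v n x, Measurable.iSup hvm, ?_, ?_, ?_, ?_⟩
  · funext x
    rw [h.resolventStep_iSup c hf hvm hmono]
    refine le_antisymm (iSup_le fun n => ?_) (iSup_le fun n => ?_)
    · refine (hmono n.le_succ x).trans ?_
      rw [Nat.succ_eq_add_one, hsucc]
      exact le_iSup (fun n => resolventStep r a β b c f (v n) x) n
    · rw [← hsucc]
      exact le_iSup (fun n => v n x) (n + 1)
  · exact ne_top_of_le_ne_top (ENNReal.div_ne_top hfw (by simpa using hcpos)) hlim1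
  · exact ne_top_of_le_ne_top (ENNReal.div_ne_top hfw (by simpa using h.η_pos)) hlim2
  -- The iteration starts from 0, so a zero set preserved by the step survives in the limit. This
  -- part of minimality is what later produces invariant ideals.
  · intro s hs
    have hz : ∀ n, ∀ x ∈ s, v n x = 0 := by
      intro n
      induction n with
      | zero => intro x _; rfl
      | succ n ih => rw [hsucc]; exact hs _ (hvm n) ih
    intro x hx
    simp [hz _ x hx]

end Coeffs

/-! ### Weak derivatives on the half-line -/

section WeakDeriv

lemma exists_Icc_of_tsupport_subset {φ : ℝ → ℝ} (hc : HasCompactSupport φ)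
    (hs : tsupport φ ⊆ Ioi 0) : ∃ A B : ℝ, 0 < A ∧ A ≤ B ∧ tsupport φ ⊆ Icc A B := by
  rcases (tsupport φ).eq_empty_or_nonempty with he | hne
  · exact ⟨1, 1, one_pos, le_rfl, by simp [he]⟩
  · have hK : IsCompact (tsupport φ) := hc
    obtain ⟨A, hA, hA'⟩ := hK.exists_isLeast hne
    obtain ⟨B, hB, hB'⟩ := hK.exists_isGreatest hne
    exact ⟨A, B, hs hA, hA' hB, fun x hx => ⟨hA' hx, hB' hx⟩⟩

lemma eq_zero_of_notMem_Icc {φ : ℝ → ℝ} {A B x : ℝ} (h : tsupport φ ⊆ Icc A B)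
    (hx : x ∉ Icc A B) : φ x = 0 :=
  image_eq_zero_of_notMem_tsupport fun hx' => hx (h hx')

lemma deriv_eq_zero_of_notMem_Icc {φ : ℝ → ℝ} {A B x : ℝ} (h : tsupport φ ⊆ Icc A B)
    (hx : x ∉ Icc A B) : deriv φ x = 0 :=
  image_eq_zero_of_notMem_tsupport fun hx' => hx (h (tsupport_deriv_subset hx'))

lemma setIntegral_Ioi_eq_intervalIntegral {F : ℝ → ℝ} {M : ℝ} (hM : 0 ≤ M)
    (hF : ∀ x, M < x → F x = 0) : ∫ x in Ioi (0 : ℝ), F x = ∫ x in (0 : ℝ)..M, F x := by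
  rw [intervalIntegral.integral_of_le hM]
  exact (setIntegral_eq_of_subset_of_forall_sdiff_eq_zero measurableSet_Ioi
    Ioc_subset_Ioi_self fun x hx => hF x (not_le.1 fun h => hx.2 ⟨hx.1, h⟩))

/-- An indefinite integral has the expected weak derivative. -/
lemma isWeakDeriv_primitive {w : ℝ → ℝ} (hw : ∀ M, IntegrableOn w (Ioc 0 M)) (k : ℝ) :
    IsWeakDeriv (fun x => k + ∫ s in Ioc 0 x, w s) w := by
  intro φ hφ hc hs
  obtain ⟨A, B, hA, hAB, hsub⟩ := exists_Icc_of_tsupport_subset hc hs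
  -- One unit past the support, so φ vanishes at both endpoints and the boundary terms of the
  -- integration by parts disappear.
  set M := B + 1 with hM
  have hM0 : 0 ≤ M := by linarith
  have hi : IntervalIntegrable w volume 0 M :=
    (intervalIntegrable_iff_integrableOn_Ioc_of_le hM0).2 (hw M)
  rw [setIntegral_Ioi_eq_intervalIntegral hM0 fun x hx => by
      rw [deriv_eq_zero_of_notMem_Icc hsub fun h => by linarith [h.2], mul_zero],
    setIntegral_Ioi_eq_intervalIntegral hM0 fun x hx => by
      rw [eq_zero_of_notMem_Icc hsub fun h => by linarith [h.2], mul_zero]]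
  have hconst : AbsolutelyContinuousOnInterval (fun _ : ℝ => k) 0 M :=
    (contDiff_const (n := 1)).contDiffOn.absolutelyContinuousOnInterval
  have hAC : AbsolutelyContinuousOnInterval (fun x => k + ∫ s in (0 : ℝ)..x, w s) 0 M :=
    hconst.fun_add (hi.absolutelyContinuousOnInterval_intervalIntegral left_mem_uIcc)
  have hφAC : AbsolutelyContinuousOnInterval φ 0 M :=
    (hφ.of_le (by exact_mod_cast le_top)).contDiffOn.absolutelyContinuousOnInterval
  have h1 := hAC.integral_mul_deriv_eq_deriv_mul hφAC
  have hφ0 : φ 0 = 0 := eq_zero_of_notMem_Icc hsub fun h => by linarith [h.1]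
  have hφM : φ M = 0 := eq_zero_of_notMem_Icc hsub fun h => by linarith [h.2]
  rw [hφ0, hφM, mul_zero, mul_zero, sub_zero, zero_sub] at h1
  have e1 : ∫ x in (0 : ℝ)..M, (k + ∫ s in Ioc 0 x, w s) * deriv φ x =
      ∫ x in (0 : ℝ)..M, (k + ∫ s in (0 : ℝ)..x, w s) * deriv φ x := by
    refine intervalIntegral.integral_congr fun x hx => ?_
    rw [uIcc_of_le hM0] at hx
    simp only [intervalIntegral.integral_of_le hx.1]
  rw [e1, h1]
  congr 1
  refine intervalIntegral.integral_congr_ae ?_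
  filter_upwards [hi.ae_hasDerivAt_integral] with x hx hx0
  have h2 := (hx (uIoc_subset_uIcc hx0) 0 left_mem_uIcc).const_add k
  rw [h2.deriv]

lemma integrableOn_mul_of_tsupport {g φ : ℝ → ℝ} {A B : ℝ}
    (hg : LocallyIntegrableOn g (Ioi 0)) (hφ : Continuous φ) (hA : 0 < A)
    (hsub : tsupport φ ⊆ Icc A B) : IntegrableOn (fun x => g x * φ x) (Ioi 0) := by
  have h1 : IntegrableOn g (Icc A B) :=
    hg.integrableOn_compact_subset (fun x hx => hA.trans_le hx.1) isCompact_Icc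
  have h2 : IntegrableOn (fun x => g x * φ x) (Icc A B) :=
    h1.mul_continuousOn hφ.continuousOn isCompact_Icc
  refine h2.of_forall_sdiff_eq_zero measurableSet_Ioi fun x hx => ?_
  rw [eq_zero_of_notMem_Icc hsub hx.2, mul_zero]

/-- The lemma of du Bois-Reymond. -/
lemma ae_eq_const_of_isWeakDeriv_zero {g : ℝ → ℝ} (hg : LocallyIntegrableOn g (Ioi 0))
    (hw : IsWeakDeriv g 0) : ∃ k, ∀ᵐ x ∂(volume.restrict (Ioi (0 : ℝ))), g x = k := by
  let ρ₀ : ContDiffBump (2 : ℝ) := ⟨1 / 2, 1, by norm_num, by norm_num⟩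
  set ρ : ℝ → ℝ := ρ₀.normed volume with hρ
  have hρs : tsupport ρ ⊆ Icc 1 3 := by
    rw [hρ, ρ₀.tsupport_normed_eq, Real.closedBall_eq_Icc]
    norm_num [ρ₀]
  have hρc : ContDiff ℝ ∞ ρ := ρ₀.contDiff_normed
  have hρ1 : ∫ x, ρ x = 1 := ρ₀.integral_normed
  set k := ∫ x in Ioi (0 : ℝ), g x * ρ x with hk
  refine ⟨k, ?_⟩
  have hmain : ∀ᵐ x, x ∈ Ioi (0 : ℝ) → g x - k = 0 := by
    refine isOpen_Ioi.ae_eq_zero_of_integral_contDiff_smul_eq_zero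
      (hg.sub ((locallyIntegrable_const k).locallyIntegrableOn _)) fun φ hφ hc hs => ?_
    obtain ⟨A', B', hA', hAB', hsub'⟩ := exists_Icc_of_tsupport_subset hc hs
    set A := min A' 1 with hA
    set B := max B' 3 with hB
    have hA0 : 0 < A := lt_min hA' one_pos
    have hAB : A ≤ B := (min_le_left _ _).trans (hAB'.trans (le_max_left _ _))
    have hsubφ : tsupport φ ⊆ Icc A B :=
      hsub'.trans (Icc_subset_Icc (min_le_left _ _) (le_max_left _ _))
    have hsubρ : tsupport ρ ⊆ Icc A B :=
      hρs.trans (Icc_subset_Icc (min_le_right _ _) (le_max_right _ _))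
    set I := ∫ x, φ x with hI
    -- Removing I times the unit bump ρ, which is supported in [1, 3] away from 0, gives a function
    -- of integral zero. Its primitive Ψ is then a test function on (0, ∞), and testing with Ψ gives
    -- ∫ g φ = k ∫ φ.
    set ψ : ℝ → ℝ := fun x => φ x - I * ρ x with hψ
    have hψc : ContDiff ℝ ∞ ψ := hφ.sub (contDiff_const.mul hρc)
    have hψ0 : ∀ x, x ∉ Icc A B → ψ x = 0 := fun x hx => by
      simp [hψ, eq_zero_of_notMem_Icc hsubφ hx, eq_zero_of_notMem_Icc hsubρ hx]
    set Ψ : ℝ → ℝ := fun x => ∫ s in A..x, ψ s with hΨ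
    have hΨd : ∀ x, HasDerivAt Ψ (ψ x) x := fun x =>
      intervalIntegral.integral_hasDerivAt_right (hψc.continuous.intervalIntegrable _ _)
        (hψc.continuous.stronglyMeasurableAtFilter _ _) hψc.continuous.continuousAt
    have hderiv : deriv Ψ = ψ := funext fun x => (hΨd x).deriv
    have hΨc : ContDiff ℝ ∞ Ψ :=
      contDiff_infty_iff_deriv.2 ⟨fun x => (hΨd x).differentiableAt, by rw [hderiv]; exact hψc⟩
    have hφi : Integrable φ := hφ.continuous.integrable_of_hasCompactSupport hc
    have hρi : Integrable ρ := hρc.continuous.integrable_of_hasCompactSupport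
      ρ₀.hasCompactSupport_normed
    have hψi : ∫ x, ψ x = 0 := by
      rw [hψ, integral_sub hφi (hρi.const_mul I), integral_const_mul, hρ1, mul_one, sub_self]
    have hΨ0 : ∀ x, x ∉ Icc A B → Ψ x = 0 := by
      intro x hx
      rcases lt_or_ge x A with h | h
      · simp only [hΨ]
        rw [intervalIntegral.integral_symm, intervalIntegral.integral_of_le h.le,
          setIntegral_congr_ae (g := fun _ => 0) measurableSet_Ioc, integral_zero, neg_zero]
        have : ∀ᵐ y : ℝ, y ≠ A := by simp [ae_iff]
        filter_upwards [this] with y hyA hy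
        exact hψ0 y fun h' => hyA (le_antisymm hy.2 h'.1)
      · have hxB : B < x := not_le.1 fun h' => hx ⟨h, h'⟩
        simp only [hΨ]
        rw [intervalIntegral.integral_of_le h, ← hψi]
        have e : ∫ s in Ioc A x, ψ s = ∫ s in Icc A x, ψ s := integral_Icc_eq_integral_Ioc.symm
        rw [e]
        refine setIntegral_eq_integral_of_forall_compl_eq_zero fun y hy => hψ0 y fun h' => hy ?_
        exact ⟨h'.1, h'.2.trans hxB.le⟩
    have hΨs : tsupport Ψ ⊆ Icc A B :=
      closure_minimal (fun x hx => by_contra fun h' => hx (hΨ0 x h')) isClosed_Icc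
    have hΨcs : HasCompactSupport Ψ := isCompact_Icc.of_isClosed_subset (isClosed_tsupport _) hΨs
    have h1 := hw Ψ hΨc hΨcs (hΨs.trans fun x hx => hA0.trans_le hx.1)
    rw [hderiv] at h1
    simp only [Pi.zero_apply, zero_mul, integral_zero, neg_zero] at h1
    have hgφ := integrableOn_mul_of_tsupport hg hφ.continuous hA0 hsubφ
    have hgρ := integrableOn_mul_of_tsupport hg hρc.continuous hA0 hsubρ
    have e1 : ∫ x in Ioi (0 : ℝ), g x * ψ x = (∫ x in Ioi (0 : ℝ), g x * φ x) - I * k := by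
      rw [hk, ← integral_const_mul, ← integral_sub hgφ (hgρ.const_mul I)]
      refine integral_congr_ae (Eventually.of_forall fun x => ?_)
      simp only [hψ]; ring
    rw [e1] at h1
    have e2 : ∫ x, φ x • (g x - k) = ∫ x in Ioi (0 : ℝ), φ x • (g x - k) := by
      refine (setIntegral_eq_integral_of_forall_compl_eq_zero fun x hx => ?_).symm
      have hx' : x ≤ 0 := not_lt.1 hx
      rw [eq_zero_of_notMem_Icc hsubφ fun h' => by linarith [h'.1], zero_smul]
    have e3 : I = ∫ x in Ioi (0 : ℝ), φ x := by
      refine (setIntegral_eq_integral_of_forall_compl_eq_zero fun x hx => ?_).symm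
      have hx' : x ≤ 0 := not_lt.1 hx
      exact eq_zero_of_notMem_Icc hsubφ fun h' => by linarith [h'.1]
    rw [e3, ← integral_mul_const, ← integral_sub hgφ (hφi.integrableOn.mul_const k)] at h1
    refine e2.trans (Eq.trans ?_ h1)
    refine integral_congr_ae (Eventually.of_forall fun x => ?_)
    simp only [smul_eq_mul]; ring
  rw [ae_restrict_iff' measurableSet_Ioi]
  filter_upwards [hmain] with x hx hx0
  exact sub_eq_zero.1 (hx hx0)

lemma continuousOn_primitive_Ioc {w : ℝ → ℝ} (hw : ∀ M, IntegrableOn w (Ioc 0 M)) :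
    ContinuousOn (fun x => ∫ s in Ioc 0 x, w s) (Ici 0) := by
  intro x hx
  have hx0 : (0 : ℝ) ≤ x := hx
  have h1 := intervalIntegral.continuousOn_primitive (f := w) (a := 0) (b := x + 1) (μ := volume)
    ((integrableOn_Icc_iff_integrableOn_Ioc).2 (hw _))
  have h2 := h1 x ⟨hx0, by linarith⟩
  refine h2.mono_of_mem_nhdsWithin ?_
  refine mem_nhdsWithin.2 ⟨Iio (x + 1), isOpen_Iio, by simp, ?_⟩
  rintro y ⟨hy1, hy2⟩
  exact ⟨hy2, hy1.le⟩

/-- A function with a weak derivative and a trace at `0` is the integral of its derivative. -/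
lemma IsWeakDeriv.ae_eq_primitive {g w : ℝ → ℝ} {k : ℝ} (h : IsWeakDeriv g w)
    (hg : LocallyIntegrableOn g (Ioi 0)) (hw : ∀ M, IntegrableOn w (Ioc 0 M))
    (hk : HasTraceAtZero g k) :
    ∀ᵐ x ∂(volume.restrict (Ioi (0 : ℝ))), g x = k + ∫ s in Ioc 0 x, w s := by
  have hWc := continuousOn_primitive_Ioc hw
  set W : ℝ → ℝ := fun x => ∫ s in Ioc 0 x, w s with hW
  have hWc' : ContinuousOn W (Ioi 0) := hWc.mono Ioi_subset_Ici_self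
  have hWl : LocallyIntegrableOn W (Ioi 0) := hWc'.locallyIntegrableOn measurableSet_Ioi
  have h0 : IsWeakDeriv (fun x => g x - W x) 0 := by
    intro φ hφ hc hs
    obtain ⟨A, B, hA, hAB, hsub⟩ := exists_Icc_of_tsupport_subset hc hs
    have h1 := h φ hφ hc hs
    have h2 := isWeakDeriv_primitive hw 0 φ hφ hc hs
    simp only [zero_add] at h2
    have hsub' : tsupport (deriv φ) ⊆ Icc A B := tsupport_deriv_subset.trans hsub
    have hdc : Continuous (deriv φ) := hφ.continuous_deriv (by exact_mod_cast le_top)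
    simp only [sub_mul, Pi.zero_apply, zero_mul, integral_zero, neg_zero]
    rw [integral_sub (integrableOn_mul_of_tsupport hg hdc hA hsub')
      (integrableOn_mul_of_tsupport hWl hdc hA hsub'), h1, h2, sub_self]
  obtain ⟨D, hD⟩ := ae_eq_const_of_isWeakDeriv_zero (hg.sub hWl) h0
  simp only [Pi.sub_apply] at hD
  obtain ⟨G, hGc, hGe, hGt⟩ := hk
  have hGW : EqOn G (fun x => D + W x) (Ioi 0) := by
    refine Measure.eqOn_open_of_ae_eq (μ := volume) ?_ isOpen_Ioi hGc (continuousOn_const.add hWc')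
    filter_upwards [hD, hGe] with x hx1 hx2
    rw [hx2]; linarith
  have hWt : Tendsto (fun x => D + W x) (𝓝[>] 0) (𝓝 (D + 0)) := by
    have h1 := (hWc 0 (mem_Ici.2 le_rfl)).mono Ioi_subset_Ici_self
    have h2 : W 0 = 0 := by simp [hW]
    have h3 : Tendsto W (𝓝[>] 0) (𝓝 (W 0)) := h1
    rw [h2] at h3
    exact h3.const_add D
  -- W vanishes at 0, so the trace identifies the du Bois-Reymond constant.
  have hkD : k = D + 0 := by
    refine tendsto_nhds_unique hGt (hWt.congr' ?_)
    filter_upwards [self_mem_nhdsWithin] with x hx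
    exact (hGW hx).symm
  filter_upwards [hD] with x hx
  rw [hkD]
  simp only [hW] at hx
  linarith

lemma hasTraceAtZero_of_ae_eq {g w : ℝ → ℝ} {k : ℝ} (hw : ∀ M, IntegrableOn w (Ioc 0 M))
    (h : ∀ᵐ x ∂(volume.restrict (Ioi (0 : ℝ))), g x = k + ∫ s in Ioc 0 x, w s) :
    HasTraceAtZero g k := by
  have hWc := continuousOn_primitive_Ioc hw
  refine ⟨fun x => k + ∫ s in Ioc 0 x, w s,
    continuousOn_const.add (hWc.mono Ioi_subset_Ici_self), h.mono fun x hx => hx.symm, ?_⟩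
  have h1 : Tendsto (fun x => ∫ s in Ioc 0 x, w s) (𝓝[>] 0) (𝓝 (∫ s in Ioc 0 (0 : ℝ), w s)) :=
    (hWc 0 (mem_Ici.2 le_rfl)).mono Ioi_subset_Ici_self
  simp only [Ioc_self, setIntegral_empty] at h1
  simpa using h1.const_add k

lemma IsWeakDeriv.congr_ae {g g' w : ℝ → ℝ} (h : IsWeakDeriv g w)
    (hg : ∀ᵐ x ∂(volume.restrict (Ioi (0 : ℝ))), g' x = g x) : IsWeakDeriv g' w := by
  intro φ hφ hc hs
  rw [← h φ hφ hc hs]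
  refine integral_congr_ae ?_
  filter_upwards [hg] with x hx
  rw [hx]

end WeakDeriv

/-! ### The weighted measure -/

section Weight

variable {κ m : ℝ}

lemma weightMeasure_eq (m : ℝ) : weightMeasure m =
    (volume.restrict (Ioi (0 : ℝ))).withDensity (fun x => ENNReal.ofReal (wt 1 m x)) := by
  simp [weightMeasure, wt]

lemma weightMeasure_ac (m : ℝ) : weightMeasure m ≪ volume.restrict (Ioi (0 : ℝ)) :=
  withDensity_absolutelyContinuous _ _

lemma ac_weightMeasure (m : ℝ) : volume.restrict (Ioi (0 : ℝ)) ≪ weightMeasure m := by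
  rw [weightMeasure_eq]
  refine withDensity_absolutelyContinuous' (measurable_wt 1 m).ennreal_ofReal.aemeasurable ?_
  filter_upwards [ae_restrict_mem measurableSet_Ioi] with x hx
  have := one_le_wt (m := m) le_rfl (mem_Ioi.1 hx)
  simpa using by linarith

lemma ae_weightMeasure (m : ℝ) : ae (weightMeasure m) = ae (volume.restrict (Ioi (0 : ℝ))) :=
  le_antisymm (weightMeasure_ac m).ae_le (ac_weightMeasure m).ae_le

lemma aestronglyMeasurable_weight_iff {f : ℝ → ℝ} : AEStronglyMeasurable f (weightMeasure m) ↔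
    AEStronglyMeasurable f (volume.restrict (Ioi (0 : ℝ))) :=
  ⟨fun h => h.mono_ac (ac_weightMeasure m), fun h => h.mono_ac (weightMeasure_ac m)⟩

lemma lintegral_weightMeasure {f : ℝ → ℝ≥0∞} (hf : AEMeasurable f (volume.restrict (Ioi (0 : ℝ)))) :
    ∫⁻ x, f x ∂(weightMeasure m) = wInt 1 m f := by
  rw [weightMeasure_eq, lintegral_withDensity_eq_lintegral_mul₀
    (measurable_wt 1 m).ennreal_ofReal.aemeasurable hf]
  rfl

lemma wInt_one_le (hκ : 1 ≤ κ) (f : ℝ → ℝ≥0∞) : wInt 1 m f ≤ wInt κ m f := by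
  refine setLIntegral_mono' measurableSet_Ioi fun x hx => ?_
  have := Real.rpow_nonneg (mem_Ioi.1 hx).le m
  gcongr
  unfold wt
  nlinarith

lemma wInt_le_mul (hκ : 1 ≤ κ) {f : ℝ → ℝ≥0∞} :
    wInt κ m f ≤ ENNReal.ofReal κ * wInt 1 m f := by
  rw [wInt, wInt, ← lintegral_const_mul' _ _ ENNReal.ofReal_ne_top]
  refine setLIntegral_mono' measurableSet_Ioi fun x hx => ?_
  have := Real.rpow_nonneg (mem_Ioi.1 hx).le m
  rw [← mul_assoc, ← ENNReal.ofReal_mul (by linarith)]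
  gcongr
  unfold wt
  nlinarith

lemma wInt_ne_top_iff (hκ : 1 ≤ κ) {f : ℝ → ℝ≥0∞} : wInt κ m f ≠ ⊤ ↔ wInt 1 m f ≠ ⊤ :=
  ⟨fun h => ne_top_of_le_ne_top h (wInt_one_le hκ f),
    fun h => ne_top_of_le_ne_top (ENNReal.mul_ne_top ENNReal.ofReal_ne_top h) (wInt_le_mul hκ)⟩

lemma eLpNorm_weightMeasure {f : ℝ → ℝ}
    (hf : AEStronglyMeasurable f (volume.restrict (Ioi (0 : ℝ)))) :
    eLpNorm f 1 (weightMeasure m) = wInt 1 m fun x => ‖f x‖ₑ := by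
  rw [eLpNorm_one_eq_lintegral_enorm, lintegral_weightMeasure hf.enorm]

lemma memLp_weight_iff (hκ : 1 ≤ κ) {f : ℝ → ℝ}
    (hf : AEStronglyMeasurable f (volume.restrict (Ioi (0 : ℝ)))) :
    MemLp f 1 (weightMeasure m) ↔ wInt κ m (fun x => ‖f x‖ₑ) ≠ ⊤ := by
  rw [wInt_ne_top_iff hκ, ← eLpNorm_weightMeasure hf, ← lt_top_iff_ne_top]
  exact ⟨fun h => h.2, fun h => ⟨aestronglyMeasurable_weight_iff.2 hf, h⟩⟩

lemma lintegral_le_wInt (hκ : 1 ≤ κ) (f : ℝ → ℝ≥0∞) :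
    ∫⁻ x in Ioi (0 : ℝ), f x ≤ wInt κ m f := by
  refine setLIntegral_mono' measurableSet_Ioi fun x hx => ?_
  calc f x = 1 * f x := (one_mul _).symm
    _ ≤ _ := by
      gcongr
      rw [← ENNReal.ofReal_one]
      exact ENNReal.ofReal_le_ofReal (one_le_wt hκ hx)

lemma integrableOn_of_memLp {f : ℝ → ℝ} (hf : MemLp f 1 (weightMeasure m)) :
    IntegrableOn f (Ioi 0) := by
  have h1 := aestronglyMeasurable_weight_iff.1 hf.1
  refine ⟨h1, ?_⟩
  refine (lintegral_le_wInt (m := m) le_rfl _).trans_lt ?_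
  rw [lt_top_iff_ne_top]
  exact (memLp_weight_iff le_rfl h1).1 hf

lemma wInt_congr_ae {f g : ℝ → ℝ≥0∞} (h : ∀ᵐ x ∂(volume.restrict (Ioi (0 : ℝ))), f x = g x) :
    wInt κ m f = wInt κ m g :=
  lintegral_congr_ae (h.mono fun x hx => by simp only [hx])

lemma wInt_mono_ae {f g : ℝ → ℝ≥0∞} (h : ∀ᵐ x ∂(volume.restrict (Ioi (0 : ℝ))), f x ≤ g x) :
    wInt κ m f ≤ wInt κ m g :=
  lintegral_mono_ae (h.mono fun _ hx => mul_le_mul_right hx _)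

lemma XSpace.measurable (u : XSpace m) : Measurable (u : ℝ → ℝ) := (Lp.stronglyMeasurable u).measurable

lemma XSpace.wInt_ne_top (u : XSpace m) (hκ : 1 ≤ κ) : wInt κ m (fun x => ‖u x‖ₑ) ≠ ⊤ :=
  (memLp_weight_iff hκ (XSpace.measurable u).aestronglyMeasurable).1 (Lp.memLp u)

lemma XSpace.norm_eq (u : XSpace m) : ‖u‖ = (wInt 1 m fun x => ‖u x‖ₑ).toReal := by
  rw [Lp.norm_def, eLpNorm_weightMeasure (XSpace.measurable u).aestronglyMeasurable]

lemma XSpace.ae_add (u v : XSpace m) :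
    ∀ᵐ x ∂(volume.restrict (Ioi (0 : ℝ))), (u + v) x = u x + v x := by
  have := Lp.coeFn_add u v
  rw [EventuallyEq, ae_weightMeasure] at this
  exact this

lemma XSpace.ae_smul (c : ℝ) (u : XSpace m) :
    ∀ᵐ x ∂(volume.restrict (Ioi (0 : ℝ))), (c • u) x = c * u x := by
  have := Lp.coeFn_smul c u
  rw [EventuallyEq, ae_weightMeasure] at this
  exact this

lemma XSpace.ae_sub (u v : XSpace m) :
    ∀ᵐ x ∂(volume.restrict (Ioi (0 : ℝ))), (u - v) x = u x - v x := by
  have := Lp.coeFn_sub u v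
  rw [EventuallyEq, ae_weightMeasure] at this
  exact this

lemma XSpace.ae_zero : ∀ᵐ x ∂(volume.restrict (Ioi (0 : ℝ))), (0 : XSpace m) x = 0 := by
  have := Lp.coeFn_zero ℝ 1 (weightMeasure m)
  rw [EventuallyEq, ae_weightMeasure] at this
  exact this

lemma XSpace.ae_toLp {f : ℝ → ℝ} (hf : MemLp f 1 (weightMeasure m)) :
    ∀ᵐ x ∂(volume.restrict (Ioi (0 : ℝ))), hf.toLp f x = f x := by
  have := hf.coeFn_toLp
  rw [EventuallyEq, ae_weightMeasure] at this
  exact this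

lemma XSpace.le_iff {u v : XSpace m} :
    u ≤ v ↔ ∀ᵐ x ∂(volume.restrict (Ioi (0 : ℝ))), u x ≤ v x := by
  rw [← Lp.coeFn_le, EventuallyLE, ae_weightMeasure]

lemma XSpace.ae_abs (u : XSpace m) :
    ∀ᵐ x ∂(volume.restrict (Ioi (0 : ℝ))), (|u| : XSpace m) x = |u x| := by
  have := Lp.coeFn_abs u
  rw [EventuallyEq, ae_weightMeasure] at this
  exact this

lemma XSpace.ext_ae {u v : XSpace m} (h : ∀ᵐ x ∂(volume.restrict (Ioi (0 : ℝ))), u x = v x) :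
    u = v := by
  refine Lp.ext ?_
  rw [EventuallyEq, ae_weightMeasure]
  exact h

/-- The equivalent norm with weight `1 + κ x ^ m`. -/
def wNorm (κ m : ℝ) (hκ : 1 ≤ κ) : Seminorm ℝ (XSpace m) :=
  Seminorm.of (fun u => (wInt κ m fun x => ‖u x‖ₑ).toReal)
    (fun u v => by
      rw [← ENNReal.toReal_add (XSpace.wInt_ne_top u hκ) (XSpace.wInt_ne_top v hκ),
        ← wInt_add (XSpace.measurable u).enorm]
      refine ENNReal.toReal_mono ?_ (wInt_mono_ae ?_)
      · rw [wInt_add (XSpace.measurable u).enorm]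
        exact ENNReal.add_ne_top.2 ⟨XSpace.wInt_ne_top u hκ, XSpace.wInt_ne_top v hκ⟩
      · filter_upwards [XSpace.ae_add u v] with x hx
        rw [hx]
        exact enorm_add_le _ _)
    (fun c u => by
      have e : wInt κ m (fun x => ‖(c • u) x‖ₑ) = ‖c‖ₑ * wInt κ m fun x => ‖u x‖ₑ := by
        rw [wInt, wInt, ← lintegral_const_mul' _ _ enorm_ne_top]
        refine lintegral_congr_ae ?_
        filter_upwards [XSpace.ae_smul c u] with x hx
        simp only [hx, enorm_mul]
        ring
      rw [e, ENNReal.toReal_mul, toReal_enorm])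

lemma wNorm_apply (hκ : 1 ≤ κ) (u : XSpace m) :
    wNorm κ m hκ u = (wInt κ m fun x => ‖u x‖ₑ).toReal := rfl

lemma ofReal_wNorm (hκ : 1 ≤ κ) (u : XSpace m) :
    ENNReal.ofReal (wNorm κ m hκ u) = wInt κ m fun x => ‖u x‖ₑ :=
  ENNReal.ofReal_toReal (XSpace.wInt_ne_top u hκ)

lemma norm_le_wNorm (hκ : 1 ≤ κ) (u : XSpace m) : ‖u‖ ≤ wNorm κ m hκ u := by
  rw [XSpace.norm_eq]
  exact ENNReal.toReal_mono (XSpace.wInt_ne_top u hκ) (wInt_one_le hκ _)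

lemma wNorm_le_norm (hκ : 1 ≤ κ) (u : XSpace m) : wNorm κ m hκ u ≤ κ * ‖u‖ := by
  rw [XSpace.norm_eq, wNorm_apply]
  have h := wInt_le_mul (m := m) hκ (f := fun x => ‖u x‖ₑ)
  have h2 := ENNReal.toReal_mono
    (ENNReal.mul_ne_top ENNReal.ofReal_ne_top (XSpace.wInt_ne_top u le_rfl)) h
  rwa [ENNReal.toReal_mul, ENNReal.toReal_ofReal (by linarith)] at h2

end Weight

/-! ### The graph of the operator in integrated form -/

/-- `f = -∂ₓ(r u) - a u + ℬ u` with `lim_{x → 0+} r(x) u(x) = ∫ β u + k`, in integrated form. -/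
def HasFlux (r a β : ℝ → ℝ) (b : ℝ → ℝ → ℝ) {m : ℝ} (k : ℝ) (u f : XSpace m) : Prop :=
  MemLp (fun x => a x * u x) 1 (weightMeasure m) ∧
    ∀ᵐ x ∂(volume.restrict (Ioi (0 : ℝ))), r x * u x = ((∫ y in Ioi (0 : ℝ), β y * u y) + k) +
      ∫ s in Ioc 0 x, (gain a b u s - a s * u s - f s)

namespace Coeffs

variable {r a β : ℝ → ℝ} {b : ℝ → ℝ → ℝ} {m κ η C : ℝ}

lemma measurable_gain (h : Coeffs r a β b m κ η C) {u : ℝ → ℝ} (hu : Measurable u) :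
    Measurable (gain a b u) := by
  have hS : MeasurableSet {p : ℝ × ℝ | p.1 < p.2} := measurableSet_lt measurable_fst measurable_snd
  have hF : Measurable fun p : ℝ × ℝ => a p.2 * b p.1 p.2 * u p.2 :=
    ((h.a_meas.comp measurable_snd).mul h.b_meas).mul (hu.comp measurable_snd)
  have h1 := (hF.indicator hS).stronglyMeasurable.integral_prod_right' (ν := volume)
  convert h1.measurable using 1
  funext x
  rw [gain, ← integral_indicator measurableSet_Ioi]
  rfl

lemma awInt_eq_wInt (h : Coeffs r a β b m κ η C) (u : ℝ → ℝ) :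
    awInt a κ m (fun x => ‖u x‖ₑ) = wInt κ m (fun x => ‖a x * u x‖ₑ) := by
  refine setLIntegral_congr_fun measurableSet_Ioi fun x hx => ?_
  have hx0 : (0 : ℝ) < x := hx
  have ha := h.a_nonneg x hx0
  simp only
  rw [enorm_mul, Real.enorm_of_nonneg ha, mul_comm (a x), ENNReal.ofReal_mul (h.wt_pos hx0).le,
    mul_assoc]

lemma awInt_ne_top (h : Coeffs r a β b m κ η C) {u : ℝ → ℝ}
    (hau : MemLp (fun x => a x * u x) 1 (weightMeasure m)) :
    awInt a κ m (fun x => ‖u x‖ₑ) ≠ ⊤ := by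
  rw [h.awInt_eq_wInt]
  exact (memLp_weight_iff h.one_le (aestronglyMeasurable_weight_iff.1 hau.1)).1 hau

lemma wInt_gainE_ne_top (h : Coeffs r a β b m κ η C) {u : ℝ → ℝ} (hu : Measurable u)
    (hw : MemLp u 1 (weightMeasure m)) (hau : MemLp (fun x => a x * u x) 1 (weightMeasure m)) :
    wInt κ m (gainE a b fun x => ‖u x‖ₑ) ≠ ⊤ := by
  refine ne_top_of_le_ne_top ?_ (h.wInt_gainE_le hu.enorm)
  exact ENNReal.add_ne_top.2 ⟨ENNReal.mul_ne_top ENNReal.ofReal_ne_top (h.awInt_ne_top hau),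
    ENNReal.mul_ne_top ENNReal.ofReal_ne_top
      ((memLp_weight_iff h.one_le hu.aestronglyMeasurable).1 hw)⟩

lemma enorm_gain_integrand (h : Coeffs r a β b m κ η C) (u : ℝ → ℝ) {x y : ℝ} (hx : 0 < x)
    (hy : 0 < y) : ‖a y * b x y * u y‖ₑ = ENNReal.ofReal (a y * b x y) * ‖u y‖ₑ := by
  rw [enorm_mul, Real.enorm_of_nonneg (mul_nonneg (h.a_nonneg y hy) (h.b_nonneg x y hx hy))]

lemma lintegral_enorm_gain (h : Coeffs r a β b m κ η C) (u : ℝ → ℝ) {x : ℝ} (hx : 0 < x) :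
    ∫⁻ y in Ioi x, ‖a y * b x y * u y‖ₑ = gainE a b (fun x => ‖u x‖ₑ) x :=
  setLIntegral_congr_fun measurableSet_Ioi fun _ hy => h.enorm_gain_integrand u hx (hx.trans hy)

lemma enorm_gain_le (h : Coeffs r a β b m κ η C) (u : ℝ → ℝ) {x : ℝ} (hx : 0 < x) :
    ‖gain a b u x‖ₑ ≤ gainE a b (fun x => ‖u x‖ₑ) x := by
  rw [← h.lintegral_enorm_gain u hx]
  exact enorm_integral_le_lintegral_enorm _

lemma memLp_gain (h : Coeffs r a β b m κ η C) {u : ℝ → ℝ} (hu : Measurable u)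
    (hw : MemLp u 1 (weightMeasure m)) (hau : MemLp (fun x => a x * u x) 1 (weightMeasure m)) :
    MemLp (gain a b u) 1 (weightMeasure m) := by
  rw [memLp_weight_iff h.one_le (h.measurable_gain hu).aestronglyMeasurable]
  refine ne_top_of_le_ne_top (h.wInt_gainE_ne_top hu hw hau) (wInt_mono_ae ?_)
  filter_upwards [ae_restrict_mem measurableSet_Ioi] with x hx
  exact h.enorm_gain_le u hx

lemma ae_integrableOn_gain (h : Coeffs r a β b m κ η C) {u : ℝ → ℝ} (hu : Measurable u)
    (hw : MemLp u 1 (weightMeasure m)) (hau : MemLp (fun x => a x * u x) 1 (weightMeasure m)) :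
    ∀ᵐ x ∂(volume.restrict (Ioi (0 : ℝ))), IntegrableOn (fun y => a y * b x y * u y) (Ioi x) := by
  have h1 : ∫⁻ x in Ioi (0 : ℝ), gainE a b (fun x => ‖u x‖ₑ) x ≠ ⊤ :=
    ne_top_of_le_ne_top (h.wInt_gainE_ne_top hu hw hau) (lintegral_le_wInt h.one_le _)
  filter_upwards [ae_lt_top (h.measurable_gainE hu.enorm) h1, ae_restrict_mem measurableSet_Ioi]
    with x hx hx0
  refine ⟨(((h.a_meas.mul (h.b_meas.comp measurable_prodMk_left)).mul hu).aestronglyMeasurable), ?_⟩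
  rw [← h.lintegral_enorm_gain u hx0] at hx
  exact hx

lemma gain_congr_ae {u v : ℝ → ℝ} (huv : ∀ᵐ x ∂(volume.restrict (Ioi (0 : ℝ))), u x = v x)
    {x : ℝ} (hx : 0 < x) : gain a b u x = gain a b v x := by
  refine integral_congr_ae ?_
  filter_upwards [ae_restrict_of_ae_restrict_of_subset (Ioi_subset_Ioi hx.le) huv] with y hy
  rw [hy]

lemma integrableOn_birth (h : Coeffs r a β b m κ η C) {u : ℝ → ℝ}
    (hu : Measurable u) (hw : MemLp u 1 (weightMeasure m)) :
    IntegrableOn (fun y => β y * u y) (Ioi 0) := by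
  refine ⟨(h.β_meas.mul hu).aestronglyMeasurable, ?_⟩
  have e : ∫⁻ y in Ioi (0 : ℝ), ‖β y * u y‖ₑ = birthE β fun x => ‖u x‖ₑ := by
    refine setLIntegral_congr_fun measurableSet_Ioi fun y hy => ?_
    rw [enorm_mul, Real.enorm_of_nonneg (h.β_nonneg y hy)]
  rw [HasFiniteIntegral, e]
  refine (h.birthE_le hu.enorm).trans_lt (lt_top_iff_ne_top.2 ?_)
  exact ENNReal.mul_ne_top ENNReal.ofReal_ne_top
      ((memLp_weight_iff h.one_le hu.aestronglyMeasurable).1 hw)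

lemma locallyIntegrableOn_flux (h : Coeffs r a β b m κ η C) {u : ℝ → ℝ}
    (hw : MemLp u 1 (weightMeasure m)) : LocallyIntegrableOn (fun x => r x * u x) (Ioi 0) := by
  have h1 : LocallyIntegrableOn u (Ioi 0) := (integrableOn_of_memLp hw).locallyIntegrableOn
  exact h1.continuousOn_mul h.r_cont isOpen_Ioi.isLocallyClosed

/-- Membership in the graph of the operator, in integrated form. -/
theorem mem_operatorGraph_iff (h : Coeffs r a β b m κ η C) (p : XSpace m × XSpace m) :
    p ∈ operatorGraph r a β b m ↔ HasFlux r a β b 0 p.1 p.2 := by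
  unfold HasFlux
  rw [add_zero]
  have hum := XSpace.measurable p.1
  have huw := Lp.memLp p.1
  constructor
  · rintro ⟨w, hw, hwm, hau, htr, heq⟩
    refine ⟨hau, ?_⟩
    have hwi : ∀ M, IntegrableOn w (Ioc 0 M) := fun M =>
      (integrableOn_of_memLp hwm).mono_set Ioc_subset_Ioi_self
    filter_upwards [hw.ae_eq_primitive (h.locallyIntegrableOn_flux huw) hwi htr] with x hx
    rw [hx]
    congr 1
    refine integral_congr_ae ?_
    rw [ae_weightMeasure] at heq
    filter_upwards [ae_restrict_of_ae_restrict_of_subset Ioc_subset_Ioi_self heq] with s hs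
    rw [hs]; ring
  · rintro ⟨hau, heq⟩
    have hgm := h.memLp_gain hum huw hau
    have hwm : MemLp (fun s => gain a b p.1 s - a s * p.1 s - p.2 s) 1 (weightMeasure m) :=
      (hgm.sub hau).sub (Lp.memLp p.2)
    have hwi : ∀ M, IntegrableOn (fun s => gain a b p.1 s - a s * p.1 s - p.2 s) (Ioc 0 M) :=
      fun M => (integrableOn_of_memLp hwm).mono_set Ioc_subset_Ioi_self
    refine ⟨fun s => gain a b p.1 s - a s * p.1 s - p.2 s, ?_, hwm, hau, ?_, ?_⟩
    · exact (isWeakDeriv_primitive hwi _).congr_ae heq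
    · exact hasTraceAtZero_of_ae_eq hwi heq
    · refine Eventually.of_forall fun x => ?_
      have : (fun y => p.1 y) = (p.1 : ℝ → ℝ) := rfl
      rw [this]; ring

/-- The flux relation is additive. -/
lemma hasFlux_add (h : Coeffs r a β b m κ η C) {k k' : ℝ} {u f v g : XSpace m}
    (hu : HasFlux r a β b k u f) (hv : HasFlux r a β b k' v g) :
    HasFlux r a β b (k + k') (u + v) (f + g) := by
  obtain ⟨hau, hu⟩ := hu
  obtain ⟨hav, hv⟩ := hv
  have h0 := XSpace.ae_add u v
  have h0f := XSpace.ae_add f g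
  have hum := XSpace.measurable u
  have hvm := XSpace.measurable v
  have huw := Lp.memLp u
  have hvw := Lp.memLp v
  refine ⟨?_, ?_⟩
  · refine MemLp.ae_eq ?_ (hau.add hav)
    rw [EventuallyEq, ae_weightMeasure]
    filter_upwards [h0] with x hx
    change a x * u x + a x * v x = a x * (u + v : XSpace m) x
    rw [hx, mul_add]
  · have hb : ∫ y in Ioi (0 : ℝ), β y * (u + v : XSpace m) y =
        (∫ y in Ioi (0 : ℝ), β y * u y) + ∫ y in Ioi (0 : ℝ), β y * v y := by
      rw [← integral_add (h.integrableOn_birth hum huw) (h.integrableOn_birth hvm hvw)]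
      refine integral_congr_ae ?_
      filter_upwards [h0] with y hy
      rw [hy, mul_add]
    have hg : ∀ᵐ x ∂(volume.restrict (Ioi (0 : ℝ))), gain a b (u + v : XSpace m) x =
        gain a b u x + gain a b v x := by
      filter_upwards [h.ae_integrableOn_gain hum huw hau, h.ae_integrableOn_gain hvm hvw hav,
        ae_restrict_mem measurableSet_Ioi] with x hx1 hx2 hx0
      rw [gain_congr_ae h0 hx0, gain, gain, gain, ← integral_add hx1 hx2]
      refine integral_congr_ae (Eventually.of_forall fun y => ?_)
      simp only [mul_add]
    have i1 : IntegrableOn (fun s => gain a b u s - a s * u s - f s) (Ioi 0) :=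
      integrableOn_of_memLp (((h.memLp_gain hum huw hau).sub hau).sub (Lp.memLp f))
    have i2 : IntegrableOn (fun s => gain a b v s - a s * v s - g s) (Ioi 0) :=
      integrableOn_of_memLp (((h.memLp_gain hvm hvw hav).sub hav).sub (Lp.memLp g))
    filter_upwards [h0, hu, hv] with x hx hx1 hx2
    rw [hb, hx, mul_add, hx1, hx2, add_add_add_comm,
      ← integral_add (i1.mono_set Ioc_subset_Ioi_self) (i2.mono_set Ioc_subset_Ioi_self)]
    congr 1
    · ring
    refine integral_congr_ae ?_
    filter_upwards [ae_restrict_of_ae_restrict_of_subset Ioc_subset_Ioi_self h0,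
      ae_restrict_of_ae_restrict_of_subset Ioc_subset_Ioi_self h0f,
      ae_restrict_of_ae_restrict_of_subset Ioc_subset_Ioi_self hg] with s hs1 hs2 hs3
    rw [hs1, hs2, hs3]
    ring

/-- The flux relation is homogeneous. -/
lemma hasFlux_smul (c : ℝ) {k : ℝ} {u f : XSpace m}
    (hu : HasFlux r a β b k u f) : HasFlux r a β b (c * k) (c • u) (c • f) := by
  obtain ⟨hau, hu⟩ := hu
  have h0 := XSpace.ae_smul c u
  have h0f := XSpace.ae_smul c f
  refine ⟨?_, ?_⟩
  · refine MemLp.ae_eq ?_ (hau.const_mul c)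
    rw [EventuallyEq, ae_weightMeasure]
    filter_upwards [h0] with x hx
    change c * (a x * u x) = a x * (c • u : XSpace m) x
    rw [hx]; ring
  · have hb : ∫ y in Ioi (0 : ℝ), β y * (c • u : XSpace m) y =
        c * ∫ y in Ioi (0 : ℝ), β y * u y := by
      rw [← integral_const_mul]
      refine integral_congr_ae ?_
      filter_upwards [h0] with y hy
      rw [hy]; ring
    have hg : ∀ x, 0 < x → gain a b (c • u : XSpace m) x = c * gain a b u x := by
      intro x hx0
      rw [gain_congr_ae h0 hx0, gain, gain, ← integral_const_mul]
      refine integral_congr_ae (Eventually.of_forall fun y => ?_)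
      ring
    filter_upwards [h0, hu] with x hx hx1
    rw [hb, hx, mul_left_comm, hx1, mul_add]
    congr 1
    · ring
    rw [← integral_const_mul]
    refine integral_congr_ae ?_
    filter_upwards [ae_restrict_of_ae_restrict_of_subset Ioc_subset_Ioi_self h0,
      ae_restrict_of_ae_restrict_of_subset Ioc_subset_Ioi_self h0f,
      ae_restrict_mem measurableSet_Ioc] with s hs1 hs2 hs3
    rw [hs1, hs2, hg s hs3.1]
    ring

/-- The graph of the operator as a linear relation. -/
def graphSubmodule (h : Coeffs r a β b m κ η C) : Submodule ℝ (XSpace m × XSpace m) where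
  carrier := operatorGraph r a β b m
  zero_mem' := by
    rw [h.mem_operatorGraph_iff]
    have h0 := XSpace.ae_zero (m := m)
    refine ⟨?_, ?_⟩
    · refine MemLp.ae_eq (f := fun _ => 0) ?_ MemLp.zero'
      rw [EventuallyEq, ae_weightMeasure]
      filter_upwards [h0] with x hx
      change 0 = a x * (0 : XSpace m) x
      rw [hx, mul_zero]
    · have hb : ∫ y in Ioi (0 : ℝ), β y * (0 : XSpace m) y = 0 := by
        refine integral_eq_zero_of_ae ?_
        filter_upwards [h0] with y hy
        rw [hy, mul_zero, Pi.zero_apply]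
      filter_upwards [h0] with x hx
      change r x * (0 : XSpace m) x = ((∫ y in Ioi (0 : ℝ), β y * (0 : XSpace m) y) + 0) +
        ∫ s in Ioc 0 x, (gain a b (0 : XSpace m) s - a s * (0 : XSpace m) s - (0 : XSpace m) s)
      rw [hb, hx, mul_zero, zero_add, zero_add]
      refine (integral_eq_zero_of_ae ?_).symm
      filter_upwards [ae_restrict_of_ae_restrict_of_subset Ioc_subset_Ioi_self h0,
        ae_restrict_mem measurableSet_Ioc] with s hs hs0
      rw [hs, gain_congr_ae h0 hs0.1]
      simp [gain]
  add_mem' := by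
    rintro ⟨u, f⟩ ⟨v, g⟩ hu hv
    rw [h.mem_operatorGraph_iff] at hu hv ⊢
    simpa using h.hasFlux_add hu hv
  smul_mem' := by
    rintro c ⟨u, f⟩ hu
    rw [h.mem_operatorGraph_iff] at hu ⊢
    simpa using hasFlux_smul c hu

end Coeffs

/-! ### The resolvent -/

namespace Coeffs

variable {r a β : ℝ → ℝ} {b : ℝ → ℝ → ℝ} {m κ η C : ℝ}

lemma absorb_zero (r a : ℝ → ℝ) (c : ℝ) : absorb r a c 0 = 0 := by simp [absorb]

/-- Solutions of the transport equation are dominated by the solution for absolute values. -/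
lemma enorm_le_transportSol (h : Coeffs r a β b m κ η C) {c k : ℝ} {u g : ℝ → ℝ}
    (hi : ∀ M, IntegrableOn (fun s => g s - (c + a s) * u s) (Ioc 0 M))
    (heq : ∀ᵐ x ∂(volume.restrict (Ioi (0 : ℝ))), r x * u x =
      k + ∫ s in Ioc 0 x, (g s - (c + a s) * u s)) :
    ∀ᵐ x ∂(volume.restrict (Ioi (0 : ℝ))),
      ‖u x‖ₑ ≤ transportSol r a c (fun x => ‖g x‖ₑ) ‖k‖ₑ x := by
  set w : ℝ → ℝ := fun s => g s - (c + a s) * u s with hw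
  set P := absorb r a c with hP
  have key : ∀ X, 0 < X → ‖k + ∫ s in Ioc 0 X, w s‖ₑ ≤ ENNReal.ofReal (Real.exp (-P X)) *
      (‖k‖ₑ + ∫⁻ s in Ioc 0 X, ENNReal.ofReal (Real.exp (P s)) * ‖g s‖ₑ) := by
    intro X hX
    have hwi : IntervalIntegrable w volume 0 X :=
      (intervalIntegrable_iff_integrableOn_Ioc_of_le hX.le).2 (hi X)
    set H : ℝ → ℝ := fun x => k + ∫ s in (0 : ℝ)..x, w s with hH
    have hHAC : AbsolutelyContinuousOnInterval H 0 X :=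
      AbsolutelyContinuousOnInterval.fun_add
        ((contDiff_const (n := 1)).contDiffOn.absolutelyContinuousOnInterval)
        (hwi.absolutelyContinuousOnInterval_intervalIntegral left_mem_uIcc)
    -- Integrating factor: since H agrees with r u almost everywhere, (e^P H)' = e^P g. The term (c
    -- + a) u is thus eliminated before absolute values are taken.
    have hFAC : AbsolutelyContinuousOnInterval (fun x => Real.exp (P x) * H x) 0 X :=
      (absolutelyContinuousOnInterval_exp
        (h.absolutelyContinuous_absorb c le_rfl hX.le)).fun_mul hHAC
    have hFTC := hFAC.integral_deriv_eq_sub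
    have hder : ∀ᵐ x ∂(volume.restrict (Ioc 0 X)),
        deriv (fun x => Real.exp (P x) * H x) x = Real.exp (P x) * g x := by
      filter_upwards [ae_restrict_of_ae (h.ae_hasDerivAt_absorb c (X + 1)),
        ae_restrict_of_ae hwi.ae_hasDerivAt_integral, ae_restrict_mem measurableSet_Ioc,
        ae_restrict_of_ae_restrict_of_subset Ioc_subset_Ioi_self heq] with x hx1 hx2 hx0 hx3
      have d1 := (hx1 ⟨hx0.1, by linarith [hx0.2]⟩).exp
      have d2 := (hx2 (by rw [uIcc_of_le hX.le]; exact ⟨hx0.1.le, hx0.2⟩) 0 left_mem_uIcc).const_add k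
      have d : HasDerivAt (fun x => Real.exp (P x) * H x)
          (Real.exp (P x) * ((c + a x) / r x) * H x + Real.exp (P x) * w x) x := d1.mul d2
      rw [d.deriv]
      have hr := (h.r_pos x hx0.1).ne'
      simp only [hH]
      rw [intervalIntegral.integral_of_le hx0.1.le, ← hx3]
      simp only [hw]
      field_simp
      ring
    have e0 : Real.exp (P 0) * H 0 = k := by simp [hH, hP, absorb_zero]
    have e1 : Real.exp (P X) * H X = k + ∫ x in Ioc 0 X, deriv (fun x => Real.exp (P x) * H x) x := by
      rw [← intervalIntegral.integral_of_le hX.le, hFTC, e0]; ring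
    have e2 : (k + ∫ s in Ioc 0 X, w s) = Real.exp (-P X) * (Real.exp (P X) * H X) := by
      rw [← mul_assoc, ← Real.exp_add, neg_add_cancel, Real.exp_zero, one_mul]
      simp only [hH, intervalIntegral.integral_of_le hX.le]
    rw [e2, e1, enorm_mul, Real.enorm_of_nonneg (Real.exp_pos _).le]
    refine mul_le_mul_right ((enorm_add_le _ _).trans (add_le_add le_rfl ?_)) _
    refine (enorm_integral_le_lintegral_enorm _).trans (lintegral_mono_ae ?_)
    filter_upwards [hder] with x hx
    rw [hx, enorm_mul, Real.enorm_of_nonneg (Real.exp_pos _).le]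
  filter_upwards [heq, ae_restrict_mem measurableSet_Ioi] with x hx hx0
  have hr := h.r_pos x hx0
  have e : u x = (r x)⁻¹ * (k + ∫ s in Ioc 0 x, w s) := by
    rw [← hx]; field_simp
  rw [e, enorm_mul, Real.enorm_of_nonneg (inv_nonneg.2 hr.le), transportSol, div_eq_inv_mul,
    ENNReal.ofReal_mul (inv_nonneg.2 hr.le), mul_assoc]
  exact mul_le_mul_right (key x hx0) _

/-- The explicit solution formula for the transport equation. -/
lemma flux_eq_of_formula (h : Coeffs r a β b m κ η C) {c k : ℝ} {u g : ℝ → ℝ}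
    (hg : ∀ M, IntegrableOn g (Ioc 0 M))
    (hu : ∀ x, 0 < x → u x = Real.exp (-absorb r a c x) / r x *
      (k + ∫ s in Ioc 0 x, Real.exp (absorb r a c s) * g s)) {x : ℝ} (hx : 0 < x) :
    r x * u x = k + ∫ s in Ioc 0 x, (g s - (c + a s) * u s) := by
  set P := absorb r a c with hP
  have hPAC := h.absolutelyContinuous_absorb c le_rfl hx.le
  have hgi : IntervalIntegrable g volume 0 x :=
    (intervalIntegrable_iff_integrableOn_Ioc_of_le hx.le).2 (hg x)
  have hEg : IntervalIntegrable (fun s => Real.exp (P s) * g s) volume 0 x :=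
    hgi.continuousOn_mul hPAC.continuousOn.rexp
  set H : ℝ → ℝ := fun x => k + ∫ s in (0 : ℝ)..x, Real.exp (P s) * g s with hH
  have hHAC : AbsolutelyContinuousOnInterval H 0 x :=
    AbsolutelyContinuousOnInterval.fun_add
      ((contDiff_const (n := 1)).contDiffOn.absolutelyContinuousOnInterval)
      (hEg.absolutelyContinuousOnInterval_intervalIntegral left_mem_uIcc)
  have hFAC : AbsolutelyContinuousOnInterval (fun x => Real.exp (-P x) * H x) 0 x :=
    (absolutelyContinuousOnInterval_exp hPAC.fun_neg).fun_mul hHAC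
  have hFTC := hFAC.integral_deriv_eq_sub
  have hform : ∀ y, 0 < y → r y * u y = Real.exp (-P y) * H y := by
    intro y hy
    have hr := (h.r_pos y hy).ne'
    rw [hu y hy]
    simp only [hH, intervalIntegral.integral_of_le hy.le]
    field_simp
  have hder : ∀ᵐ y ∂(volume.restrict (Ioc 0 x)),
      deriv (fun x => Real.exp (-P x) * H x) y = g y - (c + a y) * u y := by
    filter_upwards [ae_restrict_of_ae (h.ae_hasDerivAt_absorb c (x + 1)),
      ae_restrict_of_ae hEg.ae_hasDerivAt_integral, ae_restrict_mem measurableSet_Ioc]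
      with y hy1 hy2 hy0
    have d1 := (hy1 ⟨hy0.1, by linarith [hy0.2]⟩).neg.exp
    have d2 := (hy2 (by rw [uIcc_of_le hx.le]; exact ⟨hy0.1.le, hy0.2⟩) 0 left_mem_uIcc).const_add k
    have d : HasDerivAt (fun x => Real.exp (-P x) * H x)
        (Real.exp (-P y) * -((c + a y) / r y) * H y +
          Real.exp (-P y) * (Real.exp (P y) * g y)) y := d1.mul d2
    rw [d.deriv]
    have hr := (h.r_pos y hy0.1).ne'
    have e1 : Real.exp (-P y) * Real.exp (P y) = 1 := by
      rw [← Real.exp_add, neg_add_cancel, Real.exp_zero]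
    have e2 : u y = Real.exp (-P y) * H y / r y := by
      rw [← hform y hy0.1]; field_simp
    rw [e2]
    linear_combination g y * e1
  have e0 : Real.exp (-P 0) * H 0 = k := by simp [hH, hP, absorb_zero]
  rw [hform x hx, ← integral_congr_ae hder, ← intervalIntegral.integral_of_le hx.le, hFTC, e0]
  ring

lemma transportSol_ofReal (h : Coeffs r a β b m κ η C) {c k : ℝ} {g : ℝ → ℝ}
    (hg : ∀ M, IntegrableOn g (Ioc 0 M)) (hg0 : ∀ x, 0 ≤ g x) (hk : 0 ≤ k) {x : ℝ} (hx : 0 < x) :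
    transportSol r a c (fun s => ENNReal.ofReal (g s)) (ENNReal.ofReal k) x =
      ENNReal.ofReal (Real.exp (-absorb r a c x) / r x *
        (k + ∫ s in Ioc 0 x, Real.exp (absorb r a c s) * g s)) := by
  have hPAC := h.absolutelyContinuous_absorb c le_rfl hx.le
  have hgi : IntervalIntegrable g volume 0 x :=
    (intervalIntegrable_iff_integrableOn_Ioc_of_le hx.le).2 (hg x)
  have hEg : IntegrableOn (fun s => Real.exp (absorb r a c s) * g s) (Ioc 0 x) :=
    (intervalIntegrable_iff_integrableOn_Ioc_of_le hx.le).1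
      (hgi.continuousOn_mul hPAC.continuousOn.rexp)
  have hnn : ∀ s, 0 ≤ Real.exp (absorb r a c s) * g s := fun s =>
    mul_nonneg (Real.exp_pos _).le (hg0 s)
  rw [ENNReal.ofReal_mul (div_nonneg (Real.exp_pos _).le (h.r_pos x hx).le),
    ENNReal.ofReal_add hk (setIntegral_nonneg measurableSet_Ioc fun s _ => hnn s),
    ofReal_integral_eq_lintegral_ofReal hEg (Eventually.of_forall hnn), transportSol]
  simp only [ENNReal.ofReal_mul (Real.exp_pos _).le]

/-- Existence of the resolvent for non-negative data. -/
theorem exists_resolvent_nonneg (h : Coeffs r a β b m κ η C) {c : ℝ} (hc : 3 * C < c)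
    (f : XSpace m) :
    ∃ u f' : XSpace m, (∀ᵐ x ∂(volume.restrict (Ioi (0 : ℝ))), f' x = max (f x) 0) ∧
      (u, c • u - f') ∈ operatorGraph r a β b m ∧
      ∃ U : ℝ → ℝ≥0∞, Measurable U ∧
        U = resolventStep r a β b c (fun x => ENNReal.ofReal (f x)) U ∧
        (∀ᵐ x ∂(volume.restrict (Ioi (0 : ℝ))), 0 ≤ u x ∧ U x = ENNReal.ofReal (u x)) ∧
        ∀ s : Set ℝ, (∀ u, Measurable u → (∀ x ∈ s, u x = 0) →
          ∀ x ∈ s, resolventStep r a β b c (fun x => ENNReal.ofReal (f x)) u x = 0) →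
          ∀ x ∈ s, U x = 0 := by
  have hC := h.C_nonneg
  have hfm := XSpace.measurable f
  have hfp : Measurable fun x => max (f x) 0 := hfm.max measurable_const
  have hfE : Measurable fun x => ENNReal.ofReal (f x) := hfm.ennreal_ofReal
  have hfw : wInt κ m (fun x => ENNReal.ofReal (f x)) ≠ ⊤ :=
    ne_top_of_le_ne_top (XSpace.wInt_ne_top f h.one_le)
      (wInt_mono_ae (Eventually.of_forall fun x => Real.ofReal_le_enorm (f x)))
  obtain ⟨U, hUm, hUeq, hUw, hUa, hUv⟩ := h.exists_minimal_solution hc hfE hfw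
  have hgw : wInt κ m (gainE a b U) ≠ ⊤ := by
    refine ne_top_of_le_ne_top ?_ (h.wInt_gainE_le hUm)
    exact ENNReal.add_ne_top.2 ⟨ENNReal.mul_ne_top ENNReal.ofReal_ne_top hUa,
      ENNReal.mul_ne_top ENNReal.ofReal_ne_top hUw⟩
  have hkw : birthE β U ≠ ⊤ :=
    ne_top_of_le_ne_top (ENNReal.mul_ne_top ENNReal.ofReal_ne_top hUw) (h.birthE_le hUm)
  have hGm : Measurable fun x => ENNReal.ofReal (f x) + gainE a b U x :=
    hfE.add (h.measurable_gainE hUm)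
  have hGw : ∫⁻ x in Ioi (0 : ℝ), (ENNReal.ofReal (f x) + gainE a b U x) ≠ ⊤ := by
    refine ne_top_of_le_ne_top ?_ (lintegral_le_wInt (m := m) h.one_le _)
    rw [wInt_add hfE]
    exact ENNReal.add_ne_top.2 ⟨hfw, hgw⟩
  set g : ℝ → ℝ := fun x => (ENNReal.ofReal (f x) + gainE a b U x).toReal with hg
  set k : ℝ := (birthE β U).toReal with hk
  have hgi : ∀ M, IntegrableOn g (Ioc 0 M) := fun M =>
    (integrable_toReal_of_lintegral_ne_top hGm.aemeasurable hGw).mono_measure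
      (Measure.restrict_mono Ioc_subset_Ioi_self le_rfl)
  have hGfin : ∀ᵐ x ∂(volume.restrict (Ioi (0 : ℝ))),
      ENNReal.ofReal (f x) + gainE a b U x < ⊤ := ae_lt_top hGm hGw
  -- The births and the integral of the source are finite, so the fixed point formula shows U to be
  -- finite at every x > 0, not merely almost everywhere.
  have hUform : ∀ x, 0 < x → U x = ENNReal.ofReal (Real.exp (-absorb r a c x) / r x *
      (k + ∫ s in Ioc 0 x, Real.exp (absorb r a c s) * g s)) := by
    intro x hx
    rw [← h.transportSol_ofReal hgi (fun _ => ENNReal.toReal_nonneg) ENNReal.toReal_nonneg hx,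
      ENNReal.ofReal_toReal hkw]
    have e : ∀ᵐ x ∂(volume.restrict (Ioi (0 : ℝ))),
        ENNReal.ofReal (f x) + gainE a b U x = ENNReal.ofReal (g x) :=
      hGfin.mono fun x hx => (ENNReal.ofReal_toReal hx.ne).symm
    conv_lhs => rw [hUeq]
    exact le_antisymm (transportSol_mono_ae (e.mono fun _ hx => hx.le) le_rfl x)
      (transportSol_mono_ae (e.mono fun _ hx => hx.ge) le_rfl x)
  set u : ℝ → ℝ := fun x => (U x).toReal with hu
  have huU : ∀ x, 0 < x → U x = ENNReal.ofReal (u x) := fun x hx => by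
    simp only [hu]
    rw [ENNReal.ofReal_toReal]
    rw [hUform x hx]
    exact ENNReal.ofReal_ne_top
  have hform : ∀ x, 0 < x → u x = Real.exp (-absorb r a c x) / r x *
      (k + ∫ s in Ioc 0 x, Real.exp (absorb r a c s) * g s) := by
    intro x hx
    simp only [hu]
    rw [hUform x hx, ENNReal.toReal_ofReal]
    refine mul_nonneg (div_nonneg (Real.exp_pos _).le (h.r_pos x hx).le)
      (add_nonneg ENNReal.toReal_nonneg (setIntegral_nonneg measurableSet_Ioc fun s _ =>
        mul_nonneg (Real.exp_pos _).le ENNReal.toReal_nonneg))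
  have hum : Measurable u := hUm.ennreal_toReal
  have hu0 : ∀ x, 0 ≤ u x := fun x => ENNReal.toReal_nonneg
  have huU' : ∀ᵐ x ∂(volume.restrict (Ioi (0 : ℝ))), ‖u x‖ₑ = U x := by
    filter_upwards [ae_restrict_mem measurableSet_Ioi] with x hx
    rw [huU x hx, Real.enorm_of_nonneg (hu0 x)]
  have huL : MemLp u 1 (weightMeasure m) := by
    rw [memLp_weight_iff h.one_le hum.aestronglyMeasurable, wInt_congr_ae huU']
    exact hUw
  have hauL : MemLp (fun x => a x * u x) 1 (weightMeasure m) := by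
    have ham : Measurable fun x => a x * u x := h.a_meas.mul hum
    rw [memLp_weight_iff h.one_le ham.aestronglyMeasurable, ← h.awInt_eq_wInt]
    have : awInt a κ m (fun x => ‖u x‖ₑ) = awInt a κ m U :=
      lintegral_congr_ae (huU'.mono fun x hx => by simp only [hx])
    rw [this]; exact hUa
  have hfpL : MemLp (fun x => max (f x) 0) 1 (weightMeasure m) := by
    refine (Lp.memLp f).mono hfp.aestronglyMeasurable (Eventually.of_forall fun x => ?_)
    rw [Real.norm_eq_abs, Real.norm_eq_abs, abs_of_nonneg (le_max_right _ _)]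
    exact max_le (le_abs_self _) (abs_nonneg _)
  have hue := XSpace.ae_toLp huL
  have hfe := XSpace.ae_toLp hfpL
  refine ⟨huL.toLp u, hfpL.toLp _, hfe, ?_, U, hUm, hUeq, ?_, hUv⟩
  · rw [h.mem_operatorGraph_iff]
    refine ⟨?_, ?_⟩
    · refine hauL.ae_eq ?_
      rw [EventuallyEq, ae_weightMeasure]
      filter_upwards [hue] with x hx
      rw [hx]
    · have hb : ∫ y in Ioi (0 : ℝ), β y * huL.toLp u y = k := by
        have e1 : ∫ y in Ioi (0 : ℝ), β y * huL.toLp u y = ∫ y in Ioi (0 : ℝ), β y * u y :=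
          integral_congr_ae (hue.mono fun y hy => by simp only [hy])
        have hbm : Measurable fun y => β y * u y := h.β_meas.mul hum
        rw [e1, integral_eq_lintegral_of_nonneg_ae _ hbm.aestronglyMeasurable]
        · simp only [hk, birthE]
          congr 1
          refine setLIntegral_congr_fun measurableSet_Ioi fun y hy => ?_
          rw [ENNReal.ofReal_mul (h.β_nonneg y hy), huU y hy]
        · filter_upwards [ae_restrict_mem measurableSet_Ioi] with y hy
          exact mul_nonneg (h.β_nonneg y hy) (hu0 y)
      have hgain : ∀ x, 0 < x → gain a b u x = (gainE a b U x).toReal := by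
        intro x hx
        have hm' : Measurable fun y => a y * b x y * u y :=
          (h.a_meas.mul (h.b_meas.comp measurable_prodMk_left)).mul hum
        rw [gain, integral_eq_lintegral_of_nonneg_ae _ hm'.aestronglyMeasurable, gainE]
        · congr 1
          refine setLIntegral_congr_fun measurableSet_Ioi fun y hy => ?_
          have hy0 : 0 < y := hx.trans hy
          rw [ENNReal.ofReal_mul (mul_nonneg (h.a_nonneg y hy0) (h.b_nonneg x y hx hy0)), huU y hy0]
        · filter_upwards [ae_restrict_mem measurableSet_Ioi] with y hy
          have hy0 : 0 < y := hx.trans hy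
          exact mul_nonneg (mul_nonneg (h.a_nonneg y hy0) (h.b_nonneg x y hx hy0)) (hu0 y)
      filter_upwards [hue, ae_restrict_mem measurableSet_Ioi] with x hx hx0
      rw [hx, h.flux_eq_of_formula hgi hform hx0, hb, add_zero]
      congr 1
      refine integral_congr_ae ?_
      filter_upwards [ae_restrict_of_ae_restrict_of_subset Ioc_subset_Ioi_self hue,
        ae_restrict_of_ae_restrict_of_subset Ioc_subset_Ioi_self hfe,
        ae_restrict_of_ae_restrict_of_subset Ioc_subset_Ioi_self hGfin,
        ae_restrict_of_ae_restrict_of_subset Ioc_subset_Ioi_self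
          (XSpace.ae_sub (c • huL.toLp u) (hfpL.toLp _)),
        ae_restrict_of_ae_restrict_of_subset Ioc_subset_Ioi_self (XSpace.ae_smul c (huL.toLp u)),
        ae_restrict_mem measurableSet_Ioc] with s hs1 hs2 hs3 hs4 hs5 hs0
      rw [hs4, hs5, hs2, hs1, gain_congr_ae hue hs0.1, hgain s hs0.1]
      have e : g s = max (f s) 0 + (gainE a b U s).toReal := by
        simp only [hg]
        rw [ENNReal.toReal_add ENNReal.ofReal_ne_top (ENNReal.add_lt_top.1 hs3).2.ne,
          ENNReal.toReal_ofReal']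
      rw [e]; ring
  · filter_upwards [hue, ae_restrict_mem measurableSet_Ioi] with x hx hx0
    rw [hx]
    exact ⟨hu0 x, huU x hx0⟩

/-- The a priori estimate for the resolvent equation with an inhomogeneous boundary condition. -/
lemma wInt_le_of_hasFlux (h : Coeffs r a β b m κ η C) {c k : ℝ} (hc : 3 * C ≤ c)
    {u f : XSpace m} (hu : HasFlux r a β b k u (c • u - f)) :
    ENNReal.ofReal (c - 3 * C) * wInt κ m (fun x => ‖u x‖ₑ) ≤
      wInt κ m (fun x => ‖f x‖ₑ) + ‖k‖ₑ := by
  obtain ⟨hau, heq⟩ := hu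
  have hum := XSpace.measurable u
  have huw := Lp.memLp u
  have hgL := h.memLp_gain hum huw hau
  have hsub := XSpace.ae_sub (c • u) f
  have hsm := XSpace.ae_smul c u
  have hi : IntegrableOn (fun s => (gain a b u s + f s) - (c + a s) * u s) (Ioi 0) := by
    have h1 : MemLp (fun s => (gain a b u s + f s) - (c * u s + a s * u s)) 1 (weightMeasure m) :=
      (hgL.add (Lp.memLp f)).sub ((huw.const_mul c).add hau)
    refine (integrableOn_of_memLp h1).congr (Eventually.of_forall fun s => ?_)
    simp only; ring
  have hle := h.enorm_le_transportSol (c := c) (k := (∫ y in Ioi (0 : ℝ), β y * u y) + k)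
    (u := u) (g := fun s => gain a b u s + f s) (fun M => hi.mono_set Ioc_subset_Ioi_self) (by
      filter_upwards [heq] with x hx
      rw [hx]
      congr 1
      refine integral_congr_ae ?_
      filter_upwards [ae_restrict_of_ae_restrict_of_subset Ioc_subset_Ioi_self hsub,
        ae_restrict_of_ae_restrict_of_subset Ioc_subset_Ioi_self hsm] with s hs1 hs2
      rw [hs1, hs2]; ring)
  have hb : ‖(∫ y in Ioi (0 : ℝ), β y * u y) + k‖ₑ ≤ birthE β (fun x => ‖u x‖ₑ) + ‖k‖ₑ := by
    refine (enorm_add_le _ _).trans (add_le_add ?_ le_rfl)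
    refine (enorm_integral_le_lintegral_enorm _).trans (le_of_eq ?_)
    refine setLIntegral_congr_fun measurableSet_Ioi fun y hy => ?_
    rw [enorm_mul, Real.enorm_of_nonneg (h.β_nonneg y hy)]
  -- |u| is a subsolution of the resolvent equation for |f| with boundary defect |k|, which is all
  -- the a priori estimate needs.
  have hle2 : ∀ᵐ x ∂(volume.restrict (Ioi (0 : ℝ))), ‖u x‖ₑ ≤ transportSol r a c
      (fun x => ‖f x‖ₑ + gainE a b (fun x => ‖u x‖ₑ) x) (birthE β (fun x => ‖u x‖ₑ) + ‖k‖ₑ) x := by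
    filter_upwards [hle] with x hx
    refine hx.trans (transportSol_mono (fun y hy => ?_) hb x)
    refine (enorm_add_le _ _).trans ?_
    rw [add_comm]
    exact add_le_add le_rfl (h.enorm_gain_le u hy)
  exact le_self_add.trans (h.apriori hc (XSpace.measurable f).enorm hum.enorm hle2
    (XSpace.wInt_ne_top u h.one_le) (h.awInt_ne_top hau))

lemma wNorm_le_of_hasFlux (h : Coeffs r a β b m κ η C) {c k : ℝ} (hc : 3 * C ≤ c)
    {u f : XSpace m} (hu : HasFlux r a β b k u (c • u - f)) :
    (c - 3 * C) * wNorm κ m h.one_le u ≤ wNorm κ m h.one_le f + |k| := by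
  have h1 := h.wInt_le_of_hasFlux hc hu
  rw [← ofReal_wNorm h.one_le, ← ofReal_wNorm h.one_le, ← ENNReal.ofReal_mul (by linarith),
    Real.enorm_eq_ofReal_abs, ← ENNReal.ofReal_add (apply_nonneg _ _) (abs_nonneg _)] at h1
  exact (ENNReal.ofReal_le_ofReal_iff (add_nonneg (apply_nonneg _ _) (abs_nonneg _))).1 h1

end Coeffs

/-! ### Generation -/

lemma isFiniteMeasureOnCompacts_withDensity {q : ℝ → ℝ} (hq : ∀ M, IntegrableOn q (Ioc 0 M)) :
    IsFiniteMeasureOnCompacts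
      ((volume.restrict (Ioi (0 : ℝ))).withDensity fun x => ENNReal.ofReal (q x)) := by
  refine ⟨fun K hK => ?_⟩
  obtain ⟨M, hM⟩ := hK.bddAbove
  rw [withDensity_apply _ hK.measurableSet, Measure.restrict_restrict hK.measurableSet]
  refine lt_of_le_of_lt (lintegral_mono_set (t := Ioc 0 M) fun x hx => ⟨hx.2, hM hx.1⟩) ?_
  refine lt_of_le_of_lt (lintegral_mono fun x => Real.ofReal_le_enorm (q x)) (hq M).2

namespace Coeffs

variable {r a β : ℝ → ℝ} {b : ℝ → ℝ → ℝ} {m κ η C : ℝ}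

/-- Splits f into positive and negative parts and subtracts the two solutions for non-negative data.
-/
lemma exists_resolvent (h : Coeffs r a β b m κ η C) {c : ℝ} (hc : 3 * C < c) (f : XSpace m) :
    ∃ u : XSpace m, (u, c • u - f) ∈ h.graphSubmodule := by
  obtain ⟨u, f', hf', hu, -⟩ := h.exists_resolvent_nonneg hc f
  obtain ⟨v, g', hg', hv, -⟩ := h.exists_resolvent_nonneg hc (-f)
  have hn : ∀ᵐ x ∂(volume.restrict (Ioi (0 : ℝ))), (-f) x = -f x := by
    have := Lp.coeFn_neg f
    rw [EventuallyEq, ae_weightMeasure] at this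
    exact this
  have e : f = f' - g' := by
    refine XSpace.ext_ae ?_
    filter_upwards [hf', hg', hn, XSpace.ae_sub f' g'] with x h1 h2 h3 h4
    rw [h4, h1, h2, h3]
    rcases le_total (f x) 0 with h | h
    · rw [max_eq_right h, max_eq_left (by linarith)]; ring
    · rw [max_eq_left h, max_eq_right (by linarith)]; ring
  refine ⟨u - v, ?_⟩
  have hs : ((u, c • u - f') : XSpace m × XSpace m) - (v, c • v - g') ∈ h.graphSubmodule :=
    h.graphSubmodule.sub_mem hu hv
  have e2 : ((u - v, c • (u - v) - f) : XSpace m × XSpace m) = (u, c • u - f') - (v, c • v - g') := by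
    rw [e, Prod.mk_sub_mk, smul_sub]
    congr 1
    abel
  rwa [e2]

lemma wNorm_le_of_mem (h : Coeffs r a β b m κ η C) {c : ℝ} (hc : 3 * C ≤ c) {u f : XSpace m}
    (hu : (u, f) ∈ h.graphSubmodule) :
    (c - 3 * C) * wNorm κ m h.one_le u ≤ wNorm κ m h.one_le (c • u - f) := by
  have h1 : HasFlux r a β b 0 u f := (h.mem_operatorGraph_iff (u, f)).1 hu
  have h2 := h.wNorm_le_of_hasFlux (f := c • u - f) hc (by rwa [sub_sub_cancel])
  simpa using h2

lemma eq_of_mem_graphSubmodule (h : Coeffs r a β b m κ η C) {c : ℝ} (hc : 3 * C < c)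
    {u v f : XSpace m} (hu : (u, c • u - f) ∈ h.graphSubmodule)
    (hv : (v, c • v - f) ∈ h.graphSubmodule) : u = v := by
  have h1 := h.wNorm_le_of_mem hc.le (h.graphSubmodule.sub_mem hu hv)
  have e : c • (u - v) - (c • u - f - (c • v - f)) = 0 := by rw [smul_sub]; abel
  rw [e, map_zero] at h1
  have h2 := (norm_le_wNorm h.one_le (u - v)).trans
    (nonpos_of_mul_nonpos_right h1 (sub_pos.2 hc))
  exact sub_eq_zero.1 (norm_le_zero_iff.1 h2)

/-- The resolvent at `c > 3 C`. -/
def resolventAux (h : Coeffs r a β b m κ η C) {c : ℝ} (hc : 3 * C < c) :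
    XSpace m →L[ℝ] XSpace m :=
  LinearMap.mkContinuous
    { toFun := fun f => (h.exists_resolvent hc f).choose
      map_add' := fun f g => by
        refine h.eq_of_mem_graphSubmodule hc (h.exists_resolvent hc (f + g)).choose_spec ?_
        convert h.graphSubmodule.add_mem (h.exists_resolvent hc f).choose_spec
          (h.exists_resolvent hc g).choose_spec using 1
        rw [Prod.mk_add_mk, smul_add]
        congr 1
        abel
      map_smul' := fun d f => by
        refine h.eq_of_mem_graphSubmodule hc (h.exists_resolvent hc (d • f)).choose_spec ?_
        convert h.graphSubmodule.smul_mem d (h.exists_resolvent hc f).choose_spec using 1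
        rw [Prod.smul_mk, smul_sub, smul_comm]
        rfl }
    ((c - 3 * C)⁻¹ * κ) fun f => by
      have h1 := h.wNorm_le_of_mem hc.le (h.exists_resolvent hc f).choose_spec
      rw [sub_sub_cancel] at h1
      refine (norm_le_wNorm h.one_le _).trans ?_
      rw [mul_assoc, ← div_eq_inv_mul, le_div_iff₀' (sub_pos.2 hc)]
      exact h1.trans (wNorm_le_norm h.one_le f)

open Classical in
/-- The resolvent of the operator. -/
def resolvent (h : Coeffs r a β b m κ η C) (c : ℝ) : XSpace m →L[ℝ] XSpace m :=
  if hc : 3 * C < c then h.resolventAux hc else 0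

lemma resolvent_mem (h : Coeffs r a β b m κ η C) {c : ℝ} (hc : 3 * C < c) (f : XSpace m) :
    (h.resolvent c f, c • h.resolvent c f - f) ∈ h.graphSubmodule := by
  rw [resolvent, dif_pos hc]
  exact (h.exists_resolvent hc f).choose_spec

lemma integrableOn_wt_div (h : Coeffs r a β b m κ η C) (M : ℝ) :
    IntegrableOn (fun x => wt κ m x / r x) (Ioc 0 M) := by
  have h1 : IntegrableOn (fun x => wt κ m x * (1 / r x)) (Ioc 0 M) := by
    refine (h.r_int M).bdd_mul (c := wt κ m M) (measurable_wt κ m).aestronglyMeasurable ?_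
    filter_upwards [ae_restrict_mem measurableSet_Ioc] with x hx
    rw [Real.norm_of_nonneg (h.wt_pos hx.1).le]
    have := h.one_le
    have := Real.rpow_le_rpow hx.1.le hx.2 (zero_lt_one.trans h.one_lt).le
    unfold wt
    gcongr
  exact h1.congr (Eventually.of_forall fun x => by simp only [mul_one_div])

/-- The measure for which `u ↦ r u` is an isometry from the space with weight `1 + κ x ^ m`. -/
def fluxMeasure (r : ℝ → ℝ) (κ m : ℝ) : Measure ℝ :=
  (volume.restrict (Ioi (0 : ℝ))).withDensity fun x => ENNReal.ofReal (wt κ m x / r x)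

lemma isFiniteMeasureOnCompacts_fluxMeasure (h : Coeffs r a β b m κ η C) :
    IsFiniteMeasureOnCompacts (fluxMeasure r κ m) :=
  isFiniteMeasureOnCompacts_withDensity h.integrableOn_wt_div

lemma isFiniteMeasureOnCompacts_weightMeasure (h : Coeffs r a β b m κ η C) :
    IsFiniteMeasureOnCompacts (weightMeasure m) := by
  rw [weightMeasure_eq]
  refine isFiniteMeasureOnCompacts_withDensity fun M => ?_
  have h1 : Continuous (wt 1 m) := by
    unfold wt
    exact continuous_const.add (continuous_const.mul
      (Real.continuous_rpow_const (zero_lt_one.trans h.one_lt).le))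
  exact (h1.integrableOn_Icc).mono_set Ioc_subset_Icc_self

lemma eLpNorm_fluxMeasure (h : Coeffs r a β b m κ η C) {f : ℝ → ℝ} (hf : Measurable f) :
    eLpNorm f 1 (fluxMeasure r κ m) = wInt κ m fun x => ‖f x / r x‖ₑ := by
  have hm : Measurable fun x => ENNReal.ofReal (wt κ m x / r x) :=
    ((measurable_wt κ m).div h.r_meas).ennreal_ofReal
  rw [eLpNorm_one_eq_lintegral_enorm, fluxMeasure,
    lintegral_withDensity_eq_lintegral_mul _ hm hf.enorm]
  refine setLIntegral_congr_fun measurableSet_Ioi fun x hx => ?_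
  have hr := h.r_pos x hx
  simp only [Pi.mul_apply, div_eq_mul_inv]
  rw [enorm_mul,
    ENNReal.ofReal_mul (h.wt_pos hx).le, Real.enorm_of_nonneg (inv_nonneg.2 hr.le)]
  ring

/-- Functions of the form `φ / r` with `φ` a test function solve the flux relation. -/
lemma exists_hasFlux_of_smooth (h : Coeffs r a β b m κ η C) {φ : ℝ → ℝ} (hφ : ContDiff ℝ ∞ φ)
    (hc : HasCompactSupport φ) : ∃ (k : ℝ) (u f : XSpace m), HasFlux r a β b k u f ∧
      ∀ᵐ x ∂(volume.restrict (Ioi (0 : ℝ))), u x = φ x / r x := by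
  have hν := h.isFiniteMeasureOnCompacts_fluxMeasure
  have hμ := h.isFiniteMeasureOnCompacts_weightMeasure
  obtain ⟨M, hM⟩ := hc.isCompact.bddAbove
  have hφM : ∀ x, M < x → φ x = 0 := fun x hx =>
    image_eq_zero_of_notMem_tsupport fun hx' => (not_le.2 hx) (hM hx')
  set u₀ : ℝ → ℝ := fun x => φ x / r x with hu₀
  have hum : Measurable u₀ := hφ.continuous.measurable.div h.r_meas
  have huL : MemLp u₀ 1 (weightMeasure m) := by
    rw [memLp_weight_iff h.one_le hum.aestronglyMeasurable,
      ← h.eLpNorm_fluxMeasure hφ.continuous.measurable]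
    exact (hφ.continuous.memLp_of_hasCompactSupport hc).2.ne
  have hauL : MemLp (fun x => a x * u₀ x) 1 (weightMeasure m) := by
    obtain ⟨D, hD⟩ := h.a_bdd M
    have ham : Measurable fun x => a x * u₀ x := h.a_meas.mul hum
    refine (huL.const_mul D).mono (aestronglyMeasurable_weight_iff.2 ham.aestronglyMeasurable) ?_
    rw [ae_weightMeasure]
    rw [ae_restrict_iff' measurableSet_Ioc] at hD
    filter_upwards [ae_restrict_of_ae hD, ae_restrict_mem measurableSet_Ioi] with x hx hx0
    rcases le_or_gt x M with hxM | hxM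
    · have h1 := hx ⟨hx0, hxM⟩
      rw [norm_mul, norm_mul, Real.norm_of_nonneg (h.a_nonneg x hx0)]
      exact mul_le_mul_of_nonneg_right (h1.trans (Real.le_norm_self D)) (norm_nonneg _)
    · simp [hu₀, hφM x hxM]
  have hdL : MemLp (deriv φ) 1 (weightMeasure m) :=
    (hφ.continuous_deriv (by simp)).memLp_of_hasCompactSupport hc.deriv
  have hgL := h.memLp_gain hum huL hauL
  have hfL : MemLp (fun x => gain a b u₀ x - a x * u₀ x - deriv φ x) 1 (weightMeasure m) :=
    (hgL.sub hauL).sub hdL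
  have hue := XSpace.ae_toLp huL
  have hfe := XSpace.ae_toLp hfL
  -- φ need not vanish at 0: the flux r u has trace φ 0, and this is the amount by which the
  -- boundary condition fails.
  refine ⟨φ 0 - ∫ y in Ioi (0 : ℝ), β y * huL.toLp u₀ y, huL.toLp u₀, hfL.toLp _,
    ⟨?_, ?_⟩, hue⟩
  · refine hauL.ae_eq ?_
    rw [EventuallyEq, ae_weightMeasure]
    filter_upwards [hue] with x hx
    rw [hx]
  · filter_upwards [hue, ae_restrict_mem measurableSet_Ioi] with x hx hx0
    have e : ∫ s in Ioc 0 x, (gain a b (huL.toLp u₀) s - a s * huL.toLp u₀ s -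
        hfL.toLp (fun x => gain a b u₀ x - a x * u₀ x - deriv φ x) s) = φ x - φ 0 := by
      rw [← intervalIntegral.integral_deriv_eq_sub
        (fun y _ => (hφ.differentiable (by simp)) y)
        ((hφ.continuous_deriv (by simp)).intervalIntegrable _ _),
        intervalIntegral.integral_of_le (mem_Ioi.1 hx0).le]
      refine integral_congr_ae ?_
      filter_upwards [ae_restrict_of_ae_restrict_of_subset Ioc_subset_Ioi_self hue,
        ae_restrict_of_ae_restrict_of_subset Ioc_subset_Ioi_self hfe,
        ae_restrict_mem measurableSet_Ioc] with s hs1 hs2 hs0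
      rw [hs2, hs1, gain_congr_ae hue hs0.1]
      ring
    rw [e, hx]
    have hr := (h.r_pos x hx0).ne'
    simp only [hu₀]
    field_simp
    ring

/-- Solutions of the flux relation are limits of elements of the domain. -/
lemma exists_mem_domain_near (h : Coeffs r a β b m κ η C) {k : ℝ} {u f : XSpace m}
    (hu : HasFlux r a β b k u f) {ε : ℝ} (hε : 0 < ε) :
    ∃ v g : XSpace m, (v, g) ∈ h.graphSubmodule ∧ wNorm κ m h.one_le (u - v) < ε := by
  -- The difference u - v solves the homogeneous equation with boundary defect k, so its norm is at
  -- most |k| / (c - 3C); the choice of c gives (c - 3C) ε = ε + |k| > |k|.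
  set c : ℝ := 3 * C + 1 + |k| / ε with hc
  have hk : 0 ≤ |k| / ε := by positivity
  have hc3 : 3 * C < c := by linarith
  obtain ⟨v, hv⟩ : ∃ v, v = h.resolvent c (c • u - f) := ⟨_, rfl⟩
  have hvm := h.resolvent_mem hc3 (c • u - f)
  rw [← hv] at hvm
  refine ⟨v, _, hvm, ?_⟩
  have hvf : HasFlux r a β b 0 v (c • v - (c • u - f)) :=
    (h.mem_operatorGraph_iff (v, c • v - (c • u - f))).1 hvm
  have h2 := h.hasFlux_add hu (hasFlux_smul (-1) hvf)
  have e2 : f + (-1 : ℝ) • (c • v - (c • u - f)) = c • (u + (-1 : ℝ) • v) - 0 := by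
    rw [neg_one_smul, neg_one_smul, smul_add, smul_neg]; abel
  rw [e2, mul_zero, add_zero] at h2
  have h3 := h.wNorm_le_of_hasFlux hc3.le h2
  rw [map_zero, zero_add, neg_one_smul, ← sub_eq_add_neg] at h3
  by_contra hcon
  rw [not_lt] at hcon
  have h6 : (c - 3 * C) * ε ≤ |k| := (mul_le_mul_of_nonneg_left hcon (by linarith)).trans h3
  have h7 : (c - 3 * C) * ε = ε + |k| := by
    rw [hc]; field_simp; ring
  linarith

/-- Passing from w to r w turns the weighted norm into the L¹ norm of `fluxMeasure`. Integrability
of 1 / r near 0 makes this measure finite on compact sets, so test functions are dense for it. -/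
lemma exists_hasFlux_near (h : Coeffs r a β b m κ η C) (w : XSpace m) {ε : ℝ} (hε : 0 < ε) :
    ∃ (k : ℝ) (u f : XSpace m), HasFlux r a β b k u f ∧ wNorm κ m h.one_le (w - u) ≤ ε := by
  have hν := h.isFiniteMeasureOnCompacts_fluxMeasure
  have hwm : Measurable fun x => r x * w x := h.r_meas.mul (XSpace.measurable w)
  have e1 : ∀ᵐ x ∂(volume.restrict (Ioi (0 : ℝ))), ‖r x * w x / r x‖ₑ = ‖w x‖ₑ := by
    filter_upwards [ae_restrict_mem measurableSet_Ioi] with x hx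
    rw [mul_div_cancel_left₀ _ (h.r_pos x hx).ne']
  have hL : MemLp (fun x => r x * w x) 1 (fluxMeasure r κ m) := by
    refine ⟨hwm.aestronglyMeasurable, lt_top_iff_ne_top.2 ?_⟩
    rw [h.eLpNorm_fluxMeasure hwm, wInt_congr_ae e1]
    exact XSpace.wInt_ne_top w h.one_le
  obtain ⟨φ, hφc, hφ, hφε⟩ := hL.exist_eLpNorm_sub_le ENNReal.one_ne_top le_rfl hε
  obtain ⟨k, u, f, hu, hue⟩ := h.exists_hasFlux_of_smooth hφ hφc
  refine ⟨k, u, f, hu, ?_⟩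
  have hsub : Measurable ((fun x => r x * w x) - φ) := hwm.sub hφ.continuous.measurable
  rw [← ENNReal.ofReal_le_ofReal_iff hε.le, ofReal_wNorm]
  rw [h.eLpNorm_fluxMeasure hsub] at hφε
  refine (wInt_mono_ae ?_).trans hφε
  filter_upwards [hue, XSpace.ae_sub w u, ae_restrict_mem measurableSet_Ioi] with x hx1 hx2 hx0
  rw [hx2, hx1, Pi.sub_apply, sub_div, mul_div_cancel_left₀ _ (h.r_pos x hx0).ne']

/-- The domain of the operator is dense. -/
lemma dense_domain (h : Coeffs r a β b m κ η C) :
    Dense (Prod.fst '' (h.graphSubmodule : Set (XSpace m × XSpace m))) := by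
  refine Metric.dense_iff.2 fun w ε hε => ?_
  obtain ⟨k, u, f, hu, h1⟩ := h.exists_hasFlux_near w (half_pos hε)
  obtain ⟨v, g, hv, h2⟩ := h.exists_mem_domain_near hu (half_pos hε)
  refine ⟨v, ?_, ⟨(v, g), hv, rfl⟩⟩
  rw [Metric.mem_ball, dist_comm, dist_eq_norm]
  refine (norm_le_wNorm h.one_le _).trans_lt ?_
  have h4 : wNorm κ m h.one_le (w - v) ≤ wNorm κ m h.one_le (w - u) +
      wNorm κ m h.one_le (u - v) := by
    rw [← sub_add_sub_cancel w u v]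
    exact map_add_le_add _ _ _
  linarith

theorem isQuasiDissipative (h : Coeffs r a β b m κ η C) :
    IsQuasiDissipative h.graphSubmodule (wNorm κ m h.one_le) (3 * C) κ h.resolvent where
  norm_le := norm_le_wNorm h.one_le
  le_norm := wNorm_le_norm h.one_le
  nonneg := mul_nonneg zero_le_three h.C_nonneg
  mem _ hc f := h.resolvent_mem hc f
  dissip _ hc _ _ hu := h.wNorm_le_of_mem hc.le hu
  dense := h.dense_domain

/-- The resolvent at non-negative data is the minimal solution. -/
lemma exists_minimal_resolvent (h : Coeffs r a β b m κ η C) {c : ℝ} (hc : 3 * C < c)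
    {f : XSpace m} (hf : 0 ≤ f) :
    ∃ U : ℝ → ℝ≥0∞, Measurable U ∧
      U = resolventStep r a β b c (fun x => ENNReal.ofReal (f x)) U ∧
      (∀ᵐ x ∂(volume.restrict (Ioi (0 : ℝ))), 0 ≤ h.resolvent c f x ∧
        U x = ENNReal.ofReal (h.resolvent c f x)) ∧
      ∀ s : Set ℝ, (∀ u, Measurable u → (∀ x ∈ s, u x = 0) →
        ∀ x ∈ s, resolventStep r a β b c (fun x => ENNReal.ofReal (f x)) u x = 0) →
        ∀ x ∈ s, U x = 0 := by
  obtain ⟨u, f', hf', hu, H⟩ := h.exists_resolvent_nonneg hc f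
  have e : f' = f := by
    refine XSpace.ext_ae ?_
    filter_upwards [hf', XSpace.le_iff.1 hf, XSpace.ae_zero (m := m)] with x h1 h2 h3
    rw [h1, max_eq_left (h3 ▸ h2)]
  rw [e] at hu
  rwa [h.eq_of_mem_graphSubmodule hc hu (h.resolvent_mem hc f)] at H

lemma resolvent_nonneg (h : Coeffs r a β b m κ η C) {c : ℝ} (hc : 3 * C < c)
    {f : XSpace m} (hf : 0 ≤ f) : 0 ≤ h.resolvent c f := by
  obtain ⟨U, -, -, hU, -⟩ := h.exists_minimal_resolvent hc hf
  refine XSpace.le_iff.2 ?_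
  filter_upwards [hU, XSpace.ae_zero (m := m)] with x h1 h2
  rw [h2]
  exact h1.1

theorem isPositiveSemigroup (h : Coeffs r a β b m κ η C)
    {S : ℝ≥0 → XSpace m →L[ℝ] XSpace m}
    (hS : IsSemigroupGeneratedBy S (operatorGraph r a β b m)) : IsPositiveSemigroup S := by
  intro t f hf
  have hcl : IsClosed {x : XSpace m | 0 ≤ x} := isClosed_Ici
  refine h.isQuasiDissipative.semigroup_mem_of_resolvent_mem hS (C := {x : XSpace m | 0 ≤ x})
    hcl (le_refl (0 : XSpace m)) (fun x hx y hy => show (0 : XSpace m) ≤ x + y from add_nonneg hx hy)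
    (fun c hc x hx => ?_) (fun c hc x hx => h.resolvent_nonneg hc hx) t hf
  refine XSpace.le_iff.2 ?_
  filter_upwards [XSpace.le_iff.1 hx, XSpace.ae_smul c x, XSpace.ae_zero (m := m)] with y h1 h2 h3
  rw [h3] at h1 ⊢
  rw [h2]
  exact mul_nonneg hc h1

end Coeffs

/-! ### Closed ideals -/

lemma ae_restrict_Ioo_of_forall_lt {p : ℝ → Prop} {z : ℝ}
    (h : ∀ t < z, ∀ᵐ x ∂(volume.restrict (Ioo 0 t)), p x) :
    ∀ᵐ x ∂(volume.restrict (Ioo 0 z)), p x := by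
  obtain ⟨t, -, ht, htz⟩ := exists_seq_strictMono_tendsto z
  have e : Ioo 0 z ⊆ ⋃ n, Ioo 0 (t n) := fun x hx => by
    obtain ⟨n, hn⟩ := (htz.eventually (lt_mem_nhds hx.2)).exists
    exact mem_iUnion.2 ⟨n, hx.1, hn⟩
  exact ae_restrict_of_ae_restrict_of_subset e ((ae_restrict_iUnion_iff _ _).2 fun n => h _ (ht n))

lemma ae_restrict_Ioi_of_forall_gt {p : ℝ → Prop} {z : ℝ}
    (h : ∀ t > z, ∀ᵐ x ∂(volume.restrict (Ioi t)), p x) :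
    ∀ᵐ x ∂(volume.restrict (Ioi z)), p x := by
  obtain ⟨t, -, ht, htz⟩ := exists_seq_strictAnti_tendsto z
  have e : Ioi z ⊆ ⋃ n, Ioi (t n) := fun x hx => by
    obtain ⟨n, hn⟩ := (htz.eventually (gt_mem_nhds hx)).exists
    exact mem_iUnion.2 ⟨n, hn⟩
  exact ae_restrict_of_ae_restrict_of_subset e ((ae_restrict_iUnion_iff _ _).2 fun n => h _ (ht n))

section Ideals

variable {m : ℝ}

lemma XSpace.lintegral_enorm_le (u : XSpace m) (s : Set ℝ) (hs : s ⊆ Ioi 0) :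
    ∫⁻ x in s, ‖u x‖ₑ ≤ ENNReal.ofReal ‖u‖ := by
  rw [XSpace.norm_eq, ENNReal.ofReal_toReal (XSpace.wInt_ne_top u le_rfl)]
  exact (lintegral_mono_set hs).trans (lintegral_le_wInt le_rfl _)

/-- The functions that vanish almost everywhere on `(0, z)`. -/
def tailIdeal (m z : ℝ) : Submodule ℝ (XSpace m) where
  carrier := {u | ∀ᵐ x ∂(volume.restrict (Ioo 0 z)), u x = 0}
  zero_mem' := ae_restrict_of_ae_restrict_of_subset Ioo_subset_Ioi_self XSpace.ae_zero
  add_mem' := fun {u v} hu hv => by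
    filter_upwards [hu, hv, ae_restrict_of_ae_restrict_of_subset Ioo_subset_Ioi_self
      (XSpace.ae_add u v)] with x h1 h2 h3
    rw [h3, h1, h2, add_zero]
  smul_mem' := fun c u hu => by
    filter_upwards [hu, ae_restrict_of_ae_restrict_of_subset Ioo_subset_Ioi_self
      (XSpace.ae_smul c u)] with x h1 h2
    rw [h2, h1, mul_zero]

lemma mem_tailIdeal {z : ℝ} {u : XSpace m} :
    u ∈ tailIdeal m z ↔ ∀ᵐ x ∂(volume.restrict (Ioo 0 z)), u x = 0 := Iff.rfl

lemma isClosed_tailIdeal (m z : ℝ) : IsClosed (tailIdeal m z : Set (XSpace m)) := by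
  refine isClosed_of_closure_subset fun u hu => ?_
  have h1 : ∫⁻ x in Ioo 0 z, ‖u x‖ₑ = 0 := by
    refine le_antisymm (ENNReal.le_of_forall_pos_le_add fun ε hε _ => ?_) bot_le
    obtain ⟨v, hv, huv⟩ := Metric.mem_closure_iff.1 hu ε hε
    rw [zero_add]
    calc ∫⁻ x in Ioo 0 z, ‖u x‖ₑ = ∫⁻ x in Ioo 0 z, ‖(u - v) x‖ₑ := by
          refine lintegral_congr_ae ?_
          filter_upwards [mem_tailIdeal.1 hv, ae_restrict_of_ae_restrict_of_subset
            Ioo_subset_Ioi_self (XSpace.ae_sub u v)] with x h1 h2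
          rw [h2, h1, sub_zero]
      _ ≤ ENNReal.ofReal ‖u - v‖ := XSpace.lintegral_enorm_le _ _ Ioo_subset_Ioi_self
      _ ≤ ENNReal.ofReal ε := ENNReal.ofReal_le_ofReal (by rw [← dist_eq_norm]; exact huv.le)
      _ = ε := ENNReal.ofReal_coe_nnreal
  rw [lintegral_eq_zero_iff (XSpace.measurable u).enorm] at h1
  exact h1.mono fun x hx => by simpa using hx

lemma isLatticeIdeal_tailIdeal (m z : ℝ) : IsLatticeIdeal (tailIdeal m z) := by
  intro f hf g hg
  filter_upwards [mem_tailIdeal.1 hf,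
    ae_restrict_of_ae_restrict_of_subset Ioo_subset_Ioi_self (XSpace.le_iff.1 hg),
    ae_restrict_of_ae_restrict_of_subset Ioo_subset_Ioi_self (XSpace.ae_abs f),
    ae_restrict_of_ae_restrict_of_subset Ioo_subset_Ioi_self (XSpace.ae_abs g)] with x h1 h2 h3 h4
  rw [h3, h4, h1, abs_zero] at h2
  exact abs_nonpos_iff.1 h2

lemma weightMeasure_Ioo_ne_top (hm : 0 ≤ m) (s t : ℝ) : weightMeasure m (Ioo s t) ≠ ⊤ := by
  rw [weightMeasure_eq, withDensity_apply _ measurableSet_Ioo,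
    Measure.restrict_restrict measurableSet_Ioo]
  have h1 : Continuous (wt 1 m) := by
    unfold wt
    exact continuous_const.add (continuous_const.mul (Real.continuous_rpow_const hm))
  have h2 : IntegrableOn (wt 1 m) (Ioo s t ∩ Ioi 0) :=
    h1.integrableOn_Icc.mono_set (inter_subset_left.trans Ioo_subset_Icc_self)
  exact ne_of_lt ((lintegral_mono fun x => Real.ofReal_le_enorm _).trans_lt h2.2)

lemma exists_indicator (hm : 0 ≤ m) (s t : ℝ) : ∃ u : XSpace m,
    ∀ᵐ x ∂(volume.restrict (Ioi (0 : ℝ))), u x = (Ioo s t).indicator (fun _ => (1 : ℝ)) x := by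
  refine ⟨indicatorConstLp 1 measurableSet_Ioo (weightMeasure_Ioo_ne_top hm s t) 1, ?_⟩
  rw [← ae_weightMeasure m]
  exact indicatorConstLp_coeFn

lemma not_ae_restrict_Ioo_of_forall_not {p : ℝ → Prop} {s t : ℝ} (hst : s < t)
    (hp : ∀ x ∈ Ioo s t, ¬ p x) : ¬ ∀ᵐ x ∂(volume.restrict (Ioo s t)), p x := by
  intro h
  have h1 : ∀ᵐ x ∂(volume.restrict (Ioo s t)), False := by
    filter_upwards [h, ae_restrict_mem measurableSet_Ioo] with x hx hx0
    exact hp x hx0 hx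
  rw [eventually_false_iff_eq_bot, ae_eq_bot, Measure.restrict_eq_zero, Real.volume_Ioo] at h1
  simp only [ENNReal.ofReal_eq_zero] at h1
  linarith

lemma tailIdeal_ne_top (hm : 0 ≤ m) {z : ℝ} (hz : 0 < z) : tailIdeal m z ≠ ⊤ := by
  intro h
  obtain ⟨u, hu⟩ := exists_indicator hm 0 z
  have h1 : u ∈ tailIdeal m z := h ▸ Submodule.mem_top
  refine not_ae_restrict_Ioo_of_forall_not (p := fun x => (Ioo 0 z).indicator (fun _ => (1 : ℝ)) x = 0)
    hz (fun x hx => by simp [hx.1, hx.2]) ?_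
  filter_upwards [mem_tailIdeal.1 h1,
    ae_restrict_of_ae_restrict_of_subset Ioo_subset_Ioi_self hu] with x h2 h3
  rw [← h3, h2]

lemma tailIdeal_ne_bot (hm : 0 ≤ m) {z : ℝ} (hz : 0 < z) : tailIdeal m z ≠ ⊥ := by
  intro h
  obtain ⟨u, hu⟩ := exists_indicator hm z (z + 1)
  have h1 : u ∈ tailIdeal m z := by
    filter_upwards [ae_restrict_of_ae_restrict_of_subset Ioo_subset_Ioi_self hu,
      ae_restrict_mem measurableSet_Ioo] with x hx hx0
    rw [hx, indicator_of_notMem]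
    exact fun hx1 => lt_asymm hx1.1 hx0.2
  rw [h, Submodule.mem_bot] at h1
  refine not_ae_restrict_Ioo_of_forall_not
    (p := fun x => (Ioo z (z + 1)).indicator (fun _ => (1 : ℝ)) x = 0)
    (lt_add_one z) (fun x hx => by simp [hx.1, hx.2]) ?_
  have hs : Ioo z (z + 1) ⊆ Ioi 0 := fun x hx => hz.trans hx.1
  filter_upwards [ae_restrict_of_ae_restrict_of_subset hs hu,
    ae_restrict_of_ae_restrict_of_subset hs (XSpace.ae_zero (m := m))] with x h2 h3
  rw [← h2, h1, h3]

/-- A closed subspace contains `g` if it contains the restrictions of `g` to an exhausting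
sequence of sets. -/
lemma mem_of_indicator_mem {I : Submodule ℝ (XSpace m)} (hI : IsClosed (I : Set (XSpace m)))
    {g : XSpace m} {s : ℕ → Set ℝ} (hs : ∀ n, MeasurableSet (s n))
    (hse : ∀ᵐ x ∂(weightMeasure m), ∀ᶠ n in atTop, x ∈ s n)
    (hmem : ∀ n, ((Lp.memLp g).indicator (hs n)).toLp _ ∈ I) : g ∈ I := by
  refine hI.mem_of_tendsto (b := atTop) (f := fun n => ((Lp.memLp g).indicator (hs n)).toLp _) ?_
    (Eventually.of_forall hmem)
  rw [Lp.tendsto_Lp_iff_tendsto_eLpNorm']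
  have e : ∀ n, eLpNorm (((Lp.memLp g).indicator (hs n)).toLp _ - g : ℝ → ℝ) 1 (weightMeasure m) =
      ∫⁻ x, (s n)ᶜ.indicator (fun x => ‖g x‖ₑ) x ∂(weightMeasure m) := by
    intro n
    rw [eLpNorm_one_eq_lintegral_enorm]
    refine lintegral_congr_ae ?_
    filter_upwards [((Lp.memLp g).indicator (hs n)).coeFn_toLp] with x hx
    rw [Pi.sub_apply, hx]
    by_cases hxs : x ∈ s n <;> simp [hxs]
  simp only [e]
  have h0 : (0 : ℝ≥0∞) = ∫⁻ _, 0 ∂(weightMeasure m) := by simp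
  rw [h0]
  refine tendsto_lintegral_of_dominated_convergence (fun x => ‖g x‖ₑ)
    (fun n => (XSpace.measurable g).enorm.indicator (hs n).compl)
    (fun n => Eventually.of_forall fun x => indicator_le_self _ _ _) ?_ ?_
  · rw [← eLpNorm_one_eq_lintegral_enorm]
    exact (Lp.memLp g).2.ne
  · filter_upwards [hse] with x hx
    refine tendsto_const_nhds.congr' ?_
    filter_upwards [hx] with n hn
    simp [hn]

/-- A closed ideal contains the restriction of any function to the set where a member of the ideal
is positive. -/
lemma tailIdeal_le_of_pos {I : Submodule ℝ (XSpace m)} (hI : IsClosed (I : Set (XSpace m)))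
    (hid : IsLatticeIdeal I) {u : XSpace m} (hu : u ∈ I)
    (hu0 : ∀ᵐ x ∂(volume.restrict (Ioi (0 : ℝ))), 0 ≤ u x) {z : ℝ}
    (huz : ∀ᵐ x ∂(volume.restrict (Ioi (0 : ℝ))), z ≤ x → 0 < u x) : tailIdeal m z ≤ I := by
  intro g hg
  -- On {|g| ≤ n u} the restriction of g is dominated by n u ∈ I. These sets exhaust (0, ∞) up to a
  -- null set, as g = 0 below z and u > 0 from z on.
  have hs : ∀ n : ℕ, MeasurableSet {x | |g x| ≤ n * u x} := fun n =>
    measurableSet_le (XSpace.measurable g).abs ((XSpace.measurable u).const_mul _)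
  refine mem_of_indicator_mem hI hs ?_ fun n => ?_
  · rw [ae_weightMeasure]
    have hg' := (ae_restrict_iff' measurableSet_Ioo).1 (mem_tailIdeal.1 hg)
    filter_upwards [hu0, huz, ae_restrict_of_ae hg', ae_restrict_mem measurableSet_Ioi]
      with x h1 h2 h3 h4
    rcases lt_or_ge x z with hxz | hxz
    · refine Eventually.of_forall fun n => ?_
      rw [h3 ⟨h4, hxz⟩, abs_zero]
      positivity
    · obtain ⟨N, hN⟩ := exists_nat_ge (|g x| / u x)
      filter_upwards [eventually_ge_atTop N] with n hn
      rw [← div_le_iff₀ (h2 hxz)]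
      exact hN.trans (by exact_mod_cast hn)
  · refine hid ((n : ℝ) • u) (I.smul_mem _ hu) _ ?_
    rw [XSpace.le_iff]
    filter_upwards [XSpace.ae_toLp ((Lp.memLp g).indicator (hs n)),
      XSpace.ae_abs (((Lp.memLp g).indicator (hs n)).toLp _), XSpace.ae_abs ((n : ℝ) • u),
      XSpace.ae_smul (n : ℝ) u, hu0] with x h1 h2 h3 h4 h5
    rw [h2, h3, h1, h4, abs_of_nonneg (mul_nonneg n.cast_nonneg h5)]
    by_cases hx : x ∈ {x | |g x| ≤ n * u x}
    · rw [indicator_of_mem hx]; exact hx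
    · rw [indicator_of_notMem hx, abs_zero]; positivity

/-- Every function is the limit of its restrictions to (1 / (n + 1), ∞). -/
lemma eq_top_of_tailIdeal_le {I : Submodule ℝ (XSpace m)} (hI : IsClosed (I : Set (XSpace m)))
    (h : ∀ z, 0 < z → tailIdeal m z ≤ I) : I = ⊤ := by
  refine Submodule.eq_top_iff'.2 fun g => ?_
  refine mem_of_indicator_mem hI (s := fun n : ℕ => Ioi (1 / ((n : ℝ) + 1)))
    (fun n => measurableSet_Ioi) ?_ fun n => ?_
  · rw [ae_weightMeasure]
    filter_upwards [ae_restrict_mem measurableSet_Ioi] with x hx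
    exact tendsto_one_div_add_atTop_nhds_zero_nat.eventually (gt_mem_nhds (mem_Ioi.1 hx))
  · refine h (1 / ((n : ℝ) + 1)) (by positivity) ?_
    rw [mem_tailIdeal]
    filter_upwards [ae_restrict_of_ae_restrict_of_subset Ioo_subset_Ioi_self
      (XSpace.ae_toLp ((Lp.memLp g).indicator measurableSet_Ioi)),
      ae_restrict_mem measurableSet_Ioo] with x hx hx0
    rw [hx, indicator_of_notMem]
    exact not_lt.2 hx0.2.le

end Ideals

/-! ### Traps and invariant ideals -/

namespace Coeffs

variable {r a β : ℝ → ℝ} {b : ℝ → ℝ → ℝ} {m κ η C : ℝ}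

/-- Tonelli: the integral of the gain over (0, z) is a double integral of a non-negative function,
and reading its vanishing in the other order gives a condition for almost every mother size y. -/
lemma ae_gainE_eq_zero_iff (h : Coeffs r a β b m κ η C) {u : ℝ → ℝ≥0∞} (hu : Measurable u)
    (z : ℝ) : (∀ᵐ x ∂(volume.restrict (Ioo 0 z)), gainE a b u x = 0) ↔
      ∀ᵐ y ∂(volume.restrict (Ioi (0 : ℝ))), ∀ᵐ x ∂(volume.restrict (Ioo 0 y)),
        x < z → u y ≠ 0 → a y ≠ 0 → b x y = 0 := by
  have hm1 : Measurable (Function.uncurry fun x y => ENNReal.ofReal (a y * b x y) * u y) :=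
    ((h.a_meas.comp measurable_snd).mul h.b_meas).ennreal_ofReal.mul (hu.comp measurable_snd)
  have hS : MeasurableSet {p : ℝ × ℝ | p.1 < z} := measurableSet_lt measurable_fst measurable_const
  have hm2 := hm1.indicator hS
  set F : ℝ → ℝ → ℝ≥0∞ := fun x y => {p : ℝ × ℝ | p.1 < z}.indicator
    (Function.uncurry fun x y => ENNReal.ofReal (a y * b x y) * u y) (x, y) with hF
  have hFm : Measurable (Function.uncurry F) := hm2
  have e1 : ∫⁻ x in Ioi (0 : ℝ), ∫⁻ y in Ioi x, F x y = ∫⁻ x in Ioo 0 z, gainE a b u x := by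
    have : Ioo 0 z = Iio z ∩ Ioi 0 := by ext x; simp [and_comm]
    rw [this, ← setLIntegral_indicator measurableSet_Iio]
    refine lintegral_congr fun x => ?_
    by_cases hx : x < z
    · simp [hF, hx, gainE]
    · simp [hF, hx]
  have hFm2 : Measurable fun y => ∫⁻ x in Ioo 0 y, F x y := by
    have hS : MeasurableSet {p : ℝ × ℝ | 0 < p.2 ∧ p.2 < p.1} :=
      (measurableSet_lt measurable_const measurable_snd).inter
        (measurableSet_lt measurable_snd measurable_fst)
    have h1 := ((hFm.comp measurable_swap).indicator hS).lintegral_prod_right' (ν := volume)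
    convert h1 using 2 with y
    rw [← lintegral_indicator measurableSet_Ioo]
    rfl
  have e2 := lintegral_triangle hFm
  rw [e1] at e2
  have e3 : (∀ᵐ x ∂(volume.restrict (Ioo 0 z)), gainE a b u x = 0) ↔
      ∫⁻ x in Ioo 0 z, gainE a b u x = 0 := by
    rw [lintegral_eq_zero_iff (h.measurable_gainE hu)]; rfl
  rw [e3, e2, lintegral_eq_zero_iff hFm2]
  refine eventually_congr ?_
  filter_upwards [ae_restrict_mem measurableSet_Ioi] with y hy
  have hFy : Measurable fun x => F x y := hFm.comp measurable_prodMk_right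
  rw [Pi.zero_apply, lintegral_eq_zero_iff hFy]
  refine eventually_congr ?_
  filter_upwards [ae_restrict_mem measurableSet_Ioo] with x hx
  have ha := h.a_nonneg y hy
  have hb := h.b_nonneg x y hx.1 hy
  by_cases hxz : x < z
  · simp only [hF, indicator, mem_ofPred_eq, hxz, if_true, Function.uncurry, Pi.zero_apply,
      mul_eq_zero, ENNReal.ofReal_eq_zero, true_imp_iff]
    constructor
    · rintro (h1 | h1) h2 h3
      · exact (mul_eq_zero.1 (le_antisymm h1 (mul_nonneg ha hb))).resolve_left h3
      · exact absurd h1 h2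
    · intro h1
      by_cases h2 : u y = 0
      · exact Or.inr h2
      · by_cases h3 : a y = 0
        · left; simp [h3]
        · left; simp [h1 h2 h3]
  · simp [hF, hxz]

/-- The condition for the functions that vanish on `(0, z)` to form an invariant ideal. -/
def IsTrap (a β : ℝ → ℝ) (b : ℝ → ℝ → ℝ) (z : ℝ) : Prop :=
  (∀ᵐ y ∂(volume.restrict (Ioi z)), a y ≠ 0 → ∀ᵐ x ∂(volume.restrict (Ioo 0 z)), b x y = 0) ∧
    ∀ᵐ y ∂(volume.restrict (Ioi z)), β y = 0

variable {z : ℝ}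

/-- Mothers below z are absent because u vanishes there; mothers above z have no fragments below z
by the trap condition; y = z is negligible. -/
lemma ae_gainE_eq_zero_of_isTrap (h : Coeffs r a β b m κ η C)
    (ht : IsTrap a β b z) {u : ℝ → ℝ≥0∞} (hu : Measurable u) (hu0 : ∀ x ∈ Ioo 0 z, u x = 0) :
    ∀ᵐ x ∂(volume.restrict (Ioo 0 z)), gainE a b u x = 0 := by
  rw [h.ae_gainE_eq_zero_iff hu]
  have h1 := (ae_restrict_iff' measurableSet_Ioi).1 ht.1
  filter_upwards [ae_restrict_of_ae h1, ae_restrict_mem measurableSet_Ioi,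
    ae_restrict_of_ae (Measure.ae_ne volume z)] with y hy hy0 hyz
  rcases lt_or_gt_of_ne hyz with hlt | hgt
  · exact Eventually.of_forall fun x _ h2 => absurd (hu0 y ⟨hy0, hlt⟩) h2
  · by_cases ha : a y = 0
    · exact Eventually.of_forall fun x _ _ h3 => absurd ha h3
    · have h2 := (ae_restrict_iff' measurableSet_Ioo).1 (hy hgt ha)
      filter_upwards [ae_restrict_of_ae h2, ae_restrict_mem measurableSet_Ioo] with x hx hx0 hxz _ _
      exact hx ⟨hx0.1, hxz⟩

/-- Vanishing on (0, z) is preserved by one iteration step: the trap kills births and gain, and the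
solution at x only sees sources in (0, x]. The minimal solution inherits it. -/
lemma resolvent_mem_tailIdeal_of_nonneg (h : Coeffs r a β b m κ η C) (ht : IsTrap a β b z) {c : ℝ} (hc : 3 * C < c) {f : XSpace m} (hf0 : 0 ≤ f)
    (hf : f ∈ tailIdeal m z) : h.resolvent c f ∈ tailIdeal m z := by
  obtain ⟨U, -, -, hU, hv⟩ := h.exists_minimal_resolvent hc hf0
  have hU0 : ∀ x ∈ Ioo 0 z, U x = 0 := by
    refine hv _ fun u hu hu0 x hx => ?_
    have hb : birthE β u = 0 := by
      refine lintegral_eq_zero_of_ae_eq_zero ?_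
      have h1 := (ae_restrict_iff' measurableSet_Ioi).1 ht.2
      filter_upwards [ae_restrict_of_ae h1, ae_restrict_mem measurableSet_Ioi,
        ae_restrict_of_ae (Measure.ae_ne volume z)] with y hy hy0 hyz
      rcases lt_or_gt_of_ne hyz with hlt | hgt
      · simp [hu0 y ⟨hy0, hlt⟩]
      · simp [hy hgt]
    have hsub : Ioc 0 x ⊆ Ioo 0 z := fun s hs => ⟨hs.1, hs.2.trans_lt hx.2⟩
    have hi : ∫⁻ s in Ioc 0 x, ENNReal.ofReal (Real.exp (absorb r a c s)) *
        (ENNReal.ofReal (f s) + gainE a b u s) = 0 := by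
      refine lintegral_eq_zero_of_ae_eq_zero ?_
      filter_upwards [ae_restrict_of_ae_restrict_of_subset hsub (mem_tailIdeal.1 hf),
        ae_restrict_of_ae_restrict_of_subset hsub
          (h.ae_gainE_eq_zero_of_isTrap ht hu hu0)] with s h1 h2
      simp [h1, h2]
    rw [resolventStep, transportSol, hb, hi, add_zero, mul_zero]
  rw [mem_tailIdeal]
  filter_upwards [ae_restrict_of_ae_restrict_of_subset Ioo_subset_Ioi_self hU,
    ae_restrict_mem measurableSet_Ioo] with x hx hx0
  have h1 := hx.2
  rw [hU0 x hx0, eq_comm, ENNReal.ofReal_eq_zero] at h1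
  exact le_antisymm h1 hx.1

/-- Reduces to non-negative data by f = |f| - (|f| - f), both terms being non-negative members of
the ideal. -/
lemma resolvent_mem_tailIdeal (h : Coeffs r a β b m κ η C) (ht : IsTrap a β b z) {c : ℝ} (hc : 3 * C < c) {f : XSpace m}
    (hf : f ∈ tailIdeal m z) : h.resolvent c f ∈ tailIdeal m z := by
  have h1 : |f| ∈ tailIdeal m z := isLatticeIdeal_tailIdeal m z f hf _ (by rw [abs_abs])
  have h2 := h.resolvent_mem_tailIdeal_of_nonneg ht hc (abs_nonneg f) h1
  have h3 := h.resolvent_mem_tailIdeal_of_nonneg ht hc (f := |f| - f)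
    (sub_nonneg.2 (le_abs_self f)) (Submodule.sub_mem _ h1 hf)
  rw [map_sub] at h3
  simpa using Submodule.sub_mem _ h2 h3

lemma not_isIrreducibleSemigroup_of_isTrap (h : Coeffs r a β b m κ η C)
    {S : ℝ≥0 → XSpace m →L[ℝ] XSpace m}
    (hS : IsSemigroupGeneratedBy S (operatorGraph r a β b m)) (hz : 0 < z)
    (ht : IsTrap a β b z) : ¬ IsIrreducibleSemigroup S := by
  intro hirr
  have hm : 0 ≤ m := (zero_lt_one.trans h.one_lt).le
  rcases hirr (tailIdeal m z) (isClosed_tailIdeal m z) (isLatticeIdeal_tailIdeal m z)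
    (fun t f hf => h.isQuasiDissipative.semigroup_mem_of_resolvent_mem hS
      (isClosed_tailIdeal m z) (Submodule.zero_mem _) (fun x hx y hy => Submodule.add_mem _ hx hy)
      (fun c _ x hx => Submodule.smul_mem _ c hx)
      (fun c hc x hx => h.resolvent_mem_tailIdeal ht hc hx) t hf) with h1 | h1
  · exact tailIdeal_ne_bot hm hz h1
  · exact tailIdeal_ne_top hm hz h1

/-- The solution of the resolvent equation is positive to the right of the support of the data. -/
lemma resolventStep_ne_zero (h : Coeffs r a β b m κ η C) {c y x : ℝ} {f : XSpace m} (hf : 0 ≤ f)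
    (hfy : f ∉ tailIdeal m y) (u : ℝ → ℝ≥0∞) (hx : 0 < x) (hyx : y ≤ x) :
    resolventStep r a β b c (fun x => ENNReal.ofReal (f x)) u x ≠ 0 := by
  rw [resolventStep, transportSol]
  -- The exponential prefactor is positive, and the integral over (0, x] already collects the mass
  -- of f below y: growth carries it to every x ≥ y.
  refine mul_ne_zero ?_ fun h0 => hfy ?_
  · rw [Ne, ENNReal.ofReal_eq_zero, not_le]
    exact div_pos (Real.exp_pos _) (h.r_pos x hx)
  · have h1 := (add_eq_zero.1 h0).2
    have hsub : Ioo 0 y ⊆ Ioc 0 x := fun s hs => ⟨hs.1, hs.2.le.trans hyx⟩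
    have hm : Measurable fun s => ENNReal.ofReal (Real.exp (absorb r a c s)) *
        ENNReal.ofReal (f s) :=
      (h.measurable_absorb c).exp.ennreal_ofReal.mul (XSpace.measurable f).ennreal_ofReal
    have h2 : ∫⁻ s in Ioo 0 y, ENNReal.ofReal (Real.exp (absorb r a c s)) *
        ENNReal.ofReal (f s) = 0 := by
      refine le_antisymm (le_trans ?_ h1.le) bot_le
      exact (lintegral_mono_set hsub).trans
        (lintegral_mono fun s => mul_le_mul_right le_self_add _)
    rw [lintegral_eq_zero_iff hm] at h2
    rw [mem_tailIdeal]
    filter_upwards [h2, ae_restrict_of_ae_restrict_of_subset Ioo_subset_Ioi_self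
        (XSpace.le_iff.1 hf), ae_restrict_of_ae_restrict_of_subset Ioo_subset_Ioi_self
        (XSpace.ae_zero (m := m))] with s h3 h4 h5
    rw [Pi.zero_apply, mul_eq_zero, ENNReal.ofReal_eq_zero, ENNReal.ofReal_eq_zero] at h3
    exact le_antisymm (h3.resolve_left (not_le.2 (Real.exp_pos _))) (h5 ▸ h4)

/-- If the solution of the resolvent equation vanishes on `(0, z)` and is positive on `(y, ∞)`,
then there are no births from `(y, ∞)` and no fragments in `(0, z)` from `(y, ∞)`. -/
lemma eq_zero_of_resolventStep_eq_zero (h : Coeffs r a β b m κ η C) {c y : ℝ} (hz : 0 < z)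
    (hy : 0 ≤ y) (hzy : z ≤ y)
    {f U : ℝ → ℝ≥0∞} (hf : Measurable f) (hU : Measurable U) (hUy : ∀ x, y < x → U x ≠ 0)
    (h0 : ∀ᵐ x ∂(volume.restrict (Ioo 0 z)), resolventStep r a β b c f U x = 0) :
    (∀ᵐ y ∂(volume.restrict (Ioi y)), a y ≠ 0 →
      ∀ᵐ x ∂(volume.restrict (Ioo 0 z)), b x y = 0) ∧
      ∀ᵐ y ∂(volume.restrict (Ioi y)), β y = 0 := by
  -- A single zero of the solution at some x in (t, z) suffices: the prefactor is positive, so both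
  -- the births and the integral of all sources over (0, x] must be zero.
  have key : ∀ t < z, 0 ≤ t → birthE β U = 0 ∧
      ∀ᵐ x ∂(volume.restrict (Ioo 0 t)), gainE a b U x = 0 := by
    intro t ht ht0
    have h1 : ∃ x ∈ Ioo t z, resolventStep r a β b c f U x = 0 := by
      by_contra hcon
      push Not at hcon
      exact not_ae_restrict_Ioo_of_forall_not ht hcon
        (ae_restrict_of_ae_restrict_of_subset (Ioo_subset_Ioo_left ht0) h0)
    obtain ⟨x, hx, hx0⟩ := h1
    have hx1 : 0 < x := ht0.trans_lt hx.1
    rw [resolventStep, transportSol, mul_eq_zero, ENNReal.ofReal_eq_zero] at hx0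
    have h2 := add_eq_zero.1 (hx0.resolve_left
      (not_le.2 (div_pos (Real.exp_pos _) (h.r_pos x hx1))))
    refine ⟨h2.1, ?_⟩
    have hm : Measurable fun s => ENNReal.ofReal (Real.exp (absorb r a c s)) *
        (f s + gainE a b U s) :=
      (h.measurable_absorb c).exp.ennreal_ofReal.mul (hf.add (h.measurable_gainE hU))
    have h3 := (lintegral_eq_zero_iff hm).1 h2.2
    have hsub : Ioo 0 t ⊆ Ioc 0 x := fun s hs => ⟨hs.1, (hs.2.trans hx.1).le⟩
    filter_upwards [ae_restrict_of_ae_restrict_of_subset hsub h3] with s hs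
    rw [Pi.zero_apply, mul_eq_zero, ENNReal.ofReal_eq_zero] at hs
    exact (add_eq_zero.1 (hs.resolve_left (not_le.2 (Real.exp_pos _)))).2
  have hg : ∀ᵐ x ∂(volume.restrict (Ioo 0 z)), gainE a b U x = 0 := by
    refine ae_restrict_Ioo_of_forall_lt fun t ht => ?_
    rcases le_or_gt 0 t with h0 | h0
    · exact (key t ht h0).2
    · rw [Ioo_eq_empty (by linarith)]; simp
  have hsub : Ioi y ⊆ Ioi 0 := Ioi_subset_Ioi hy
  constructor
  · rw [h.ae_gainE_eq_zero_iff hU] at hg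
    filter_upwards [ae_restrict_of_ae_restrict_of_subset hsub hg,
      ae_restrict_mem measurableSet_Ioi] with w hw hwy haw
    have h4 : Ioo 0 z ⊆ Ioo 0 w := Ioo_subset_Ioo_right (hzy.trans (mem_Ioi.1 hwy).le)
    filter_upwards [ae_restrict_of_ae_restrict_of_subset h4 hw, ae_restrict_mem measurableSet_Ioo]
      with x hx hx0
    exact hx hx0.2 (hUy w hwy) haw
  · have hb := (key 0 hz le_rfl).1
    have hm : Measurable fun y => ENNReal.ofReal (β y) * U y := h.β_meas.ennreal_ofReal.mul hU
    rw [birthE, lintegral_eq_zero_iff hm] at hb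
    filter_upwards [ae_restrict_of_ae_restrict_of_subset hsub hb,
      ae_restrict_mem measurableSet_Ioi] with w hw hwy
    rw [Pi.zero_apply, mul_eq_zero, ENNReal.ofReal_eq_zero] at hw
    exact le_antisymm (hw.resolve_right (hUy w hwy)) (h.β_nonneg w (hsub hwy))

/-- Take a nontrivial invariant closed ideal and let z be the infimum of the sizes y such that some
member does not vanish on (0, y). Resolvents of suitable non-negative members are positive on [y, ∞)
for y arbitrarily close to z. If z = 0, the ideal contains every function; if z > 0, all members
vanish on (0, z), which forces the trap at z. -/
lemma exists_isTrap (h : Coeffs r a β b m κ η C) {S : ℝ≥0 → XSpace m →L[ℝ] XSpace m}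
    (hS : IsSemigroupGeneratedBy S (operatorGraph r a β b m)) (hirr : ¬ IsIrreducibleSemigroup S) :
    ∃ z, 0 < z ∧ IsTrap a β b z := by
  unfold IsIrreducibleSemigroup at hirr
  push Not at hirr
  obtain ⟨I, hI, hid, hinv, hbot, htop⟩ := hirr
  have hC := h.C_nonneg
  -- The dissipativity constant is γ = 3C, and invariance passes from the semigroup to the resolvent
  -- only for c > 2γ.
  set c : ℝ := 2 * (3 * C) + 1 with hc
  have hc3 : 3 * C < c := by linarith
  have hR : ∀ f ∈ I, h.resolvent c f ∈ I := fun f hf =>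
    h.isQuasiDissipative.resolvent_mem_of_semigroup_mem hS hI hinv (by linarith) hf
  set A : Set ℝ := {y | 0 < y ∧ ¬ I ≤ tailIdeal m y} with hA
  have hAne : A.Nonempty := by
    by_contra hcon
    rw [not_nonempty_iff_eq_empty] at hcon
    refine hbot (eq_bot_iff.2 fun f hf => ?_)
    rw [Submodule.mem_bot]
    refine XSpace.ext_ae ?_
    have h1 : ∀ n : ℕ, ∀ᵐ x ∂(volume.restrict (Ioo 0 ((n : ℝ) + 1))), f x = 0 := fun n => by
      have h2 : (n : ℝ) + 1 ∉ A := by rw [hcon]; exact notMem_empty _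
      have h3 : I ≤ tailIdeal m ((n : ℝ) + 1) := by
        by_contra h4
        exact h2 ⟨by positivity, h4⟩
      exact h3 hf
    have h2 : Ioi (0 : ℝ) ⊆ ⋃ n : ℕ, Ioo 0 ((n : ℝ) + 1) := fun x hx => by
      obtain ⟨n, hn⟩ := exists_nat_gt x
      exact mem_iUnion.2 ⟨n, hx, by linarith⟩
    filter_upwards [ae_restrict_of_ae_restrict_of_subset h2 ((ae_restrict_iUnion_iff _ _).2 h1),
      XSpace.ae_zero (m := m)] with x h3 h4
    rw [h3, h4]
  have hAbdd : BddBelow A := ⟨0, fun y hy => hy.1.le⟩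
  have hsol : ∀ y ∈ A, ∃ f ∈ I, 0 ≤ f ∧ ∃ U : ℝ → ℝ≥0∞, Measurable U ∧
      U = resolventStep r a β b c (fun x => ENNReal.ofReal (f x)) U ∧
      (∀ᵐ x ∂(volume.restrict (Ioi (0 : ℝ))), 0 ≤ h.resolvent c f x ∧
        U x = ENNReal.ofReal (h.resolvent c f x)) ∧ ∀ x, y ≤ x → U x ≠ 0 := by
    rintro y ⟨hy0, hy⟩
    obtain ⟨f, hf, hfy⟩ := SetLike.not_le_iff_exists.1 hy
    have hfI : |f| ∈ I := hid f hf _ (by rw [abs_abs])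
    obtain ⟨U, hUm, hUeq, hUu, -⟩ := h.exists_minimal_resolvent hc3 (abs_nonneg f)
    refine ⟨|f|, hfI, abs_nonneg f, U, hUm, hUeq, hUu, fun x hx => ?_⟩
    rw [hUeq]
    refine h.resolventStep_ne_zero (abs_nonneg f) (fun h1 => hfy ?_) U (hy0.trans_le hx) hx
    exact isLatticeIdeal_tailIdeal m y |f| h1 f (by rw [abs_abs])
  set z := sInf A with hz
  have hz0 : 0 ≤ z := le_csInf hAne fun y hy => hy.1.le
  have hIz : I ≤ tailIdeal m z := fun f hf => by
    refine ae_restrict_Ioo_of_forall_lt fun t ht => ?_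
    rcases le_or_gt t 0 with h0 | h0
    · rw [Ioo_eq_empty (by linarith)]; simp
    · by_contra hcon
      exact notMem_of_lt_csInf ht hAbdd ⟨h0, fun h1 => hcon (h1 hf)⟩
  have hgt : ∀ t > z, ∃ y ∈ A, y < t := fun t ht => exists_lt_of_csInf_lt hAne ht
  rcases hz0.eq_or_lt with h0 | h0
  · refine absurd (eq_top_of_tailIdeal_le hI fun t ht => ?_) htop
    obtain ⟨y, hy, hyt⟩ := hgt t (h0 ▸ ht)
    obtain ⟨f, hf, -, U, -, -, hUu, hU⟩ := hsol y hy
    refine tailIdeal_le_of_pos hI hid (hR f hf) (hUu.mono fun x hx => hx.1) ?_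
    filter_upwards [hUu] with x hx hxt
    have h1 := hU x (hyt.le.trans hxt)
    rw [hx.2, Ne, ENNReal.ofReal_eq_zero, not_le] at h1
    exact h1
  · have key : ∀ t > z, (∀ᵐ y ∂(volume.restrict (Ioi t)), a y ≠ 0 →
        ∀ᵐ x ∂(volume.restrict (Ioo 0 z)), b x y = 0) ∧
        ∀ᵐ y ∂(volume.restrict (Ioi t)), β y = 0 := by
      intro t ht
      obtain ⟨y, hy, hyt⟩ := hgt t ht
      obtain ⟨f, hf, -, U, hUm, hUeq, hUu, hU⟩ := hsol y hy
      refine h.eq_zero_of_resolventStep_eq_zero h0 (hz0.trans ht.le) ht.le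
        (XSpace.measurable f).ennreal_ofReal hUm (fun x hx => hU x (hyt.trans hx).le) (c := c) ?_
      rw [← hUeq]
      filter_upwards [ae_restrict_of_ae_restrict_of_subset Ioo_subset_Ioi_self hUu,
        mem_tailIdeal.1 (hIz (hR f hf))] with x h1 h2
      rw [h1.2, h2, ENNReal.ofReal_zero]
    exact ⟨z, h0, ae_restrict_Ioi_of_forall_gt fun t ht => (key t ht).1,
      ae_restrict_Ioi_of_forall_gt fun t ht => (key t ht).2⟩

theorem isIrreducibleSemigroup_iff (h : Coeffs r a β b m κ η C)
    {S : ℝ≥0 → XSpace m →L[ℝ] XSpace m}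
    (hS : IsSemigroupGeneratedBy S (operatorGraph r a β b m)) :
    IsIrreducibleSemigroup S ↔ ∀ z, 0 < z → ¬ IsTrap a β b z := by
  refine ⟨fun hirr z hz ht => h.not_isIrreducibleSemigroup_of_isTrap hS hz ht hirr, fun H => ?_⟩
  by_contra hirr
  obtain ⟨z, hz, ht⟩ := h.exists_isTrap hS hirr
  exact H z hz ht

end Coeffs

/-! ### Essential supports -/

lemma nonneg_of_mem_essSupport {f : ℝ → ℝ} {x : ℝ} (hx : x ∈ essSupport f) : 0 ≤ x := by
  by_contra h
  refine hx (Iio 0) (Iio_mem_nhds (not_le.1 h)) ?_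
  have : Iio (0 : ℝ) ∩ Ioi 0 = ∅ := by
    ext y
    simpa using fun h => le_of_lt h
  simp [this]

lemma notMem_essSupport {f : ℝ → ℝ} {O : Set ℝ} (hO : IsOpen O)
    (h : ∀ᵐ y ∂(volume.restrict (O ∩ Ioi 0)), f y = 0) {x : ℝ} (hx : x ∈ O) : x ∉ essSupport f :=
  fun hx' => hx' O (hO.mem_nhds hx) h

/-- Each point outside the essential support has a neighbourhood on which f is null; second
countability patches them together. -/
lemma ae_eq_zero_of_forall_notMem {f : ℝ → ℝ} (hf : Measurable f) {s : Set ℝ}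
    (h : ∀ x ∈ s, x ∉ essSupport f) : ∀ᵐ y ∂(volume.restrict (Ioi (0 : ℝ))), y ∈ s → f y = 0 := by
  rw [ae_iff]
  refine measure_null_of_locally_null _ fun x hx => ?_
  simp only [Classical.not_imp, mem_ofPred_eq] at hx
  have h1 := h x hx.1
  simp only [essSupport, mem_ofPred_eq, not_forall, not_not] at h1
  obtain ⟨U, hU, hUf⟩ := h1
  refine ⟨{y | ¬ (y ∈ s → f y = 0)} ∩ U, inter_mem self_mem_nhdsWithin
    (mem_nhdsWithin_of_mem_nhds hU), ?_⟩
  have hm : MeasurableSet {y | ¬ f y = 0} := (hf (measurableSet_singleton 0)).compl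
  rw [ae_iff, Measure.restrict_apply hm] at hUf
  rw [Measure.restrict_apply' measurableSet_Ioi]
  refine measure_mono_null (fun y hy => ?_) hUf
  obtain ⟨⟨hy1, hy2⟩, hy3⟩ := hy
  simp only [Classical.not_imp, mem_ofPred_eq] at hy1
  exact ⟨hy1.2, hy2, hy3⟩

lemma supSupp_le_iff {f : ℝ → ℝ} (hf : Measurable f) {z : ℝ} (hz : 0 ≤ z) :
    supSupp f ≤ z ↔ ∀ᵐ y ∂(volume.restrict (Ioi z)), f y = 0 := by
  have e : Ioi z ∩ Ioi 0 = Ioi z := inter_eq_left.2 (Ioi_subset_Ioi hz)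
  rw [supSupp, iSup₂_le_iff]
  constructor
  · intro h
    have h1 := ae_eq_zero_of_forall_notMem hf (s := Ioi z)
      fun x hx hx' => not_lt.2 (EReal.coe_le_coe_iff.1 (h x hx')) hx
    filter_upwards [ae_restrict_of_ae_restrict_of_subset (Ioi_subset_Ioi hz) h1,
      ae_restrict_mem measurableSet_Ioi] with x hx hx0
    exact hx hx0
  · intro h x hx
    rw [EReal.coe_le_coe_iff]
    by_contra hcon
    rw [← e] at h
    exact notMem_essSupport isOpen_Ioi h (not_le.1 hcon) hx

/-! ### The smallest daughter particle -/

section Daughter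

variable {a : ℝ → ℝ} {b : ℝ → ℝ → ℝ}

/-- A kernel vanishing almost everywhere would carry no mass. Hence the real infimum in
`minDaughter` is a genuine one and not the default value of `sInf ∅`. -/
lemma essSupport_nonempty {y : ℝ} (hy : 0 < y) (hb : Measurable fun x => b x y)
    (hmass : fragMoment b 1 y = ENNReal.ofReal y) : (essSupport fun x => b x y).Nonempty := by
  by_contra h
  rw [not_nonempty_iff_eq_empty] at h
  have h1 := ae_eq_zero_of_forall_notMem hb (s := univ) fun x _ => by rw [h]; exact notMem_empty x
  have h2 : fragMoment b 1 y = 0 := by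
    refine lintegral_eq_zero_of_ae_eq_zero ?_
    filter_upwards [ae_restrict_of_ae_restrict_of_subset Ioc_subset_Ioi_self h1] with x hx
    simp [hx (mem_univ x)]
  rw [h2, eq_comm, ENNReal.ofReal_eq_zero] at hmass
  exact not_lt.2 hmass hy

lemma minDaughter_mem_Icc {y : ℝ} (hy : 0 < y) (hb : Measurable fun x => b x y)
    (hmass : fragMoment b 1 y = ENNReal.ofReal y) (hzero : ∀ x, y < x → b x y = 0) :
    minDaughter a b y ∈ Icc 0 y := by
  rw [minDaughter]
  split_ifs with ha
  · exact ⟨hy.le, le_rfl⟩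
  · obtain ⟨x, hx⟩ := essSupport_nonempty hy hb hmass
    refine ⟨le_csInf ⟨x, hx⟩ fun t ht => nonneg_of_mem_essSupport ht,
      (csInf_le ⟨0, fun t ht => nonneg_of_mem_essSupport ht⟩ hx).trans ?_⟩
    by_contra hcon
    refine notMem_essSupport isOpen_Ioi ?_ (not_le.1 hcon) hx
    filter_upwards [ae_restrict_mem (measurableSet_Ioi.inter measurableSet_Ioi)] with t ht
    exact hzero t ht.1

/-- The restriction z ≤ y makes both sides true when a y = 0, where the smallest daughter is y
itself. -/
lemma le_minDaughter_iff {y z : ℝ} (hy : 0 < y) (hzy : z ≤ y) (hb : Measurable fun x => b x y)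
    (hmass : fragMoment b 1 y = ENNReal.ofReal y) :
    z ≤ minDaughter a b y ↔ (a y ≠ 0 → ∀ᵐ x ∂(volume.restrict (Ioo 0 z)), b x y = 0) := by
  rw [minDaughter]
  split_ifs with ha
  · simp [ha, hzy]
  rw [le_csInf_iff ⟨0, fun t ht => nonneg_of_mem_essSupport ht⟩ (essSupport_nonempty hy hb hmass)]
  simp only [ne_eq, ha, not_false_eq_true, true_imp_iff]
  constructor
  · intro h
    have h1 := ae_eq_zero_of_forall_notMem hb (s := Iio z) fun x hx hx' => not_lt.2 (h x hx') hx
    filter_upwards [ae_restrict_of_ae_restrict_of_subset Ioo_subset_Ioi_self h1,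
      ae_restrict_mem measurableSet_Ioo] with x hx hx0
    exact hx hx0.2
  · intro h t ht
    by_contra hcon
    have e : Iio z ∩ Ioi 0 = Ioo 0 z := by rw [inter_comm]; rfl
    rw [← e] at h
    exact notMem_essSupport isOpen_Iio h (not_le.1 hcon) ht

end Daughter

/-! ### The threshold -/

section Threshold

variable {a : ℝ → ℝ} {b : ℝ → ℝ → ℝ}

lemma ae_restrict_Ici_pos {z : ℝ} (hz : 0 ≤ z) : ∀ᵐ y ∂(volume.restrict (Ici z)), 0 < y := by
  rw [← restrict_Ioi_eq_restrict_Ici]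
  filter_upwards [ae_restrict_mem measurableSet_Ioi] with y hy
  exact hz.trans_lt hy

/-- A real-valued `essInf` is meaningful only with bounds: here 0 bounds the daughters from below,
and on [z, z + 1] they are at most z + 1, which bounds the admissible lower bounds. -/
lemma le_cMap_iff (hD : ∀ y, 0 < y → minDaughter a b y ∈ Icc 0 y) {z w : ℝ} (hz : 0 ≤ z) :
    w ≤ cMap a b z ↔ ∀ᵐ y ∂(volume.restrict (Ici z)), w ≤ minDaughter a b y := by
  have hpos := ae_restrict_Ici_pos hz
  have hbdd : IsBoundedUnder (· ≥ ·) (ae (volume.restrict (Ici z))) (minDaughter a b) :=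
    ⟨0, eventually_map.2 (hpos.mono fun y hy => (hD y hy).1)⟩
  have hne : (ae (volume.restrict (Icc z (z + 1)))).NeBot := by
    rw [ae_neBot, Ne, Measure.restrict_eq_zero, Real.volume_Icc]
    simp
  have hsub : volume.restrict (Icc z (z + 1)) ≤ volume.restrict (Ici z) :=
    Measure.restrict_mono Icc_subset_Ici_self le_rfl
  have hcob : IsCoboundedUnder (· ≥ ·) (ae (volume.restrict (Ici z))) (minDaughter a b) := by
    refine ⟨z + 1, fun t ht => ?_⟩
    have h1 := ae_mono hsub (eventually_map.1 ht)
    obtain ⟨y, ⟨hy1, hy2⟩, hy3⟩ := ((Filter.Eventually.and h1 (ae_mono hsub hpos)).and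
      (ae_restrict_mem measurableSet_Icc)).exists
    exact (hy1.trans (hD y hy2).2).trans hy3.2
  constructor
  · intro h
    filter_upwards [ae_essInf_le hbdd] with y hy
    exact h.trans hy
  · exact fun h => le_liminf_of_le hcob h

lemma cMap_le (hD : ∀ y, 0 < y → minDaughter a b y ∈ Icc 0 y) {z : ℝ} (hz : 0 ≤ z) :
    cMap a b z ≤ z := by
  refine le_of_forall_gt_imp_ge_of_dense fun t ht => ?_
  have h1 := (le_cMap_iff hD hz).1 le_rfl
  have hne : (ae (volume.restrict (Ioo z t))).NeBot := by
    rw [ae_neBot, Ne, Measure.restrict_eq_zero, Real.volume_Ioo]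
    simpa using ht
  have hs : Ioo z t ⊆ Ici z := fun x hx => hx.1.le
  obtain ⟨y, hy1, hy2⟩ := ((ae_restrict_of_ae_restrict_of_subset hs h1).and
    (ae_restrict_mem measurableSet_Ioo)).exists
  exact (hy1.trans (hD y (hz.trans_lt hy2.1)).2).trans hy2.2.le

lemma cMap_nonneg (hD : ∀ y, 0 < y → minDaughter a b y ∈ Icc 0 y) {z : ℝ} (hz : 0 ≤ z) :
    0 ≤ cMap a b z :=
  (le_cMap_iff hD hz).2 ((ae_restrict_Ici_pos hz).mono fun y hy => (hD y hy).1)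

lemma iterate_cMap_nonneg (hD : ∀ y, 0 < y → minDaughter a b y ∈ Icc 0 y) {z : ℝ} (hz : 0 ≤ z)
    (n : ℕ) : 0 ≤ (cMap a b)^[n] z := by
  induction n with
  | zero => exact hz
  | succ n ih =>
    rw [Function.iterate_succ_apply']
    exact cMap_nonneg hD ih

lemma antitone_iterate_cMap (hD : ∀ y, 0 < y → minDaughter a b y ∈ Icc 0 y) {z : ℝ}
    (hz : 0 ≤ z) : Antitone fun n : ℕ => (cMap a b)^[n] z := by
  refine antitone_nat_of_succ_le fun n => ?_
  rw [Function.iterate_succ_apply']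
  exact cMap_le hD (iterate_cMap_nonneg hD hz n)

lemma tendsto_cLim (hD : ∀ y, 0 < y → minDaughter a b y ∈ Icc 0 y) {z : ℝ} (hz : 0 ≤ z) :
    Tendsto (fun n : ℕ => (cMap a b)^[n] z) atTop (𝓝 (cLim a b z)) := by
  have h1 := tendsto_atTop_ciInf (antitone_iterate_cMap hD hz)
    ⟨0, by rintro _ ⟨n, rfl⟩; exact iterate_cMap_nonneg hD hz n⟩
  rwa [cLim, h1.limUnder_eq]

lemma cLim_nonneg (hD : ∀ y, 0 < y → minDaughter a b y ∈ Icc 0 y) {z : ℝ} (hz : 0 ≤ z) :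
    0 ≤ cLim a b z :=
  ge_of_tendsto' (tendsto_cLim hD hz) (iterate_cMap_nonneg hD hz)

/-- The limits of the iterates are fixed points. -/
lemma cLim_le_cMap_cLim (hD : ∀ y, 0 < y → minDaughter a b y ∈ Icc 0 y) {z : ℝ} (hz : 0 ≤ z) :
    cLim a b z ≤ cMap a b (cLim a b z) := by
  have ht := tendsto_cLim hD hz
  have hle := (antitone_iterate_cMap hD hz).le_of_tendsto ht
  have h0 := cLim_nonneg hD hz
  rw [le_cMap_iff hD h0, ← restrict_Ioi_eq_restrict_Ici]
  -- 𝔠 need not be continuous. Instead the half-lines starting at the iterates cover (𝔠_∞(z), ∞),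
  -- and on the n-th one the daughters are at least the next iterate, hence at least 𝔠_∞(z).
  have hsub : Ioi (cLim a b z) ⊆ ⋃ n : ℕ, Ici ((cMap a b)^[n] z) := fun y hy => by
    obtain ⟨n, hn⟩ := (ht.eventually (gt_mem_nhds (mem_Ioi.1 hy))).exists
    exact mem_iUnion.2 ⟨n, hn.le⟩
  refine ae_restrict_of_ae_restrict_of_subset hsub ((ae_restrict_iUnion_iff _ _).2 fun n => ?_)
  rw [← le_cMap_iff hD (iterate_cMap_nonneg hD hz n), ← Function.iterate_succ_apply' (cMap a b)]
  exact hle (n + 1)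

lemma cLim_eq_self (hD : ∀ y, 0 < y → minDaughter a b y ∈ Icc 0 y) {z : ℝ} (hz : 0 ≤ z)
    (h : z ≤ cMap a b z) : cLim a b z = z := by
  have h1 : ∀ n : ℕ, (cMap a b)^[n] z = z :=
    Function.iterate_fixed (le_antisymm (cMap_le hD hz) h)
  refine tendsto_nhds_unique (tendsto_cLim hD hz) ?_
  simp only [h1]
  exact tendsto_const_nhds

lemma coe_cLim_le_cBar {z : ℝ} (hz : 0 < z) : (cLim a b z : EReal) ≤ cBar a b :=
  le_iSup₂ (f := fun (z : ℝ) (_ : z ∈ Ioi (0 : ℝ)) => (cLim a b z : EReal)) z hz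

lemma exists_lt_cLim_of_lt_cBar {w : EReal} (h : w < cBar a b) :
    ∃ z : ℝ, 0 < z ∧ w < cLim a b z := by
  rw [cBar, lt_iSup_iff] at h
  obtain ⟨z, hz⟩ := h
  obtain ⟨hz0, hw⟩ := lt_iSup_iff.1 hz
  exact ⟨z, hz0, hw⟩

/-- A finite value of the threshold is a fixed point. -/
lemma le_cMap_of_cBar_eq (hD : ∀ y, 0 < y → minDaughter a b y ∈ Icc 0 y) {s : ℝ} (hs : 0 ≤ s)
    (h : cBar a b = s) : s ≤ cMap a b s := by
  refine le_of_forall_lt_imp_le_of_dense fun w hw => ?_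
  -- For w < s there is a fixed point 𝔠_∞(z) in (w, s]; its lower bound on daughters holds on [s, ∞)
  -- in particular.
  have h1 : (w : EReal) < cBar a b := by rw [h]; exact EReal.coe_lt_coe_iff.2 hw
  obtain ⟨z, hz, hwz⟩ := exists_lt_cLim_of_lt_cBar h1
  have hz0 : (0 : ℝ) ≤ z := hz.le
  have h2 : cLim a b z ≤ s := by
    rw [← EReal.coe_le_coe_iff, ← h]; exact coe_cLim_le_cBar hz
  have h3 := (le_cMap_iff hD (cLim_nonneg hD hz0)).1 (cLim_le_cMap_cLim hD hz0)
  rw [le_cMap_iff hD hs]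
  filter_upwards [ae_restrict_of_ae_restrict_of_subset (Ici_subset_Ici.2 h2) h3] with y hy
  exact (EReal.coe_lt_coe_iff.1 hwz).le.trans hy

/-- Comparison of the threshold with the fixed points above which there is no mass of `S`. -/
lemma forall_fixedPoint_lt_iff (hD : ∀ y, 0 < y → minDaughter a b y ∈ Icc 0 y) (S : EReal) :
    (∀ z : ℝ, 0 < z → z ≤ cMap a b z → (z : EReal) < S) ↔
      S = ⊤ ∨ cBar a b < S ∨ cBar a b = 0 := by
  constructor
  · intro H
    by_contra hcon
    push Not at hcon
    obtain ⟨h1, h2, h3⟩ := hcon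
    have hc0 : 0 < cBar a b := by
      refine lt_of_le_of_ne ?_ h3.symm
      exact (EReal.coe_nonneg.2 (cLim_nonneg hD zero_le_one)).trans (coe_cLim_le_cBar zero_lt_one)
    -- The maximum with 0 covers S = -∞ as well. If it lies strictly below c̄, some 𝔠_∞(z) is a
    -- positive fixed point exceeding S.
    rcases (max_le h2 hc0.le).lt_or_eq with h4 | h4
    · obtain ⟨z, hz, h5⟩ := exists_lt_cLim_of_lt_cBar h4
      have h6 := max_lt_iff.1 h5
      exact lt_asymm h6.1 (H _ (EReal.coe_pos.1 h6.2) (cLim_le_cMap_cLim hD hz.le))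
    · have h5 : S = cBar a b := by
        rcases max_choice S 0 with h6 | h6
        · rw [← h4, h6]
        · rw [h6] at h4
          exact absurd h4 hc0.ne
      have h6 : ∃ s : ℝ, cBar a b = s := by
        refine ⟨(cBar a b).toReal, (EReal.coe_toReal (h5 ▸ h1) ?_).symm⟩
        exact (bot_lt_iff_ne_bot.1 (EReal.bot_lt_zero.trans hc0))
      obtain ⟨s, hs⟩ := h6
      have hs0 : 0 < s := by rwa [hs, EReal.coe_pos] at hc0
      have h7 := H s hs0 (le_cMap_of_cBar_eq hD hs0.le hs)
      rw [h5, hs] at h7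
      exact lt_irrefl _ h7
  · intro H z hz hzc
    have h1 : (z : EReal) ≤ cBar a b := by
      rw [← cLim_eq_self hD hz.le hzc]
      exact_mod_cast coe_cLim_le_cBar hz
    rcases H with H | H | H
    · rw [H]; exact EReal.coe_lt_top z
    · exact h1.trans_lt H
    · rw [H] at h1
      exact absurd (EReal.coe_nonpos.1 h1) (not_le.2 hz)

/-- Both halves are pointwise translations: the fragment condition at mother size y says z ≤ 𝔟(y),
and a single endpoint does not affect the essential infimum. -/
lemma isTrap_iff {β : ℝ → ℝ} (hβ : Measurable β) (hb : Measurable (Function.uncurry b))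
    (hmass : ∀ y, 0 < y → fragMoment b 1 y = ENNReal.ofReal y)
    (hzero : ∀ x y, 0 < y → y < x → b x y = 0) {z : ℝ} (hz : 0 < z) :
    Coeffs.IsTrap a β b z ↔ z ≤ cMap a b z ∧ supSupp β ≤ z := by
  have hby : ∀ y, Measurable fun x => b x y := fun y => hb.comp measurable_prodMk_right
  have hD : ∀ y, 0 < y → minDaughter a b y ∈ Icc 0 y := fun y hy =>
    minDaughter_mem_Icc hy (hby y) (hmass y hy) fun x hx => hzero x y hy hx
  rw [Coeffs.IsTrap, supSupp_le_iff hβ hz.le, le_cMap_iff hD hz.le, ← restrict_Ioi_eq_restrict_Ici]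
  refine and_congr_left fun _ => eventually_congr ?_
  filter_upwards [ae_restrict_mem measurableSet_Ioi] with y hy
  have hy0 : z < y := hy
  rw [le_minDaughter_iff (hz.trans hy0) hy0.le (hby y) (hmass y (hz.trans hy0))]

/-- Absence of traps in terms of the threshold. -/
theorem forall_not_isTrap_iff {β : ℝ → ℝ} (hβ : Measurable β)
    (hb : Measurable (Function.uncurry b))
    (hmass : ∀ y, 0 < y → fragMoment b 1 y = ENNReal.ofReal y)
    (hzero : ∀ x y, 0 < y → y < x → b x y = 0) :
    (∀ z, 0 < z → ¬ Coeffs.IsTrap a β b z) ↔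
      supSupp β = ⊤ ∨ cBar a b < supSupp β ∨ cBar a b = 0 := by
  have hby : ∀ y, Measurable fun x => b x y := fun y => hb.comp measurable_prodMk_right
  have hD : ∀ y, 0 < y → minDaughter a b y ∈ Icc 0 y := fun y hy =>
    minDaughter_mem_Icc hy (hby y) (hmass y hy) fun x hx => hzero x y hy hx
  rw [← forall_fixedPoint_lt_iff hD]
  refine forall₂_congr fun z hz => ?_
  rw [isTrap_iff hβ hb hmass hzero hz, not_and, not_le]

end Threshold

/-! ### Moments of the fragmentation kernel -/

/-- The real `liminf` is the supremum of the eventual lower bounds, with value 0 when there are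
none; positivity excludes that default. -/
lemma exists_pos_eventually_le_of_liminf_pos {f : ℝ → ℝ} (h : 0 < liminf f atTop) :
    ∃ c, 0 < c ∧ ∀ᶠ y in atTop, c ≤ f y := by
  rw [liminf_eq] at h
  have hne : {c | ∀ᶠ y in atTop, c ≤ f y}.Nonempty := by
    by_contra hcon
    rw [not_nonempty_iff_eq_empty] at hcon
    rw [hcon, Real.sSup_empty] at h
    exact lt_irrefl _ h
  obtain ⟨c, hc, hc0⟩ := exists_lt_of_lt_csSup hne h
  exact ⟨c, hc0, hc⟩

/-- For p ≥ q powers of t ≤ 1 decrease; for p < q this is Bernoulli's inequality for the concave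
power p / q at t^q. It transfers a defect of one moment to another. -/
lemma rpow_le_convex_comb {p q t : ℝ} (hp : 0 ≤ p) (hq : 0 < q) (ht : 0 < t) (ht1 : t ≤ 1) :
    t ^ p ≤ 1 - min 1 (p / q) * (1 - t ^ q) := by
  rcases le_total q p with hqp | hqp
  · rw [min_eq_left ((one_le_div hq).2 hqp)]
    have := Real.rpow_le_rpow_of_exponent_ge ht ht1 hqp
    linarith
  · have h1 : p / q ≤ 1 := (div_le_one hq).2 hqp
    have h2 := rpow_one_add_le_one_add_mul_self (s := t ^ q - 1) (p := p / q)
      (by have := Real.rpow_nonneg ht.le q; linarith) (div_nonneg hp hq.le) h1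
    rw [add_sub_cancel, ← Real.rpow_mul ht.le, mul_div_cancel₀ _ hq.ne'] at h2
    rw [min_eq_right h1]
    linarith

lemma rpow_le_one_add_rpow {k m x : ℝ} (hk : 0 ≤ k) (hkm : k ≤ m) (hx : 0 < x) :
    x ^ k ≤ 1 + x ^ m := by
  have hm := Real.rpow_nonneg hx.le m
  rcases le_total x 1 with h | h
  · have := Real.rpow_le_one hx.le h hk
    linarith
  · have := Real.rpow_le_rpow_of_exponent_le h hkm
    linarith

section Moments

variable {b : ℝ → ℝ → ℝ} {m m₀ y : ℝ}

/-- Interpolation of moments. -/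
lemma fragMoment_le (hb : Measurable fun x => b x y) (hb0 : ∀ x, 0 < x → 0 ≤ b x y) (hy : 0 < y)
    {θ : ℝ} (hθ : 0 ≤ θ) (hθ1 : θ ≤ 1)
    (H : ∀ t, 0 < t → t ≤ 1 → t ^ (m - 1) ≤ 1 - θ * (1 - t ^ (m₀ - 1))) :
    fragMoment b m y ≤ ENNReal.ofReal ((1 - θ) * y ^ (m - 1)) * fragMoment b 1 y +
      ENNReal.ofReal (θ * y ^ (m - m₀)) * fragMoment b m₀ y := by
  have hm : ∀ k : ℝ, Measurable fun x => ENNReal.ofReal (x ^ k * b x y) := fun k =>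
    ((measurable_id.pow_const k).mul hb).ennreal_ofReal
  rw [fragMoment, fragMoment, fragMoment, ← lintegral_const_mul _ (hm 1),
    ← lintegral_const_mul _ (hm m₀), ← lintegral_add_left ((hm 1).const_mul _)]
  refine setLIntegral_mono' measurableSet_Ioc fun x hx => ?_
  have hx0 := hx.1
  have hbx := hb0 x hx0
  have h1 : 0 ≤ (1 - θ) * y ^ (m - 1) := mul_nonneg (by linarith) (by positivity)
  have h2 : 0 ≤ θ * y ^ (m - m₀) := by positivity
  rw [← ENNReal.ofReal_mul h1, ← ENNReal.ofReal_mul h2, ← ENNReal.ofReal_add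
    (mul_nonneg h1 (by positivity)) (mul_nonneg h2 (by positivity))]
  refine ENNReal.ofReal_le_ofReal ?_
  -- Splitting off the mass factor x leaves powers of the relative size x / y with exponents m - 1
  -- and m₀ - 1.
  have h3 := H (x / y) (by positivity) ((div_le_one hy).2 hx.2)
  have e1 : x ^ m = y ^ (m - 1) * x * (x / y) ^ (m - 1) := by
    rw [Real.div_rpow hx0.le hy.le, Real.rpow_sub_one hx0.ne']
    field_simp
  have e2 : y ^ (m - m₀) * x ^ m₀ = y ^ (m - 1) * x * (x / y) ^ (m₀ - 1) := by
    rw [Real.div_rpow hx0.le hy.le, Real.rpow_sub_one hx0.ne', Real.rpow_sub_one hy.ne',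
      Real.rpow_sub_one hy.ne', Real.rpow_sub hy]
    field_simp
  have h4 : x ^ m ≤ (1 - θ) * (y ^ (m - 1) * x) + θ * (y ^ (m - m₀) * x ^ m₀) := by
    rw [e1, e2]
    have := mul_le_mul_of_nonneg_left h3 (by positivity : 0 ≤ y ^ (m - 1) * x)
    linarith
  rw [Real.rpow_one]
  have := mul_le_mul_of_nonneg_right h4 hbx
  linarith

lemma fragMoment_le_rpow (hm : 1 < m) (hb : Measurable fun x => b x y)
    (hb0 : ∀ x, 0 < x → 0 ≤ b x y)
    (hy : 0 < y) (hmass : fragMoment b 1 y = ENNReal.ofReal y) :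
    fragMoment b m y ≤ ENNReal.ofReal (y ^ m) := by
  have h1 := fragMoment_le (m := m) (m₀ := m) hb hb0 hy le_rfl zero_le_one fun t ht ht1 => by
    simpa using Real.rpow_le_one ht.le ht1 (by linarith)
  rw [hmass] at h1
  simp only [sub_zero, one_mul, zero_mul, ENNReal.ofReal_zero, add_zero] at h1
  rwa [← ENNReal.ofReal_mul (by positivity), Real.rpow_sub_one hy.ne',
    div_mul_cancel₀ _ hy.ne'] at h1

/-- Interpolation with p = m - 1, q = m₀ - 1: the first moment is conserved and the m₀-th is reduced
by the factor 1 - c, so the total factor is (1 - θ) + θ (1 - c) = 1 - θ c. -/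
lemma fragMoment_le_of_defect (hm₀ : 1 < m₀) (hm : 1 < m) (hb : Measurable fun x => b x y)
    (hb0 : ∀ x, 0 < x → 0 ≤ b x y) (hy : 0 < y) (hmass : fragMoment b 1 y = ENNReal.ofReal y)
    {c : ℝ} (hc : c ≤ momentDefect b m₀ y / y ^ m₀) :
    fragMoment b m y ≤ ENNReal.ofReal ((1 - min 1 ((m - 1) / (m₀ - 1)) * c) * y ^ m) := by
  set θ := min 1 ((m - 1) / (m₀ - 1)) with hθ
  have hθ0 : 0 ≤ θ := le_min zero_le_one (div_nonneg (by linarith) (by linarith))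
  have hθ1 : θ ≤ 1 := min_le_left _ _
  have h1 := fragMoment_le (m := m) (m₀ := m₀) hb hb0 hy hθ0 hθ1 fun t ht ht1 =>
    rpow_le_convex_comb (by linarith) (by linarith) ht ht1
  have hfin : fragMoment b m₀ y ≠ ⊤ :=
    ne_top_of_le_ne_top ENNReal.ofReal_ne_top (fragMoment_le_rpow hm₀ hb hb0 hy hmass)
  have hy0 := Real.rpow_pos_of_pos hy m₀
  have h2 : (fragMoment b m₀ y).toReal ≤ (1 - c) * y ^ m₀ := by
    rw [le_div_iff₀ hy0, momentDefect] at hc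
    linarith
  have h3 : fragMoment b m₀ y ≤ ENNReal.ofReal ((1 - c) * y ^ m₀) :=
    (ENNReal.le_ofReal_iff_toReal_le hfin (ENNReal.toReal_nonneg.trans h2)).2 h2
  refine h1.trans ?_
  rw [hmass]
  refine (add_le_add le_rfl (mul_le_mul_right h3 _)).trans ?_
  have p1 : 0 ≤ (1 - θ) * y ^ (m - 1) := mul_nonneg (by linarith) (by positivity)
  have p2 : 0 ≤ θ * y ^ (m - m₀) := by positivity
  rw [← ENNReal.ofReal_mul p1, ← ENNReal.ofReal_mul p2, ← ENNReal.ofReal_add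
    (mul_nonneg p1 hy.le) (mul_nonneg p2 (ENNReal.toReal_nonneg.trans h2))]
  refine ENNReal.ofReal_le_ofReal (le_of_eq ?_)
  rw [Real.rpow_sub_one hy.ne', Real.rpow_sub hy]
  field_simp
  ring

end Moments

/-! ### Verification of the standing assumptions -/

lemma operatorGraph_congr {r r' a β : ℝ → ℝ} {b : ℝ → ℝ → ℝ} {m : ℝ}
    (h : ∀ x, 0 < x → r x = r' x) : operatorGraph r a β b m = operatorGraph r' a β b m := by
  have key : ∀ (r r' : ℝ → ℝ), (∀ x, 0 < x → r x = r' x) →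
      operatorGraph r a β b m ⊆ operatorGraph r' a β b m := by
    rintro r r' h p ⟨w, h1, h2, h3, ⟨G, hG, hGe, hG0⟩, h5⟩
    have e : ∀ᵐ x ∂(volume.restrict (Ioi (0 : ℝ))), r' x * p.1 x = r x * p.1 x := by
      filter_upwards [ae_restrict_mem measurableSet_Ioi] with x hx
      rw [h x hx]
    refine ⟨w, h1.congr_ae e, h2, h3, ⟨G, hG, ?_, hG0⟩, h5⟩
    filter_upwards [hGe, e] with x hx1 hx2
    rw [hx1, hx2]
  exact Subset.antisymm (key r r' h) (key r' r fun x hx => (h x hx).symm)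

lemma integrableOn_Ioc_of_continuousOn {f : ℝ → ℝ} (hf : ContinuousOn f (Ioi 0))
    (h1 : IntegrableOn f (Ioc 0 1)) (M : ℝ) : IntegrableOn f (Ioc 0 M) := by
  have h2 : IntegrableOn f (Icc 1 M) :=
    (hf.mono fun x hx => zero_lt_one.trans_le hx.1).integrableOn_Icc
  refine (h1.union h2).mono_set fun x hx => ?_
  rcases le_total x 1 with h | h
  · exact Or.inl ⟨hx.1, h⟩
  · exact Or.inr ⟨h, hx.2⟩

/-- The standing assumptions hold for a suitable weight. -/
theorem exists_coeffs {r a β : ℝ → ℝ} {b : ℝ → ℝ → ℝ} {m l r₀ b₀ : ℝ}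
    (hr_meas : Measurable r)
    (hr_cont : ContinuousOn r (Ioi 0)) (hr_pos : ∀ x, 0 < x → 0 < r x)
    (hr_le : ∀ x, 0 < x → r x ≤ r₀ * (1 + x))
    (hr_zero : IntegrableOn (fun x => 1 / r x) (Ioc 0 1))
    (ha_meas : Measurable a) (ha_nonneg : ∀ x, 0 < x → 0 ≤ a x)
    (ha_bdd : ∀ M : ℝ, ∃ C : ℝ, ∀ᵐ x ∂(volume.restrict (Ioc 0 M)), a x ≤ C)
    (hb_meas : Measurable (Function.uncurry b))
    (hb_nonneg : ∀ x y, 0 < x → 0 < y → 0 ≤ b x y)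
    (hb_mass : ∀ y, 0 < y → fragMoment b 1 y = ENNReal.ofReal y)
    (hl : 0 ≤ l)
    (hb_number : ∀ y, 0 < y → fragMoment b 0 y ≤ ENNReal.ofReal (b₀ * (1 + y ^ l)))
    (hb_liminf : ∃ m₀ : ℝ, 1 < m₀ ∧ 0 < liminf (fun y : ℝ => momentDefect b m₀ y / y ^ m₀) atTop)
    (hm : 1 < m) (hlm : l ≤ m)
    (hβ_meas : Measurable β) (hβ_nonneg : ∀ x, 0 < x → 0 ≤ β x)
    (hβ_bdd : ∃ C : ℝ, ∀ᵐ x ∂(volume.restrict (Ioi 0)), β x ≤ C * (1 + x ^ m)) :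
    ∃ κ η C : ℝ, Coeffs r a β b m κ η C := by
  obtain ⟨m₀, hm₀, hlim⟩ := hb_liminf
  obtain ⟨c₀, hc₀, hev⟩ := exists_pos_eventually_le_of_liminf_pos hlim
  obtain ⟨Y₀, hY₀⟩ := eventually_atTop.1 hev
  set Y := max Y₀ 1 with hY
  have hY1 : 1 ≤ Y := le_max_right _ _
  have hbm : ∀ y, Measurable fun x => b x y := fun y => hb_meas.comp measurable_prodMk_right
  have hb0 : ∀ y, 0 < y → ∀ x, 0 < x → 0 ≤ b x y := fun y hy x hx => hb_nonneg x y hx hy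
  -- The fraction of the m-th moment lost by mothers larger than Y; the cap at 1 keeps 1 - c
  -- non-negative.
  set c := min 1 (min 1 ((m - 1) / (m₀ - 1)) * c₀) with hc
  have hcpos : 0 < c := lt_min one_pos (mul_pos (lt_min one_pos
    (div_pos (by linarith) (by linarith))) hc₀)
  have hc1 : c ≤ 1 := min_le_left _ _
  have hmoment : ∀ y, Y ≤ y → fragMoment b m y ≤ ENNReal.ofReal ((1 - c) * y ^ m) := by
    intro y hy
    have hy0 : 0 < y := by linarith
    refine (fragMoment_le_of_defect hm₀ hm (hbm y) (hb0 y hy0) hy0 (hb_mass y hy0)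
      (hY₀ y ((le_max_left _ _).trans hy))).trans (ENNReal.ofReal_le_ofReal ?_)
    have : c ≤ min 1 ((m - 1) / (m₀ - 1)) * c₀ := min_le_right _ _
    gcongr
  set B := max b₀ 0 with hB
  have hB0 : 0 ≤ B := le_max_right _ _
  have hnumber : ∀ y, 0 < y → fragMoment b 0 y ≤ ENNReal.ofReal (B * (2 + y ^ m)) := by
    intro y hy
    refine (hb_number y hy).trans (ENNReal.ofReal_le_ofReal ?_)
    have h1 := rpow_le_one_add_rpow hl hlm hy
    have h2 : 0 ≤ y ^ l := Real.rpow_nonneg hy.le l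
    have h3 : b₀ ≤ B := le_max_left _ _
    nlinarith
  -- For y ≥ 1 the number of fragments is at most B (2 + y^m) ≤ 3 B y^m ≤ (κ c / 2) y^m. It uses up
  -- half of the moment loss κ c y^m, which leaves η = c / 2.
  set κ := max 1 (6 * B / c) with hκ
  have hκ1 : 1 ≤ κ := le_max_left _ _
  have hκ2 : 6 * B ≤ κ * c := by
    rw [← div_le_iff₀ hcpos]; exact le_max_right _ _
  obtain ⟨D, hD⟩ := ha_bdd Y
  set D' := max D 0 with hD'
  have hD0 : 0 ≤ D' := le_max_right _ _
  obtain ⟨Cβ, hCβ⟩ := hβ_bdd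
  -- The summands pay for fragmentation of sizes up to Y, where a is bounded by D', for the drift of
  -- the weight, and for births.
  set C := D' * (2 * B + 1) + 2 * m * κ * |r₀| + |Cβ| with hC
  have hC1 : 0 ≤ D' * (2 * B + 1) := by positivity
  have hC2 : 0 ≤ 2 * m * κ * |r₀| := by positivity
  have hC3 : 0 ≤ |Cβ| := abs_nonneg _
  have hsum : ∀ y, 0 < y → ∫⁻ x in Ioo 0 y, ENNReal.ofReal (wt κ m x * b x y) ≤
      fragMoment b 0 y + ENNReal.ofReal κ * fragMoment b m y := by
    intro y hy
    have hmk : ∀ k : ℝ, Measurable fun x => ENNReal.ofReal (x ^ k * b x y) := fun k =>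
      ((measurable_id.pow_const k).mul (hbm y)).ennreal_ofReal
    rw [fragMoment, fragMoment, ← lintegral_const_mul _ (hmk m), ← lintegral_add_left (hmk 0)]
    refine (lintegral_mono_set Ioo_subset_Ioc_self).trans
      (setLIntegral_mono' measurableSet_Ioc fun x hx => ?_)
    have hx0 := hx.1
    have hbx := hb_nonneg x y hx.1 hy
    rw [← ENNReal.ofReal_mul (by positivity), ← ENNReal.ofReal_add (by positivity) (by positivity),
      Real.rpow_zero, wt]
    exact ENNReal.ofReal_le_ofReal (le_of_eq (by ring))
  refine ⟨κ, c / 2, C, hr_meas, hr_cont, hr_pos, ?_, hm, hκ1, by positivity, by linarith,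
    by positivity, ?_, ha_meas, ha_nonneg, ha_bdd, hb_meas, hb_nonneg, ?_, hβ_meas, hβ_nonneg, ?_⟩
  · exact integrableOn_Ioc_of_continuousOn
      (continuousOn_const.div hr_cont fun x hx => (hr_pos x hx).ne') hr_zero
  · intro x hx
    have h1 := rpow_le_one_add_rpow (k := m - 1) (m := m) (by linarith) (by linarith) hx
    have h2 : 0 ≤ x ^ m := Real.rpow_nonneg hx.le m
    have h3 : x ^ (m - 1) * x = x ^ m := by
      rw [Real.rpow_sub_one hx.ne', div_mul_cancel₀ _ hx.ne']
    have h4 : 0 ≤ x ^ (m - 1) := Real.rpow_nonneg hx.le _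
    have h5 : r x ≤ |r₀| * (1 + x) :=
      (hr_le x hx).trans (mul_le_mul_of_nonneg_right (le_abs_self r₀) (by linarith))
    calc κ * (m * x ^ (m - 1)) * r x ≤ κ * (m * x ^ (m - 1)) * (|r₀| * (1 + x)) := by gcongr
      _ = κ * m * |r₀| * (x ^ (m - 1) + x ^ (m - 1) * x) := by ring
      _ ≤ κ * m * |r₀| * (1 + x ^ m + x ^ m) := by rw [h3]; gcongr
      _ ≤ κ * m * |r₀| * (2 * (1 + κ * x ^ m)) := by
          gcongr
          nlinarith
      _ = 2 * m * κ * |r₀| * wt κ m x := by rw [wt]; ring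
      _ ≤ C * wt κ m x := by
          have := one_le_wt (m := m) hκ1 hx
          gcongr
          linarith
  · rw [ae_restrict_iff' measurableSet_Ioc] at hD
    filter_upwards [ae_restrict_of_ae hD, ae_restrict_mem measurableSet_Ioi] with y hy hy0
    have hy0' : 0 < y := hy0
    have hay := ha_nonneg y hy0'
    have hym : 0 ≤ y ^ m := Real.rpow_nonneg hy0'.le m
    have hwy := one_le_wt (m := m) hκ1 hy0'
    rcases le_or_gt y Y with hle | hgt
    · have ha : a y ≤ D' := (hy ⟨hy0', hle⟩).trans (le_max_left _ _)
      calc _ ≤ ENNReal.ofReal D' * (ENNReal.ofReal (B * (2 + y ^ m)) +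
            ENNReal.ofReal κ * ENNReal.ofReal (y ^ m)) := by
            gcongr
            exact (hsum y hy0').trans (by
              gcongr
              · exact hnumber y hy0'
              · exact fragMoment_le_rpow hm (hbm y) (hb0 y hy0') hy0' (hb_mass y hy0'))
        _ = ENNReal.ofReal (D' * (B * (2 + y ^ m) + κ * y ^ m)) := by
            rw [← ENNReal.ofReal_mul (by positivity), ← ENNReal.ofReal_add (by positivity)
              (by positivity), ← ENNReal.ofReal_mul hD0]
        _ ≤ _ := by
            refine ENNReal.ofReal_le_ofReal ?_
            have h1 : B * (2 + y ^ m) + κ * y ^ m ≤ (2 * B + 1) * wt κ m y := by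
              rw [wt]
              have := mul_nonneg hB0 hym
              nlinarith [mul_le_mul_of_nonneg_right hκ1 this]
            calc D' * (B * (2 + y ^ m) + κ * y ^ m) ≤ D' * ((2 * B + 1) * wt κ m y) := by gcongr
              _ = D' * (2 * B + 1) * wt κ m y := by ring
              _ ≤ _ := by
                gcongr
                have : 0 ≤ (1 - c / 2) * a y := mul_nonneg (by linarith) hay
                linarith
    · have hy1 : 1 ≤ y ^ m := Real.one_le_rpow (hY1.trans hgt.le) (by linarith)
      have hcc : 0 ≤ (1 - c) * y ^ m := mul_nonneg (by linarith) hym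
      calc _ ≤ ENNReal.ofReal (a y) * (ENNReal.ofReal (B * (2 + y ^ m)) +
            ENNReal.ofReal κ * ENNReal.ofReal ((1 - c) * y ^ m)) := by
            gcongr
            exact (hsum y hy0').trans (by
              gcongr
              · exact hnumber y hy0'
              · exact hmoment y hgt.le)
        _ = ENNReal.ofReal (a y * (B * (2 + y ^ m) + κ * ((1 - c) * y ^ m))) := by
            rw [← ENNReal.ofReal_mul (by positivity), ← ENNReal.ofReal_add (by positivity)
              (by positivity), ← ENNReal.ofReal_mul hay]
        _ ≤ _ := by
            refine ENNReal.ofReal_le_ofReal ?_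
            have h1 : B * (2 + y ^ m) + κ * ((1 - c) * y ^ m) ≤ (1 - c / 2) * wt κ m y := by
              rw [wt]
              have h2 : B * (2 + y ^ m) ≤ κ * c / 2 * y ^ m := by
                nlinarith [mul_le_mul_of_nonneg_left hy1 hB0]
              nlinarith
            calc a y * (B * (2 + y ^ m) + κ * ((1 - c) * y ^ m))
                ≤ a y * ((1 - c / 2) * wt κ m y) := by gcongr
              _ = (1 - c / 2) * a y * wt κ m y := by ring
              _ ≤ _ := by
                gcongr
                linarith
  · filter_upwards [hCβ, ae_restrict_mem measurableSet_Ioi] with x hx hx0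
    have h2 : 0 ≤ x ^ m := Real.rpow_nonneg (mem_Ioi.1 hx0).le m
    have hwy := one_le_wt (m := m) hκ1 hx0
    calc β x ≤ Cβ * (1 + x ^ m) := hx
      _ ≤ |Cβ| * wt κ m x := by
          rw [wt]
          refine mul_le_mul (le_abs_self _) ?_ (by positivity) (abs_nonneg _)
          nlinarith
      _ ≤ C * wt κ m x := by
          gcongr
          linarith

end GrowthFrag

end

/-! ### The generation and irreducibility theorem -/

theorem mainTheorem3
    (r a β : ℝ → ℝ) (b : ℝ → ℝ → ℝ) (m l r₀ b₀ : ℝ)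
    -- transport coefficient
    (hr_cont : ContinuousOn r (Ioi 0))
    (hr_pos : ∀ x, 0 < x → 0 < r x)
    (hr_le : ∀ x, 0 < x → r x ≤ r₀ * (1 + x))
    (hr_zero : IntegrableOn (fun x => 1 / r x) (Ioc 0 1))
    -- fragmentation rate
    (ha_meas : Measurable a)
    (ha_nonneg : ∀ x, 0 < x → 0 ≤ a x)
    (ha_bdd : ∀ M : ℝ, ∃ C : ℝ, ∀ᵐ x ∂(volume.restrict (Ioc 0 M)), a x ≤ C)
    -- fragmentation kernel
    (hb_meas : Measurable (Function.uncurry b))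
    (hb_nonneg : ∀ x y, 0 < x → 0 < y → 0 ≤ b x y)
    (hb_zero : ∀ x y, 0 < y → y < x → b x y = 0)
    (hb_mass : ∀ y, 0 < y → GrowthFrag.fragMoment b 1 y = ENNReal.ofReal y)
    (hl : 0 ≤ l)
    (hb_number : ∀ y, 0 < y → GrowthFrag.fragMoment b 0 y ≤ ENNReal.ofReal (b₀ * (1 + y ^ l)))
    (hb_liminf : ∃ m₀ : ℝ, 1 < m₀ ∧
      0 < liminf (fun y : ℝ => GrowthFrag.momentDefect b m₀ y / y ^ m₀) atTop)
    -- exponent of the state space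
    (hm : 1 < m) (hlm : l ≤ m)
    -- birth rate
    (hβ_meas : Measurable β)
    (hβ_nonneg : ∀ x, 0 < x → 0 ≤ β x)
    (hβ_bdd : ∃ C : ℝ, ∀ᵐ x ∂(volume.restrict (Ioi 0)), β x ≤ C * (1 + x ^ m)) :
    (∃ S : ℝ≥0 → GrowthFrag.XSpace m →L[ℝ] GrowthFrag.XSpace m,
      GrowthFrag.IsSemigroupGeneratedBy S (GrowthFrag.operatorGraph r a β b m)) ∧
    ∀ S : ℝ≥0 → GrowthFrag.XSpace m →L[ℝ] GrowthFrag.XSpace m,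
      GrowthFrag.IsSemigroupGeneratedBy S (GrowthFrag.operatorGraph r a β b m) →
        GrowthFrag.IsPositiveSemigroup S ∧
        (GrowthFrag.IsIrreducibleSemigroup S ↔
          GrowthFrag.supSupp β = ⊤ ∨
          GrowthFrag.cBar a b < GrowthFrag.supSupp β ∨
          GrowthFrag.cBar a b = 0) := by
  -- Continuity is assumed only on (0, ∞); the value 1 elsewhere yields a measurable function on ℝ,
  -- and the operator sees r only on (0, ∞).
  set r' : ℝ → ℝ := (Ioi (0 : ℝ)).piecewise r 1 with hr'
  have hrr : ∀ x, 0 < x → r x = r' x := fun x hx => (piecewise_eq_of_mem _ r 1 (mem_Ioi.2 hx)).symm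
  have hmeas : Measurable r' :=
    hr_cont.measurable_piecewise continuousOn_const measurableSet_Ioi
  obtain ⟨κ, η, C, h⟩ := GrowthFrag.exists_coeffs (r := r') (r₀ := r₀) hmeas
    (hr_cont.congr fun x hx => (hrr x hx).symm) (fun x hx => hrr x hx ▸ hr_pos x hx)
    (fun x hx => hrr x hx ▸ hr_le x hx)
    (hr_zero.congr_fun (fun x hx => by simp only [hrr x hx.1]) measurableSet_Ioc)
    ha_meas ha_nonneg ha_bdd hb_meas hb_nonneg hb_mass hl hb_number hb_liminf hm hlm
    hβ_meas hβ_nonneg hβ_bdd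
  rw [GrowthFrag.operatorGraph_congr hrr]
  refine ⟨h.isQuasiDissipative.exists_isSemigroupGeneratedBy, fun S hS =>
    ⟨h.isPositiveSemigroup hS, ?_⟩⟩
  rw [h.isIrreducibleSemigroup_iff hS]
  exact GrowthFrag.forall_not_isTrap_iff hβ_meas hb_meas hb_mass hb_zero
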